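/- **Setting.** Let $G=(V,E)$ be a simple graph with $n\ge 2$ vertices. The edges $e_1,\dots,e_T$ ($T \ge 1$) are independent, uniformly random elements of $E$ and arrive one by one; an online algorithm knows $G$ and must orient every edge irrevocably on arrival. The discrepancy of a vertex at time $t$ is its in-degree minus its out-degree among the first $t$ oriented edges. For a graph $H$ and a set $S$ of its vertices let $\mathrm{vol}(S)$ be the sum of the $H$-degrees in $S$. The graph $H$ is an *$\alpha$-expander* if $|E(S,V(H)\setminus S)|\ge \alpha\min\{\mathrm{vol}(S),\mathrm{vol}(V(H)\setminus S)\}$ for all $S\subseteq V(H)$, and it is *$\gamma$-weakly-regular* if every vertex of $H$ has degree at least $\gamma$ times the average degree. An *$(\alpha,K)$-expander decomposition* of $G$ is a family $G_1,\dots,G_m$ of subgraphs of $G$ such that every edge of $G$ lies in exactly one $G_i$, every $G_i$ is an $\frac{\alpha}{4}$-weakly-regular $\alpha$-expander, and every vertex of $G$ lies in at most $K$ of the $G_i$. *Piecewise greedy* with respect to the decomposition means: an arriving edge $\{u,v\}$ of $G_i$ is oriented from $u$ to $v$ only if the discrepancy of $u$, counted among the earlier arrivals in $G_i$ only, is at least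 that of $v$ (ties are broken arbitrarily). **Theorem 1.** (a) There are a deterministic polynomial-time online algorithm (preprocessing $G$ takes time polynomial in $n$, and the arrival after $t$ others is processed in time polynomial in $n+t$) and constants $k$ and $a,b>0$ such that, on every $G$, the algorithm is piecewise greedy with respect to some $(a/\log^{k} n,\; b\log^{k} n)$-expander decomposition of $G$ that depends on $G$ only, and such that for every $c\in\mathbb N$ there is a $C>0$ for which, for all $G$ and $T$, with probability at least $1-(nT)^{-c}$ the absolute discrepancy of every vertex is at most $C\log^{k}(nT)$ at all times $t\le T$. (b) There are constants $a,b>0$ such that every $G$ has an $(a/\log n,\; b\log^2 n)$-expander decomposition, and such that for every $c\in\mathbb N$ there is a $C>0$ for which, for all $G$ and $T$ and every such decomposition, every deterministic piecewise greedy online rule keeps the absolute discrepancy of every vertex at most $C(\log^7 n+\log^5 T)$ at all times $t\le T$, with probability at least $1-(nT)^{-c}$. -/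

import Mathlib

namespace EdgeOrientation

/-! ### Graphs: volume, expansion, weak regularity, decompositions -/

/-- The degree of `v` in the subgraph `H` (it is `0` for vertices outside `H`). -/
noncomputable def degIn {n : ℕ} {G : SimpleGraph (Fin n)} (H : G.Subgraph) (v : Fin n) : ℕ :=
  (H.neighborSet v).ncard

/-- The volume of `S` in `H`: the sum of the degrees of the vertices in `S`. -/
noncomputable def vol {n : ℕ} {G : SimpleGraph (Fin n)} (H : G.Subgraph)
    (S : Finset (Fin n)) : ℕ :=
  ∑ v ∈ S, degIn H v

/-- The number of edges of `H` between `S` and its complement. -/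
noncomputable def cutSize {n : ℕ} {G : SimpleGraph (Fin n)} (H : G.Subgraph)
    (S : Finset (Fin n)) : ℕ :=
  {p : Fin n × Fin n | p.1 ∈ S ∧ p.2 ∉ S ∧ H.Adj p.1 p.2}.ncard

/-- `H` is an `α`-expander: `|E(S, V ∖ S)| ≥ α · min (vol S) (vol (V ∖ S))` for every `S ⊆ V`,
where `V` is the vertex set of `H` (vertices outside `V` have degree `0`, so that the complement
of `S` in the ambient vertex set has the volume of `V ∖ S`). -/
def IsExpander {n : ℕ} {G : SimpleGraph (Fin n)} (H : G.Subgraph) (α : ℝ) : Prop :=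
  ∀ S : Finset (Fin n), (S : Set (Fin n)) ⊆ H.verts →
    α * min (vol H S : ℝ) (vol H Sᶜ : ℝ) ≤ (cutSize H S : ℝ)

/-- `H` is `γ`-weakly-regular: each of its vertices has degree at least `γ` times the average
degree of `H`. -/
def IsWeaklyRegular {n : ℕ} {G : SimpleGraph (Fin n)} (H : G.Subgraph) (γ : ℝ) : Prop :=
  ∀ v ∈ H.verts, γ * ((vol H Finset.univ : ℝ) / (H.verts.ncard : ℝ)) ≤ (degIn H v : ℝ)

/-- The subgraphs `P 0, …, P (m - 1)` of `G` decompose `G` into an edge-disjoint union of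
`α / 4`-weakly-regular `α`-expanders such that every vertex lies in at most `K` of them. -/
structure IsExpanderDecomposition {n : ℕ} {G : SimpleGraph (Fin n)} {m : ℕ}
    (P : Fin m → G.Subgraph) (α K : ℝ) : Prop where
  edge_partition : ∀ u v, G.Adj u v → ∃! i, (P i).Adj u v
  expander : ∀ i, IsExpander (P i) α
  weaklyRegular : ∀ i, IsWeaklyRegular (P i) (α / 4)
  overlap : ∀ v, ({i | v ∈ (P i).verts}.ncard : ℝ) ≤ K

/-! ### Online orientation and discrepancy -/

/-- The edges of `G`, each written once, with its smaller endpoint first. -/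
abbrev Edge {n : ℕ} (G : SimpleGraph (Fin n)) : Type :=
  {p : Fin n × Fin n // p.1 < p.2 ∧ G.Adj p.1 p.2}

/-- A deterministic online rule. `σ h e` is the irrevocable decision on the edge `e = (u, v)` that
arrives after the edges in `h` (listed with the most recent arrival first): `true` orients it as
`u → v`, and `false` orients it as `v → u`. -/
abbrev OnlineRule {n : ℕ} (G : SimpleGraph (Fin n)) : Type :=
  List (Edge G) → Edge G → Bool

/-- The arcs (tail, head) that `σ` has produced on the arrivals `h` (most recent first). -/
def arcs {n : ℕ} {G : SimpleGraph (Fin n)} (σ : OnlineRule G) :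
    List (Edge G) → List (Fin n × Fin n)
  | [] => []
  | e :: h => (if σ h e = true then (e.1.1, e.1.2) else (e.1.2, e.1.1)) :: arcs σ h

/-- In-degree minus out-degree of `w` in the directed multigraph with the arcs `A`. -/
def disc {n : ℕ} (A : List (Fin n × Fin n)) (w : Fin n) : ℤ :=
  (A.countP (fun a => a.2 = w) : ℤ) - (A.countP (fun a => a.1 = w) : ℤ)

open scoped Classical in
/-- The arcs that `σ` has produced so far on edges of the piece `H`. -/
noncomputable def arcsIn {n : ℕ} {G : SimpleGraph (Fin n)} (σ : OnlineRule G) (H : G.Subgraph)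
    (h : List (Edge G)) : List (Fin n × Fin n) :=
  (arcs σ h).filter (fun a => H.Adj a.1 a.2)

/-- `σ` runs the greedy algorithm separately on each piece: a new edge is oriented from its
endpoint of larger discrepancy within the piece of the edge to its endpoint of smaller discrepancy
there, with ties broken arbitrarily. -/
def IsPiecewiseGreedy {n : ℕ} {G : SimpleGraph (Fin n)} {m : ℕ} (σ : OnlineRule G)
    (P : Fin m → G.Subgraph) : Prop :=
  ∀ (h : List (Edge G)) (e : Edge G) (i : Fin m), (P i).Adj e.1.1 e.1.2 →
    if σ h e = true
    then disc (arcsIn σ (P i) h) e.1.2 ≤ disc (arcsIn σ (P i) h) e.1.1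
    else disc (arcsIn σ (P i) h) e.1.1 ≤ disc (arcsIn σ (P i) h) e.1.2

/-- The first `t` arrivals of the sequence `e`, most recent first. -/
def history {n : ℕ} {G : SimpleGraph (Fin n)} {T : ℕ} (e : Fin T → Edge G) (t : ℕ) :
    List (Edge G) :=
  ((List.ofFn e).take t).reverse

/-- The probability, over `T` independent uniformly random edges of `G` (that is, over a uniformly
random element of `E ^ T`), that at some time `t ≤ T` some vertex has absolute discrepancy larger
than `B`. -/
noncomputable def failureProb {n : ℕ} {G : SimpleGraph (Fin n)} (σ : OnlineRule G) (T : ℕ)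
    (B : ℝ) : ℝ :=
  (Nat.card {e : Fin T → Edge G //
      ∃ t ≤ T, ∃ w : Fin n, B < |(disc (arcs σ (history e t)) w : ℝ)|} : ℝ) /
    (Nat.card (Fin T → Edge G) : ℝ)

/-! ### The machine model: random access machines with logarithmic cost -/

/-- The configuration of a random access machine: registers and memory cells, each of which
holds a natural number. -/
structure RamState where
  reg : ℕ → ℕ
  mem : ℕ → ℕ

/-- Structured programs of a random access machine. Registers are named by the program, memory
cells are addressed by the contents of registers. -/
inductive Prog : Type
  /-- `x := k`. -/
  | const (x k : ℕ)
  /-- `x := y + z`. -/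
  | add (x y z : ℕ)
  /-- `x := y - z`, and `0` if `y < z`. -/
  | sub (x y z : ℕ)
  /-- `x := y * z`. -/
  | mul (x y z : ℕ)
  /-- `x := ⌊y / z⌋`, and `0` if `z = 0`. -/
  | div (x y z : ℕ)
  /-- `x := mem[y]`. -/
  | load (x y : ℕ)
  /-- `mem[x] := y`. -/
  | store (x y : ℕ)
  /-- `p; q`. -/
  | seq (p q : Prog)
  /-- `if x ≠ 0 then p else q`. -/
  | ite (x : ℕ) (p q : Prog)
  /-- `while x ≠ 0 do p`. -/
  | loop (x : ℕ) (p : Prog)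

/-- `s.set x k` is the configuration `s` with the value `k` in register `x`. -/
def RamState.set (s : RamState) (x k : ℕ) : RamState :=
  { s with reg := Function.update s.reg x k }

/-- `s.put a k` is the configuration `s` with the value `k` in memory cell `a`. -/
def RamState.put (s : RamState) (a k : ℕ) : RamState :=
  { s with mem := Function.update s.mem a k }

/-- `Exec p s c s'`: the program `p`, started in the configuration `s`, halts in `s'` after `c`
time units. An instruction costs `1` plus the bit lengths of the numbers (and addresses) it
reads. -/
inductive Exec : Prog → RamState → ℕ → RamState → Prop
  | const (s : RamState) (x k : ℕ) :
      Exec (.const x k) s (1 + k.size) (s.set x k)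
  | add (s : RamState) (x y z : ℕ) :
      Exec (.add x y z) s (1 + (s.reg y).size + (s.reg z).size) (s.set x (s.reg y + s.reg z))
  | sub (s : RamState) (x y z : ℕ) :
      Exec (.sub x y z) s (1 + (s.reg y).size + (s.reg z).size) (s.set x (s.reg y - s.reg z))
  | mul (s : RamState) (x y z : ℕ) :
      Exec (.mul x y z) s (1 + (s.reg y).size + (s.reg z).size) (s.set x (s.reg y * s.reg z))
  | div (s : RamState) (x y z : ℕ) :
      Exec (.div x y z) s (1 + (s.reg y).size + (s.reg z).size) (s.set x (s.reg y / s.reg z))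
  | load (s : RamState) (x y : ℕ) :
      Exec (.load x y) s (1 + (s.reg y).size + (s.mem (s.reg y)).size)
        (s.set x (s.mem (s.reg y)))
  | store (s : RamState) (x y : ℕ) :
      Exec (.store x y) s (1 + (s.reg x).size + (s.reg y).size) (s.put (s.reg x) (s.reg y))
  | seq (p q : Prog) (s s' s'' : RamState) (c c' : ℕ) (hp : Exec p s c s')
      (hq : Exec q s' c' s'') :
      Exec (.seq p q) s (c + c') s''
  | ite_true (x : ℕ) (p q : Prog) (s s' : RamState) (c : ℕ) (hx : s.reg x ≠ 0)
      (hp : Exec p s c s') :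
      Exec (.ite x p q) s (1 + (s.reg x).size + c) s'
  | ite_false (x : ℕ) (p q : Prog) (s s' : RamState) (c : ℕ) (hx : s.reg x = 0)
      (hq : Exec q s c s') :
      Exec (.ite x p q) s (1 + (s.reg x).size + c) s'
  | loop_done (x : ℕ) (p : Prog) (s : RamState) (hx : s.reg x = 0) :
      Exec (.loop x p) s 1 s
  | loop_step (x : ℕ) (p : Prog) (s s' s'' : RamState) (c c' : ℕ) (hx : s.reg x ≠ 0)
      (hp : Exec p s c s') (hl : Exec (.loop x p) s' c' s'') :
      Exec (.loop x p) s (1 + (s.reg x).size + c + c') s''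

/-- An online algorithm: one program that is run on the graph before the first arrival, and one
that is run on each arriving edge. Registers and memory persist between the runs. -/
structure OnlineAlgorithm where
  init : Prog
  step : Prog

open scoped Classical in
/-- The initial configuration: register `0` holds `n`, the memory holds the adjacency matrix of
`G` row by row, and everything else is `0`. -/
noncomputable def inputState {n : ℕ} (G : SimpleGraph (Fin n)) : RamState where
  reg := fun x => if x = 0 then n else 0
  mem := fun a => if ∃ u v : Fin n, G.Adj u v ∧ a = (u : ℕ) * n + (v : ℕ) then 1 else 0

/-- The new edge `(u, v)` is presented to the machine in the registers `1` and `2`. -/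
def RamState.present {n : ℕ} {G : SimpleGraph (Fin n)} (s : RamState) (e : Edge G) : RamState :=
  (s.set 1 (e.1.1 : ℕ)).set 2 (e.1.2 : ℕ)

/-- On the graph `G`, the algorithm `A` always halts and carries out the online rule `σ`, with
its decision (nonzero for `true`) in register `0` after each arrival. The preprocessing of `G` takes
time at most `(n + 2) ^ d`, and an edge that arrives after `t` others is processed in time at most
`(n + t + 2) ^ d`. Here `st h` is the configuration after the arrivals `h`. -/
def OnlineAlgorithm.ComputesInTime (A : OnlineAlgorithm) {n : ℕ} (G : SimpleGraph (Fin n))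
    (σ : OnlineRule G) (d : ℕ) : Prop :=
  ∃ st : List (Edge G) → RamState,
    (∃ c ≤ (n + 2) ^ d, Exec A.init (inputState G) c (st [])) ∧
    ∀ (h : List (Edge G)) (e : Edge G),
      (∃ c ≤ (n + h.length + 2) ^ d, Exec A.step ((st h).present e) c (st (e :: h))) ∧
      (σ h e = true ↔ (st (e :: h)).reg 0 ≠ 0)

end EdgeOrientation

open EdgeOrientation

/-!
Two facts carry the proof: greedy orientation is stable on a weakly regular expander, and every
graph splits into few layers of such expanders, which moreover can be found by a deterministic
polynomial-time search.

*Discrepancy.* Let `x` be the vector of the discrepancies within one piece. The potential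
`∑ v, (cosh (l * x v) - 1)` changes, when the greedy rule orients an edge `{u, w}`, by a term of
second order in `l` minus `sinh l * |sinh (l * x u) - sinh (l * x w)|`. On an expander, the sum of
the latter over the edges is bounded below by a weighted distance of `sinh (l * x)` from its median
(the coarea inequality). The entries of `x` add up to `0`, so that weak regularity rules out a large
median (`sinh_variation`). For `l = 2 * α ^ 2 / 9` the gain therefore pays for the second-order terms up
to a constant, and the potential of all pieces grows by `O(1)` per arrival in expectation. Markov's
inequality at each of the `T` times makes every discrepancy within a piece `O(log (n * T) / α ^ 2)`
with high probability, and a vertex lies in at most `K` pieces (`failureProb_le_of_decomposition`).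

*Decomposition.* With `σ` proportional to `log n`, a cluster may be split along a cut of expansion
at most `1 / σ`, or along a cut with fewer edges than `1 / σ` times its average degree. A potential
`∑ vol * log (vol * size)` over the clusters pays for the removed edges (`PartitionInv.split`), so
that at most half of the edges are cut. In a partition without such splits the clusters are
`1 / σ`-expanders, and they are weakly regular because no single vertex can be split off. Repeating
this with the cut edges gives `O(log n)` levels, and each vertex lies in one piece of each level.

*Algorithm.* It is not possible to test all cuts in polynomial time, but it suffices to test the
sweep cuts of lazy random walks from every vertex, in integer arithmetic. If all of these fail, then
by a Cheeger inequality for sweeps every walk has, after `t = O(log ^ 3 n)` steps, at least half of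
the stationary density everywhere. Hence a set `S` with at most half of the volume loses at least a
quarter of the mass that starts in it, whereas the mass that leaves it in one step is at most half
the size of its cut (`cut_ge_of_walks`). So the clusters are `1 / (2 * t)`-expanders. The search is
written in a small loop language whose loops have polynomial bounds and whose only products are
those with `n`. Programs of this language therefore run in polynomial time on the random access
machine (`machine_computesInTime`), and only their functional correctness has to be shown
(`Program.exists_decomposition`).
-/

namespace EdgeOrientation

/-! ### Weighted graphs: sweep cuts and the Cheeger inequality -/

section WeightedGraphs

variable {V : Type*} [Fintype V]

/-- The degree of `u` in the weighted graph with weight matrix `A`. -/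
noncomputable def wdeg (A : V → V → ℝ) (u : V) : ℝ := ∑ w, A u w

/-- The volume of `S` in the weighted graph with weight matrix `A`. -/
noncomputable def wvol (A : V → V → ℝ) (S : Finset V) : ℝ := ∑ u ∈ S, wdeg A u

lemma wdeg_nonneg {A : V → V → ℝ} (h0 : ∀ u w, 0 ≤ A u w) (u : V) : 0 ≤ wdeg A u :=
  Finset.sum_nonneg fun w _ => h0 u w

lemma wvol_nonneg {A : V → V → ℝ} (h0 : ∀ u w, 0 ≤ A u w) (S : Finset V) : 0 ≤ wvol A S :=
  Finset.sum_nonneg fun w _ => wdeg_nonneg h0 w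

lemma wvol_mono {A : V → V → ℝ} (h0 : ∀ u w, 0 ≤ A u w) {S T : Finset V} (h : S ⊆ T) :
    wvol A S ≤ wvol A T :=
  Finset.sum_le_sum_of_subset_of_nonneg h fun u _ _ => wdeg_nonneg h0 u

/-- Every weighted finite family of reals has a weighted median among its values. -/
lemma exists_median [Nonempty V] (d : V → ℝ) (hd : ∀ u, 0 ≤ d u) (x : V → ℝ) :
    ∃ m, ∑ u with x m < x u, d u ≤ ∑ u with x u ≤ x m, d u ∧
      ∑ u with x u < x m, d u ≤ ∑ u with x m ≤ x u, d u := by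
  set Q : Finset V := Finset.univ.filter fun m =>
    ∑ u with x m < x u, d u ≤ ∑ u with x u ≤ x m, d u with hQ
  have hne : Q.Nonempty := by
    obtain ⟨m, -, hm⟩ := Finset.univ.exists_max_image x Finset.univ_nonempty
    refine ⟨m, ?_⟩
    have : (Finset.univ.filter fun u => x m < x u) = ∅ := by
      ext u; simp [hm u (Finset.mem_univ u)]
    simp only [hQ, Finset.mem_filter, Finset.mem_univ, true_and, this, Finset.sum_empty]
    exact Finset.sum_nonneg fun u _ => hd u
  obtain ⟨m, hmQ, hm⟩ := Q.exists_min_image x hne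
  refine ⟨m, by simpa [hQ] using hmQ, ?_⟩
  by_contra hlt
  push Not at hlt
  have hne2 : (Finset.univ.filter fun u => x u < x m).Nonempty := by
    by_contra hemp
    rw [Finset.not_nonempty_iff_eq_empty] at hemp
    rw [hemp, Finset.sum_empty] at hlt
    exact absurd hlt (not_lt.mpr (Finset.sum_nonneg fun u _ => hd u))
  obtain ⟨m', hm', hmax⟩ := Finset.exists_max_image _ x hne2
  have hm'lt : x m' < x m := by simpa using hm'
  have e1 : (Finset.univ.filter fun u => x m' < x u) = Finset.univ.filter fun u => x m ≤ x u := by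
    ext u
    simp only [Finset.mem_filter, Finset.mem_univ, true_and]
    constructor
    · intro h
      by_contra h'
      have := hmax u (by simpa using h')
      linarith
    · intro h; linarith
  have e2 : (Finset.univ.filter fun u => x u ≤ x m') = Finset.univ.filter fun u => x u < x m := by
    ext u
    simp only [Finset.mem_filter, Finset.mem_univ, true_and]
    constructor
    · intro h; linarith
    · intro h; exact hmax u (by simpa using h)
  have : m' ∈ Q := by
    simp only [hQ, Finset.mem_filter, Finset.mem_univ, true_and, e1, e2]
    exact hlt.le
  have := hm m' this
  linarith

variable [DecidableEq V]

/-- The weight of the edges between `S` and its complement. -/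
noncomputable def wcut (A : V → V → ℝ) (S : Finset V) : ℝ := ∑ u ∈ S, ∑ w ∈ Sᶜ, A u w

lemma wcut_nonneg {A : V → V → ℝ} (h0 : ∀ u w, 0 ≤ A u w) (S : Finset V) : 0 ≤ wcut A S :=
  Finset.sum_nonneg fun w _ => Finset.sum_nonneg fun z _ => h0 w z

lemma wcut_compl {A : V → V → ℝ} (hs : ∀ u w, A u w = A w u) (S : Finset V) :
    wcut A Sᶜ = wcut A S := by
  unfold wcut
  rw [Finset.sum_comm, compl_compl]
  exact Finset.sum_congr rfl fun u _ => Finset.sum_congr rfl fun w _ => hs w u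

lemma sum_abs_indicator_sub {A : V → V → ℝ} (hs : ∀ u w, A u w = A w u) (S : Finset V) :
    ∑ u, ∑ w, A u w * |(if u ∈ S then (1 : ℝ) else 0) - (if w ∈ S then 1 else 0)|
      = 2 * wcut A S := by
  have key : ∀ u w, A u w * |(if u ∈ S then (1 : ℝ) else 0) - (if w ∈ S then 1 else 0)|
      = (if u ∈ S then (if w ∈ Sᶜ then A u w else 0) else 0)
        + (if u ∈ Sᶜ then (if w ∈ S then A u w else 0) else 0) := by
    intro u w
    by_cases hu : u ∈ S <;> by_cases hw : w ∈ S <;> simp [hu, hw]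
  have h2 : wcut A S = ∑ u, if u ∈ S then (∑ w, if w ∈ Sᶜ then A u w else 0) else 0 := by
    simp only [wcut, Finset.sum_ite_mem, Finset.univ_inter]
  have h3 : wcut A S = ∑ u, if u ∈ Sᶜ then (∑ w, if w ∈ S then A u w else 0) else 0 := by
    rw [← wcut_compl hs]
    simp only [wcut, Finset.sum_ite_mem, Finset.univ_inter, compl_compl]
  rw [two_mul]
  nth_rewrite 1 [h2]
  rw [h3, ← Finset.sum_add_distrib]
  refine Finset.sum_congr rfl fun u _ => ?_
  rw [Finset.sum_congr rfl fun w _ => key u w, Finset.sum_add_distrib]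
  congr 1 <;> split_ifs <;> simp

/-- Coarea inequality: if all superlevel sets of `g ≥ 0` at positive heights expand, then the total
variation of `g` dominates its `L¹` norm. The lowest layer of `g` is peeled off by induction. -/
lemma coarea {A : V → V → ℝ} (hs : ∀ u w, A u w = A w u)
    (α : ℝ) : ∀ (k : ℕ) (g : V → ℝ), (Finset.univ.filter (fun u => 0 < g u)).card = k →
    (∀ u, 0 ≤ g u) →
    (∀ u, 0 < g u → α * wvol A (Finset.univ.filter fun w => g u ≤ g w)
      ≤ wcut A (Finset.univ.filter fun w => g u ≤ g w)) →
    2 * α * ∑ u, wdeg A u * g u ≤ ∑ u, ∑ w, A u w * |g u - g w| := by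
  intro k
  induction k using Nat.strong_induction_on with
  | _ k ih =>
  intro g hk hg h
  set P := Finset.univ.filter (fun u => 0 < g u) with hP
  rcases P.eq_empty_or_nonempty with he | hne
  · have : ∀ u, g u = 0 := by
      intro u
      by_contra hu
      have : u ∈ P := by simp [hP, lt_of_le_of_ne (hg u) (Ne.symm hu)]
      simp [he] at this
    simp [this]
  · obtain ⟨m, hmP, hm⟩ := P.exists_min_image g hne
    have hmpos : 0 < g m := by simpa [hP] using hmP
    set g' : V → ℝ := fun u => g u - g m * (if u ∈ P then 1 else 0) with hg'
    have hin : ∀ u, u ∈ P → g m ≤ g u := hm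
    have hout : ∀ u, u ∉ P → g u = 0 := by
      intro u hu
      have : ¬ 0 < g u := by simpa [hP] using hu
      exact le_antisymm (not_lt.mp this) (hg u)
    have hg'0 : ∀ u, 0 ≤ g' u := by
      intro u
      by_cases hu : u ∈ P
      · simp [hg', hu, hin u hu]
      · simp [hg', hu, hg u]
    have hpos : ∀ u, 0 < g' u → u ∈ P ∧ g m < g u := by
      intro u hu
      by_cases hu' : u ∈ P
      · simp [hg', hu'] at hu; exact ⟨hu', hu⟩
      · simp [hg', hu', hout u hu'] at hu
    have hset : ∀ u, 0 < g' u → (Finset.univ.filter fun w => g' u ≤ g' w)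
        = Finset.univ.filter fun w => g u ≤ g w := by
      intro u hu
      obtain ⟨hu1, hu2⟩ := hpos u hu
      ext w
      simp only [Finset.mem_filter, Finset.mem_univ, true_and]
      by_cases hw : w ∈ P
      · simp [hg', hu1, hw]
      · have := hout w hw
        simp only [hg', hu1, hw, this, if_true, if_false]
        constructor <;> intro h <;> linarith
    have hsub : (Finset.univ.filter (fun u => 0 < g' u)) ⊂ P := by
      refine Finset.ssubset_iff_subset_ne.mpr ⟨?_, ?_⟩
      · intro u hu
        exact (hpos u (by simpa using hu)).1
      · intro he
        have : m ∈ Finset.univ.filter (fun u => 0 < g' u) := he ▸ hmP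
        have := (hpos m (by simpa using this)).2
        exact lt_irrefl _ this
    have ihg := ih _ (hk ▸ Finset.card_lt_card hsub) g' rfl hg'0 (by
      intro u hu
      rw [hset u hu]
      exact h u (by have := (hpos u hu).2; linarith))
    have hPset : (Finset.univ.filter fun w => g m ≤ g w) = P := by
      ext w
      simp only [Finset.mem_filter, Finset.mem_univ, true_and]
      constructor
      · intro hw; simp [hP]; linarith
      · exact hin w
    have hcut := h m hmpos
    rw [hPset] at hcut
    have e1 : ∑ u, wdeg A u * g u = ∑ u, wdeg A u * g' u + g m * wvol A P := by
      have : wvol A P = ∑ u, wdeg A u * (if u ∈ P then 1 else 0) := by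
        simp [wvol]
      rw [this, Finset.mul_sum, ← Finset.sum_add_distrib]
      refine Finset.sum_congr rfl fun u _ => ?_
      simp only [hg']; ring
    have e2 : ∑ u, ∑ w, A u w * |g u - g w|
        = ∑ u, ∑ w, A u w * |g' u - g' w| + g m * (2 * wcut A P) := by
      rw [← sum_abs_indicator_sub hs, Finset.mul_sum, ← Finset.sum_add_distrib]
      refine Finset.sum_congr rfl fun u _ => ?_
      rw [Finset.mul_sum, ← Finset.sum_add_distrib]
      refine Finset.sum_congr rfl fun w _ => ?_
      have : |g u - g w| = |g' u - g' w|
          + g m * |(if u ∈ P then (1 : ℝ) else 0) - (if w ∈ P then 1 else 0)| := by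
        by_cases hu : u ∈ P <;> by_cases hw : w ∈ P
        · simp [hg', hu, hw]
        · have h1 := hout w hw
          have h2 := hin u hu
          simp only [hg', hu, hw, h1, if_true, if_false]
          rw [abs_of_nonneg (by linarith), abs_of_nonneg (by linarith)]; simp
        · have h1 := hout u hu
          have h2 := hin w hw
          simp only [hg', hu, hw, h1, if_true, if_false]
          rw [abs_of_nonpos (by linarith), abs_of_nonpos (by linarith)]; simp
        · simp [hg', hu, hw]
      rw [this]; ring
    rw [e1, e2]
    nlinarith

/-- The sets `{w | x u ≤ x w}` (the sweep cuts of `x`) all expand by `α`. -/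
def SweepsExpand (A : V → V → ℝ) (α : ℝ) (x : V → ℝ) : Prop :=
  ∀ u, α * min (wvol A (Finset.univ.filter fun w => x u ≤ x w))
      (wvol A (Finset.univ.filter fun w => x u ≤ x w)ᶜ)
    ≤ wcut A (Finset.univ.filter fun w => x u ≤ x w)

lemma SweepsExpand.neg {A : V → V → ℝ} (hs : ∀ u w, A u w = A w u) (h0 : ∀ u w, 0 ≤ A u w)
    {α : ℝ} {x : V → ℝ} (h : SweepsExpand A α x) : SweepsExpand A α (fun u => - x u) := by
  intro u
  simp only [neg_le_neg_iff]
  set L := Finset.univ.filter fun w => x w ≤ x u with hL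
  rcases (Finset.univ.filter fun w => x u < x w).eq_empty_or_nonempty with he | hne
  · have hLc : Lᶜ = ∅ := by
      rw [← he]; ext w; simp [hL]
    have h1 : wvol A Lᶜ = 0 := by simp [hLc, wvol]
    rw [h1, min_eq_right (wvol_nonneg h0 L), mul_zero]
    exact wcut_nonneg h0 L
  · obtain ⟨u', hu', hmin⟩ := Finset.exists_min_image _ x hne
    have hlt : x u < x u' := by simpa using hu'
    have : (Finset.univ.filter fun w => x u' ≤ x w) = Lᶜ := by
      ext w
      simp only [hL, Finset.mem_filter, Finset.mem_univ, true_and, Finset.mem_compl, not_le]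
      constructor
      · intro h; linarith
      · intro h; exact hmin w (by simpa using h)
    have := h u'
    rw [‹(Finset.univ.filter fun w => x u' ≤ x w) = Lᶜ›, compl_compl, wcut_compl hs, min_comm]
      at this
    exact this

/-- One-sided form of the coarea inequality: `g` is an increasing function of the part of `x` above
a median. -/
lemma coarea_above_median {A : V → V → ℝ} (hs : ∀ u w, A u w = A w u) (h0 : ∀ u w, 0 ≤ A u w)
    {α : ℝ} {x : V → ℝ} (h : SweepsExpand A α x) (m : V)
    (hm : ∑ u with x m < x u, wdeg A u ≤ ∑ u with x u ≤ x m, wdeg A u)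
    (g : V → ℝ) (hg : ∀ u, 0 ≤ g u) (hpos : ∀ u, 0 < g u → x m < x u)
    (hmono : ∀ u w, 0 < g u → (g u ≤ g w ↔ x u ≤ x w)) :
    2 * α * ∑ u, wdeg A u * g u ≤ ∑ u, ∑ w, A u w * |g u - g w| := by
  refine coarea hs α _ g rfl hg fun u hu => ?_
  have e : (Finset.univ.filter fun w => g u ≤ g w) = Finset.univ.filter fun w => x u ≤ x w := by
    ext w; simp [hmono u w hu]
  rw [e]
  refine le_trans (le_of_eq ?_) (h u)
  congr 1
  rw [eq_comm, min_eq_left]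
  have hlt := hpos u hu
  calc wvol A (Finset.univ.filter fun w => x u ≤ x w)
      ≤ wvol A (Finset.univ.filter fun w => x m < x w) := by
        refine wvol_mono h0 fun w => ?_
        simp only [Finset.mem_filter, Finset.mem_univ, true_and]
        intro h; linarith
    _ ≤ wvol A (Finset.univ.filter fun w => x w ≤ x m) := hm
    _ ≤ _ := by
        refine wvol_mono h0 fun w => ?_
        simp only [Finset.mem_filter, Finset.mem_univ, true_and, Finset.mem_compl, not_le]
        intro h; linarith

lemma SweepsExpand.exists_median [Nonempty V] {A : V → V → ℝ} (hs : ∀ u w, A u w = A w u)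
    (h0 : ∀ u w, 0 ≤ A u w) {α : ℝ} {x : V → ℝ} (h : SweepsExpand A α x) :
    ∃ m, 2 * α * ∑ u, wdeg A u * |x u - x m| ≤ ∑ u, ∑ w, A u w * |x u - x w| ∧
      (0 ≤ α → α ^ 2 * ∑ u, wdeg A u * (x u - x m) ^ 2
        ≤ ∑ u, ∑ w, A u w * (x u - x w) ^ 2) := by
  obtain ⟨m, hm1, hm2⟩ := EdgeOrientation.exists_median (wdeg A) (wdeg_nonneg h0) x
  have hneg := h.neg hs h0
  have hm2' : ∑ u with -x m < -x u, wdeg A u ≤ ∑ u with -x u ≤ -x m, wdeg A u := by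
    simpa only [neg_lt_neg_iff, neg_le_neg_iff] using hm2
  -- the parts of `x` above and below the median
  set p : V → ℝ := fun u => max (x u - x m) 0 with hp
  set q : V → ℝ := fun u => max (x m - x u) 0 with hq
  have hpq : ∀ u, (p u = x u - x m ∧ q u = 0 ∧ x m ≤ x u) ∨
      (p u = 0 ∧ q u = x m - x u ∧ x u ≤ x m) := by
    intro u
    rcases le_total (x m) (x u) with h | h
    · left; exact ⟨max_eq_left (by linarith), max_eq_right (by linarith), h⟩
    · right; exact ⟨max_eq_right (by linarith), max_eq_left (by linarith), h⟩
  have hp0 : ∀ u, 0 ≤ p u := fun u => le_max_right _ _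
  have hq0 : ∀ u, 0 ≤ q u := fun u => le_max_right _ _
  have hppos : ∀ u, 0 < p u → x m < x u := by
    intro u hu; rcases hpq u with h | h <;> linarith [h.1, h.2.1]
  have hqpos : ∀ u, 0 < q u → -x m < -x u := by
    intro u hu; rcases hpq u with h | h <;> linarith [h.1, h.2.1]
  have hpm : ∀ u w, 0 < p u → (p u ≤ p w ↔ x u ≤ x w) := by
    intro u w hu
    have := hppos u hu
    rcases hpq u with h | h <;> rcases hpq w with h' | h' <;>
      constructor <;> intro h'' <;> linarith [h.1, h.2.1, h.2.2, h'.1, h'.2.1, h'.2.2]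
  have hqm : ∀ u w, 0 < q u → (q u ≤ q w ↔ -x u ≤ -x w) := by
    intro u w hu
    have := hqpos u hu
    rcases hpq u with h | h <;> rcases hpq w with h' | h' <;>
      constructor <;> intro h'' <;> linarith [h.1, h.2.1, h.2.2, h'.1, h'.2.1, h'.2.2]
  refine ⟨m, ?_, fun hα => ?_⟩
  · have c1 := coarea_above_median hs h0 h m hm1 p hp0 hppos hpm
    have c2 := coarea_above_median hs h0 hneg m hm2' q hq0 hqpos hqm
    have e1 : ∑ u, wdeg A u * |x u - x m| = ∑ u, wdeg A u * p u + ∑ u, wdeg A u * q u := by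
      rw [← Finset.sum_add_distrib]
      refine Finset.sum_congr rfl fun u _ => ?_
      rw [← mul_add]; congr 1
      rcases hpq u with h | h
      · rw [h.1, h.2.1, abs_of_nonneg (by linarith)]; ring
      · rw [h.1, h.2.1, abs_of_nonpos (by linarith)]; ring
    have e2 : ∑ u, ∑ w, A u w * |x u - x w|
        = ∑ u, ∑ w, A u w * |p u - p w| + ∑ u, ∑ w, A u w * |q u - q w| := by
      rw [← Finset.sum_add_distrib]
      refine Finset.sum_congr rfl fun u _ => ?_
      rw [← Finset.sum_add_distrib]
      refine Finset.sum_congr rfl fun w _ => ?_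
      rw [← mul_add]; congr 1
      rcases hpq u with h | h <;> rcases hpq w with h' | h' <;>
        rw [h.1, h.2.1, h'.1, h'.2.1]
      · simp
      · rw [abs_of_nonneg (by linarith), abs_of_nonneg (by linarith), abs_of_nonpos (by linarith)]
        ring
      · rw [abs_of_nonpos (by linarith), abs_of_nonpos (by linarith), abs_of_nonneg (by linarith)]
        ring
      · rw [show x m - x u - (x m - x w) = -(x u - x w) by ring, abs_neg]; simp
    rw [e1, e2, mul_add]
    exact add_le_add c1 c2
  · -- the coarea inequality for the squares, and `2|a² - b²| ≤ θ⁻¹(a - b)² + θ(a + b)²`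
    have sq_part : ∀ g : V → ℝ, (∀ u, 0 ≤ g u) →
        2 * α * ∑ u, wdeg A u * g u ^ 2 ≤ ∑ u, ∑ w, A u w * |g u ^ 2 - g w ^ 2| →
        α ^ 2 * ∑ u, wdeg A u * g u ^ 2 ≤ ∑ u, ∑ w, A u w * (g u - g w) ^ 2 := by
      intro g hg hc
      have d1 : ∑ u, ∑ w, A u w * g u ^ 2 = ∑ u, wdeg A u * g u ^ 2 :=
        Finset.sum_congr rfl fun u _ => by rw [wdeg, Finset.sum_mul]
      have d2 : ∑ u, ∑ w, A u w * g w ^ 2 = ∑ u, wdeg A u * g u ^ 2 := by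
        rw [Finset.sum_comm, ← d1]
        exact Finset.sum_congr rfl fun u _ => Finset.sum_congr rfl fun w _ => by rw [hs]
      have hb : α * ∑ u, ∑ w, A u w * |g u ^ 2 - g w ^ 2|
          ≤ ∑ u, ∑ w, A u w * (g u - g w) ^ 2
            + (α ^ 2 / 2) * (∑ u, ∑ w, A u w * g u ^ 2 + ∑ u, ∑ w, A u w * g w ^ 2) := by
        rw [← Finset.sum_add_distrib, Finset.mul_sum, Finset.mul_sum, ← Finset.sum_add_distrib]
        refine Finset.sum_le_sum fun u _ => ?_
        rw [← Finset.sum_add_distrib, Finset.mul_sum, Finset.mul_sum, ← Finset.sum_add_distrib]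
        refine Finset.sum_le_sum fun w _ => ?_
        have : α * |g u ^ 2 - g w ^ 2| ≤ (g u - g w) ^ 2 + α ^ 2 / 2 * (g u ^ 2 + g w ^ 2) := by
          rw [show g u ^ 2 - g w ^ 2 = (g u - g w) * (g u + g w) by ring, abs_mul,
            abs_of_nonneg (add_nonneg (hg u) (hg w))]
          have := sq_abs (g u - g w)
          nlinarith [sq_nonneg (2 * |g u - g w| - α * (g u + g w)),
            mul_nonneg (sq_nonneg α) (sq_nonneg (g u - g w))]
        nlinarith [mul_le_mul_of_nonneg_left this (h0 u w)]
      rw [d1, d2] at hb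
      nlinarith [mul_le_mul_of_nonneg_left hc hα]
    have sqpos : ∀ {g : V → ℝ} {u}, (∀ u, 0 ≤ g u) → 0 < g u ^ 2 → 0 < g u := by
      intro g u hg hu
      exact lt_of_le_of_ne (hg u) fun e => by simp [← e] at hu
    have c1 := sq_part p hp0 (coarea_above_median hs h0 h m hm1 (fun u => p u ^ 2)
      (fun u => sq_nonneg _) (fun u hu => hppos u (sqpos hp0 hu)) fun u w hu => by
        rw [← hpm u w (sqpos hp0 hu)]; exact sq_le_sq₀ (hp0 u) (hp0 w))
    have c2 := sq_part q hq0 (coarea_above_median hs h0 hneg m hm2' (fun u => q u ^ 2)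
      (fun u => sq_nonneg _) (fun u hu => hqpos u (sqpos hq0 hu)) fun u w hu => by
        rw [← hqm u w (sqpos hq0 hu)]; exact sq_le_sq₀ (hq0 u) (hq0 w))
    have e1 : ∑ u, wdeg A u * (x u - x m) ^ 2
        = ∑ u, wdeg A u * p u ^ 2 + ∑ u, wdeg A u * q u ^ 2 := by
      rw [← Finset.sum_add_distrib]
      refine Finset.sum_congr rfl fun u _ => ?_
      rcases hpq u with h | h <;> rw [h.1, h.2.1] <;> ring
    have e2 : ∑ u, ∑ w, A u w * (p u - p w) ^ 2 + ∑ u, ∑ w, A u w * (q u - q w) ^ 2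
        ≤ ∑ u, ∑ w, A u w * (x u - x w) ^ 2 := by
      rw [← Finset.sum_add_distrib]
      refine Finset.sum_le_sum fun u _ => ?_
      rw [← Finset.sum_add_distrib]
      refine Finset.sum_le_sum fun w _ => ?_
      rw [← mul_add]
      refine mul_le_mul_of_nonneg_left ?_ (h0 u w)
      rcases hpq u with h | h <;> rcases hpq w with h' | h' <;>
        rw [h.1, h.2.1, h'.1, h'.2.1] <;>
        nlinarith [mul_nonneg (sub_nonneg.2 h.2.2) (sub_nonneg.2 h'.2.2)]
    rw [e1, mul_add]
    linarith

end WeightedGraphs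


/-! ### The greedy potential on one expander -/

/-- `sinh` is convex on the nonnegative reals, and so lies below its chord from `0` to `l b`. -/
lemma sinh_chord {a b l : ℝ} (hl : 0 ≤ l) (ha : 0 < a) (hab : a ≤ b) :
    b * Real.sinh (l * a) ≤ a * Real.sinh (l * b) := by
  have hc : ConvexOn ℝ (Set.Ici (0 : ℝ)) Real.sinh := by
    refine convexOn_of_deriv2_nonneg (convex_Ici 0) Real.continuous_sinh.continuousOn
      Real.differentiable_sinh.differentiableOn ?_ ?_
    · rw [Real.deriv_sinh]; exact Real.differentiable_cosh.differentiableOn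
    · intro x hx
      rw [interior_Ici] at hx
      simp only [Function.iterate_succ, Function.iterate_zero, Function.comp, id,
        Real.deriv_sinh, Real.deriv_cosh]
      exact (Real.sinh_nonneg_iff.2 (le_of_lt hx))
  have hb : 0 < b := lt_of_lt_of_le ha hab
  obtain ⟨-, hc2⟩ := hc
  have h := @hc2 0 (by simp) (l * b) (by simp; positivity) (1 - a / b) (a / b)
    (by rw [sub_nonneg, div_le_one hb]; exact hab) (by positivity) (by ring)
  simp only [smul_eq_mul, mul_zero, zero_add, Real.sinh_zero] at h
  rw [show a / b * (l * b) = l * a by field_simp] at h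
  calc b * Real.sinh (l * a) ≤ b * (a / b * Real.sinh (l * b)) :=
        mul_le_mul_of_nonneg_left h hb.le
    _ = a * Real.sinh (l * b) := by field_simp

lemma sinh_sub_ge_of_pos {l M x : ℝ} (hl : 0 ≤ l) (hM : 0 < M) :
    Real.sinh (l * M) / 2 * (1 - x / M) ≤ |Real.sinh (l * x) - Real.sinh (l * M)| := by
  have hf : 0 ≤ Real.sinh (l * M) := Real.sinh_nonneg_iff.2 (by positivity)
  rw [show Real.sinh (l * M) / 2 * (1 - x / M) = Real.sinh (l * M) * (M - x) / (2 * M) by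
    field_simp, div_le_iff₀ (by positivity)]
  rcases le_or_gt M x with h | h
  · have : Real.sinh (l * M) * (M - x) ≤ 0 := mul_nonpos_of_nonneg_of_nonpos hf (by linarith)
    have h2 : 0 ≤ |Real.sinh (l * x) - Real.sinh (l * M)| * (2 * M) := by positivity
    linarith
  · have h1 : Real.sinh (l * M) - Real.sinh (l * x) ≤ |Real.sinh (l * x) - Real.sinh (l * M)| := by
      rw [abs_sub_comm]; exact le_abs_self _
    refine le_trans ?_ (mul_le_mul_of_nonneg_right h1 (by positivity))
    rcases lt_or_ge 0 x with h0 | h0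
    · have := sinh_chord hl h0 h.le
      nlinarith [mul_nonneg hf (sub_nonneg.2 h.le)]
    · rcases eq_or_lt_of_le h0 with rfl | h0
      · simp only [mul_zero, Real.sinh_zero, sub_zero]; nlinarith
      · have e : Real.sinh (l * x) = - Real.sinh (l * (-x)) := by
          rw [mul_neg, Real.sinh_neg, neg_neg]
        have hs : 0 ≤ Real.sinh (l * (-x)) :=
          Real.sinh_nonneg_iff.2 (mul_nonneg hl (by linarith))
        rw [e]
        rcases le_total M (-x) with hx | hx
        · have := sinh_chord hl hM hx
          nlinarith
        · nlinarith [mul_nonneg hf (sub_nonneg.2 hx), mul_nonneg hs hM.le]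

/-- A linear lower bound for the distance of `sinh (l x)` from `sinh (l M)`. It is linear in `x` so that
it can be summed over discrepancies with the sum `0`. -/
lemma sinh_sub_ge {l M x : ℝ} (hl : 0 < l) (hM : M ≠ 0) :
    |Real.sinh (l * M)| / 2 * (1 - x / M) ≤ |Real.sinh (l * x) - Real.sinh (l * M)| := by
  rcases lt_or_gt_of_ne hM with h | h
  · have := sinh_sub_ge_of_pos (x := -x) hl.le (neg_pos.2 h)
    rw [mul_neg, mul_neg, Real.sinh_neg, Real.sinh_neg, neg_div_neg_eq, ← neg_sub', abs_neg] at this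
    rwa [abs_of_neg (Real.sinh_neg_iff.2 (mul_neg_of_pos_of_neg hl h))]
  · have := sinh_sub_ge_of_pos (x := x) hl.le h
    rwa [abs_of_nonneg (Real.sinh_nonneg_iff.2 (mul_nonneg hl.le h.le))]

section

variable {V : Type*} [Fintype V] [DecidableEq V]

/-- In a weakly regular expander the values of a discrepancy vector `x` vary along the edges: since
the entries of `x` sum to zero, a positive fraction of `∑ |sinh x|` is seen by the vertices far from
the median, and each of these has large degree. -/
lemma sinh_variation {A : V → V → ℝ} (hs : ∀ u w, A u w = A w u) (h0 : ∀ u w, 0 ≤ A u w)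
    {α : ℝ} (hα : 0 < α) (hα1 : α ≤ 1) (W : Finset V)
    (hreg : ∀ v ∈ W, α / 4 * (wvol A Finset.univ / W.card) ≤ wdeg A v)
    {x : V → ℝ} (hx : ∀ v ∉ W, x v = 0) (hsum : ∑ v, x v = 0) {l : ℝ} (hl : 0 < l)
    (hexp : ∀ S, α * min (wvol A S) (wvol A Sᶜ) ≤ wcut A S) :
    2 * (α ^ 2 / 9) * ∑ u, wdeg A u * |Real.sinh (l * x u)|
      ≤ ∑ u, ∑ w, A u w * |Real.sinh (l * x u) - Real.sinh (l * x w)| := by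
  rcases W.eq_empty_or_nonempty with rfl | hW
  · have : ∀ v, x v = 0 := fun v => hx v (by simp)
    simp [this]
  have : Nonempty V := ⟨hW.choose⟩
  have hWc : (0 : ℝ) < W.card := by exact_mod_cast hW.card_pos
  obtain ⟨m, hm, -⟩ := SweepsExpand.exists_median hs h0
    (x := fun u => Real.sinh (l * x u)) (α := α) (fun u => hexp _)
  set D := ∑ u, wdeg A u * |Real.sinh (l * x u) - Real.sinh (l * x m)| with hD
  set F := |Real.sinh (l * x m)| with hF
  have hvol : 0 ≤ wvol A Finset.univ := wvol_nonneg h0 _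
  have hmed : α / 8 * (wvol A Finset.univ) * F ≤ D := by
    have h1 : W.card * F / 2 ≤ ∑ u ∈ W, |Real.sinh (l * x u) - Real.sinh (l * x m)| := by
      rcases eq_or_ne (x m) 0 with h | h
      · simp only [hF, h, mul_zero, Real.sinh_zero, abs_zero, zero_div]
        exact Finset.sum_nonneg fun u _ => abs_nonneg _
      · have hsW : ∑ u ∈ W, x u = 0 := by
          rw [← hsum]
          exact Finset.sum_subset (Finset.subset_univ _) fun v _ hv => hx v hv
        calc W.card * F / 2 = ∑ u ∈ W, F / 2 * (1 - x u / x m) := by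
              rw [← Finset.mul_sum, Finset.sum_sub_distrib, ← Finset.sum_div, hsW]
              simp; ring
          _ ≤ _ := Finset.sum_le_sum fun u _ => sinh_sub_ge hl h
    have h2 : α / 4 * (wvol A Finset.univ / W.card) *
        ∑ u ∈ W, |Real.sinh (l * x u) - Real.sinh (l * x m)| ≤ D := by
      rw [Finset.mul_sum]
      refine le_trans (Finset.sum_le_sum fun u hu =>
        mul_le_mul_of_nonneg_right (hreg u hu) (abs_nonneg _)) ?_
      exact Finset.sum_le_sum_of_subset_of_nonneg (Finset.subset_univ _)
        fun u _ _ => mul_nonneg (wdeg_nonneg h0 u) (abs_nonneg _)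
    refine le_trans ?_ h2
    refine le_trans (le_of_eq ?_) (mul_le_mul_of_nonneg_left h1 (by positivity))
    field_simp; ring
  have htri : ∑ u, wdeg A u * |Real.sinh (l * x u)| ≤ D + wvol A Finset.univ * F := by
    rw [hD, wvol, Finset.sum_mul, ← Finset.sum_add_distrib]
    refine Finset.sum_le_sum fun u _ => ?_
    rw [← mul_add]
    refine mul_le_mul_of_nonneg_left ?_ (wdeg_nonneg h0 u)
    have := abs_add_le (Real.sinh (l * x u) - Real.sinh (l * x m)) (Real.sinh (l * x m))
    rwa [sub_add_cancel] at this
  have hD0 : 0 ≤ D := Finset.sum_nonneg fun u _ => mul_nonneg (wdeg_nonneg h0 u) (abs_nonneg _)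
  calc 2 * (α ^ 2 / 9) * ∑ u, wdeg A u * |Real.sinh (l * x u)|
      ≤ 2 * (α ^ 2 / 9) * (D + wvol A Finset.univ * F) :=
        mul_le_mul_of_nonneg_left htri (by positivity)
    _ = 2 * α / 9 * (α * D + 8 * (α / 8 * wvol A Finset.univ * F)) := by ring
    _ ≤ 2 * α / 9 * (1 * D + 8 * D) := by gcongr
    _ = 2 * α * D := by ring
    _ ≤ _ := hm

end


/-! ### Subgraphs as weighted graphs -/

section

variable {n : ℕ} {G : SimpleGraph (Fin n)}

open scoped Classical in
/-- The adjacency matrix of a subgraph. -/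
noncomputable def adjMat (H : G.Subgraph) (u w : Fin n) : ℝ := if H.Adj u w then 1 else 0

lemma adjMat_symm (H : G.Subgraph) (u w : Fin n) : adjMat H u w = adjMat H w u := by
  unfold adjMat; rw [H.adj_comm]

lemma adjMat_nonneg (H : G.Subgraph) (u w : Fin n) : 0 ≤ adjMat H u w := by
  unfold adjMat; split_ifs <;> simp

lemma wdeg_adjMat (H : G.Subgraph) (v : Fin n) : wdeg (adjMat H) v = degIn H v := by
  classical
  simp only [wdeg, adjMat, degIn, Finset.sum_boole]
  rw [Set.ncard_eq_toFinset_card']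
  congr 2
  ext w; simp

lemma wvol_adjMat (H : G.Subgraph) (S : Finset (Fin n)) : wvol (adjMat H) S = vol H S := by
  simp only [wvol, vol, wdeg_adjMat, Nat.cast_sum]

lemma wcut_adjMat (H : G.Subgraph) (S : Finset (Fin n)) : wcut (adjMat H) S = cutSize H S := by
  classical
  simp only [wcut, adjMat, cutSize]
  rw [← Finset.sum_product', Finset.sum_boole, Set.ncard_eq_toFinset_card']
  congr 2
  ext ⟨u, w⟩; simp [and_assoc]

lemma wdeg_adjMat_eq_zero (H : G.Subgraph) {v : Fin n} (hv : v ∉ H.verts) :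
    wdeg (adjMat H) v = 0 := by
  refine Finset.sum_eq_zero fun w _ => ?_
  rw [adjMat, if_neg fun h => hv (H.edge_vert h)]

/-- Expansion of the subsets of the vertex set of `H` gives expansion of all sets, since the other
vertices are isolated. -/
lemma IsExpander.cut_ge {H : G.Subgraph} {α : ℝ} (h : IsExpander H α) (hα : 0 ≤ α)
    (S : Finset (Fin n)) :
    α * min (wvol (adjMat H) S) (wvol (adjMat H) Sᶜ) ≤ wcut (adjMat H) S := by
  classical
  set S' := S.filter fun v => v ∈ H.verts with hS'
  have hin : S' ⊆ S := Finset.filter_subset _ _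
  have e1 : wvol (adjMat H) S' = wvol (adjMat H) S :=
    Finset.sum_subset hin fun v hv hv' => wdeg_adjMat_eq_zero H fun h => hv' (by simp [hS', hv, h])
  have e2 : wvol (adjMat H) Sᶜ ≤ wvol (adjMat H) S'ᶜ :=
    wvol_mono (adjMat_nonneg H) (Finset.compl_subset_compl.2 hin)
  have e3 : wcut (adjMat H) S' ≤ wcut (adjMat H) S := by
    refine le_trans (Finset.sum_le_sum (g := fun u => ∑ w ∈ Sᶜ, adjMat H u w) fun u _ => ?_)
      (Finset.sum_le_sum_of_subset_of_nonneg hin fun u _ _ =>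
        Finset.sum_nonneg fun w _ => adjMat_nonneg H u w)
    refine le_of_eq (Finset.sum_subset (Finset.compl_subset_compl.2 hin) fun w hw hw' => ?_).symm
    rw [adjMat, if_neg fun h => ?_]
    simp only [Finset.mem_compl, not_not] at hw hw'
    exact hw (by simp [hS', hw', H.edge_vert h.symm])
  have := h S' (fun v hv => by
    have : v ∈ S' := hv
    simp only [hS', Finset.mem_filter] at this
    exact this.2)
  rw [← wvol_adjMat, ← wvol_adjMat, ← wcut_adjMat, e1] at this
  refine le_trans (mul_le_mul_of_nonneg_left (min_le_min_left _ e2) hα) (this.trans e3)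

noncomputable instance edgeFintype : Fintype (Edge G) := Fintype.ofFinite _

lemma sum_edge (φ : Fin n → Fin n → ℝ) (hφ : ∀ u w, φ u w = φ w u) :
    2 * ∑ e : Edge G, φ e.1.1 e.1.2
      = ∑ u, ∑ w, (adjMat (⊤ : G.Subgraph) u w) * φ u w := by
  classical
  have h1 : ∑ e : Edge G, φ e.1.1 e.1.2
      = ∑ u, ∑ w, if u < w ∧ G.Adj u w then φ u w else 0 := by
    rw [← Finset.sum_product', Finset.univ_product_univ, ← Finset.sum_filter]
    exact (Finset.sum_subtype (p := fun p : Fin n × Fin n => p.1 < p.2 ∧ G.Adj p.1 p.2)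
      (Finset.univ.filter fun p : Fin n × Fin n => p.1 < p.2 ∧ G.Adj p.1 p.2) (by simp)
      (fun p => φ p.1 p.2)).symm
  have h2 : ∑ e : Edge G, φ e.1.1 e.1.2
      = ∑ u, ∑ w, if w < u ∧ G.Adj u w then φ u w else 0 := by
    rw [h1, Finset.sum_comm]
    refine Finset.sum_congr rfl fun u _ => Finset.sum_congr rfl fun w _ => ?_
    rw [hφ, G.adj_comm]
  rw [two_mul]
  nth_rewrite 1 [h1]
  rw [h2, ← Finset.sum_add_distrib]
  refine Finset.sum_congr rfl fun u _ => ?_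
  rw [← Finset.sum_add_distrib]
  refine Finset.sum_congr rfl fun w _ => ?_
  simp only [adjMat, SimpleGraph.Subgraph.top_adj]
  by_cases h : G.Adj u w
  · rcases lt_or_gt_of_ne h.ne with h' | h'
    · simp [h, h', h'.not_gt]
    · simp [h, h', h'.not_gt]
  · simp [h]

/-! ### Discrepancies of the pieces -/

lemma disc_cons (a : Fin n × Fin n) (A : List (Fin n × Fin n)) (w : Fin n) :
    disc (a :: A) w = disc A w + (if a.2 = w then 1 else 0) - (if a.1 = w then 1 else 0) := by
  simp only [disc, List.countP_cons]
  by_cases h1 : a.2 = w <;> by_cases h2 : a.1 = w <;> simp [h1, h2] <;> ring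

lemma sum_disc (A : List (Fin n × Fin n)) : ∑ w, disc A w = 0 := by
  induction A with
  | nil => simp [disc]
  | cons a A ih => simp [disc_cons, Finset.sum_add_distrib, ih]

/-- The arc that `σ` makes of the arrival `e` after `h`. -/
def newArc (σ : OnlineRule G) (h : List (Edge G)) (e : Edge G) : Fin n × Fin n :=
  if σ h e = true then (e.1.1, e.1.2) else (e.1.2, e.1.1)

lemma arcsIn_cons_of_adj (σ : OnlineRule G) {H : G.Subgraph} {h : List (Edge G)} {e : Edge G}
    (he : H.Adj e.1.1 e.1.2) : arcsIn σ H (e :: h) = newArc σ h e :: arcsIn σ H h := by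
  classical
  have : H.Adj (newArc σ h e).1 (newArc σ h e).2 := by
    unfold newArc; split_ifs
    · exact he
    · exact he.symm
  simp only [arcsIn, arcs]
  rw [← newArc, List.filter_cons_of_pos (by simpa using this)]

lemma arcsIn_cons_of_not_adj (σ : OnlineRule G) {H : G.Subgraph} {h : List (Edge G)} {e : Edge G}
    (he : ¬ H.Adj e.1.1 e.1.2) : arcsIn σ H (e :: h) = arcsIn σ H h := by
  classical
  have : ¬ H.Adj (newArc σ h e).1 (newArc σ h e).2 := by
    unfold newArc; split_ifs
    · exact he
    · exact fun h => he h.symm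
  simp only [arcsIn, arcs]
  rw [← newArc, List.filter_cons_of_neg (by simpa using this)]

lemma disc_arcsIn_eq_zero (σ : OnlineRule G) (H : G.Subgraph) (h : List (Edge G)) {v : Fin n}
    (hv : v ∉ H.verts) : disc (arcsIn σ H h) v = 0 := by
  classical
  induction h with
  | nil => simp [arcsIn, arcs, disc]
  | cons e h ih =>
    by_cases he : H.Adj e.1.1 e.1.2
    · rw [arcsIn_cons_of_adj σ he, disc_cons, ih]
      have h1 : e.1.1 ≠ v := fun h => hv (h ▸ H.edge_vert he)
      have h2 : e.1.2 ≠ v := fun h => hv (h ▸ H.edge_vert he.symm)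
      unfold newArc; split_ifs <;> simp_all
    · rw [arcsIn_cons_of_not_adj σ he, ih]

lemma disc_arcs_eq_sum {m : ℕ} (σ : OnlineRule G) {P : Fin m → G.Subgraph}
    (hP : ∀ u v, G.Adj u v → ∃! i, (P i).Adj u v) (h : List (Edge G)) (w : Fin n) :
    disc (arcs σ h) w = ∑ i, disc (arcsIn σ (P i) h) w := by
  classical
  induction h with
  | nil => simp [arcsIn, arcs, disc]
  | cons e h ih =>
    obtain ⟨i, hi, huniq⟩ := hP _ _ e.2.2
    rw [← Finset.add_sum_erase _ _ (Finset.mem_univ i)] at ih ⊢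
    have : ∀ j ∈ Finset.univ.erase i, disc (arcsIn σ (P j) (e :: h)) w
        = disc (arcsIn σ (P j) h) w := by
      intro j hj
      rw [arcsIn_cons_of_not_adj σ fun hj' => (Finset.ne_of_mem_erase hj) (huniq j hj')]
    rw [Finset.sum_congr rfl this, arcsIn_cons_of_adj σ hi, arcs, ← newArc, disc_cons, disc_cons, ih]
    ring

/-- The potential of one piece: the discrepancies within it, weighted exponentially with rate `l`. -/
noncomputable def piecePot (l : ℝ) (σ : OnlineRule G) (H : G.Subgraph) (h : List (Edge G)) : ℝ :=
  ∑ v, (Real.cosh (l * disc (arcsIn σ H h) v) - 1)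

lemma cosh_sub_one_le {l : ℝ} (hl : 0 ≤ l) : Real.cosh l - 1 ≤ l / 2 * Real.sinh l := by
  have h1 : Real.cosh l = 1 + 2 * Real.sinh (l / 2) ^ 2 := by
    have := Real.cosh_two_mul (l / 2)
    rw [show 2 * (l / 2) = l by ring, Real.cosh_sq] at this
    linarith
  have h2 : Real.sinh l = 2 * Real.sinh (l / 2) * Real.cosh (l / 2) := by
    have := Real.sinh_two_mul (l / 2)
    rwa [show 2 * (l / 2) = l by ring] at this
  have h3 : Real.sinh (l / 2) ≤ l / 2 * Real.cosh (l / 2) := by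
    have hmono : MonotoneOn (fun y => y * Real.cosh y - Real.sinh y) (Set.Ici 0) := by
      refine monotoneOn_of_deriv_nonneg (convex_Ici 0) (by fun_prop) (by fun_prop) ?_
      intro y hy
      rw [interior_Ici] at hy
      have hd : HasDerivAt (fun y => y * Real.cosh y - Real.sinh y)
          (1 * Real.cosh y + y * Real.sinh y - Real.cosh y) y :=
        ((hasDerivAt_id y).mul (Real.hasDerivAt_cosh y)).sub (Real.hasDerivAt_sinh y)
      rw [hd.deriv]
      have := mul_nonneg (le_of_lt hy) (Real.sinh_nonneg_iff.2 (le_of_lt hy))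
      linarith
    have := hmono (a := 0) (b := l / 2) (by simp) (by simp; linarith) (by linarith)
    simp at this
    linarith
  have h4 : 0 ≤ Real.sinh (l / 2) := Real.sinh_nonneg_iff.2 (by linarith)
  rw [h1, h2]
  nlinarith

/-- The change of the potential when the greedy rule orients an edge whose endpoints have the
discrepancies `x` and `y`. The first term is of second order in `l`; the second one is the gain from
being greedy. -/
noncomputable def greedyChange (l x y : ℝ) : ℝ :=
  (Real.cosh l - 1) * (Real.cosh (l * x) + Real.cosh (l * y))
    - Real.sinh l * |Real.sinh (l * x) - Real.sinh (l * y)|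

lemma greedyChange_eq {l x y : ℝ} (hl : 0 ≤ l) (h : y ≤ x) :
    Real.cosh (l * (x - 1)) - Real.cosh (l * x) + (Real.cosh (l * (y + 1)) - Real.cosh (l * y))
      = greedyChange l x y := by
  have : Real.sinh (l * y) ≤ Real.sinh (l * x) :=
    Real.sinh_le_sinh.2 (mul_le_mul_of_nonneg_left h hl)
  rw [greedyChange, abs_of_nonneg (by linarith), mul_sub, mul_one, Real.cosh_sub, mul_add, mul_one,
    Real.cosh_add]
  ring

lemma greedyChange_comm (l x y : ℝ) : greedyChange l x y = greedyChange l y x := by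
  rw [greedyChange, greedyChange, abs_sub_comm, add_comm (Real.cosh (l * x))]

lemma sum_update_two {f g : Fin n → ℝ} {a b : Fin n} (hab : a ≠ b)
    (h : ∀ v, v ≠ a → v ≠ b → f v = g v) :
    ∑ v, f v - ∑ v, g v = (f a - g a) + (f b - g b) := by
  rw [← Finset.sum_sub_distrib]
  rw [← Finset.sum_subset (Finset.subset_univ {a, b}), Finset.sum_pair hab]
  intro v _ hv
  simp only [Finset.mem_insert, Finset.mem_singleton, not_or] at hv
  rw [h v hv.1 hv.2, sub_self]

lemma piecePot_cons {m : ℕ} {σ : OnlineRule G} {P : Fin m → G.Subgraph}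
    (hσ : IsPiecewiseGreedy σ P) {l : ℝ} (hl : 0 ≤ l) (i : Fin m) (h : List (Edge G))
    {e : Edge G} (he : (P i).Adj e.1.1 e.1.2) :
    piecePot l σ (P i) (e :: h) - piecePot l σ (P i) h
      = greedyChange l (disc (arcsIn σ (P i) h) e.1.1) (disc (arcsIn σ (P i) h) e.1.2) := by
  have hne : e.1.1 ≠ e.1.2 := he.ne
  have hg := hσ h e i he
  unfold piecePot
  rw [arcsIn_cons_of_adj σ he]
  unfold newArc
  by_cases hs : σ h e = true
  · rw [if_pos hs] at hg ⊢
    rw [sum_update_two hne (by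
      intro v h1 h2
      rw [disc_cons, if_neg (Ne.symm h2), if_neg (Ne.symm h1)]; simp)]
    rw [← greedyChange_eq hl (by exact_mod_cast hg)]
    simp [disc_cons, hne, hne.symm, sub_eq_add_neg]
  · rw [if_neg hs] at hg ⊢
    rw [sum_update_two hne (by
      intro v h1 h2
      rw [disc_cons, if_neg (Ne.symm h1), if_neg (Ne.symm h2)]; simp)]
    rw [greedyChange_comm, ← greedyChange_eq hl (by exact_mod_cast hg)]
    simp only [disc_cons, if_true, if_neg hne, if_neg hne.symm]
    push_cast
    ring_nf

/-- The rate of the exponential potential on `α`-expanders. -/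
noncomputable def potRate (α : ℝ) : ℝ := 2 * α ^ 2 / 9

/-- One uniformly random arrival increases the potential of a piece, in expectation, by at most twice
the fraction of the edges that lie in the piece. -/
lemma sum_piecePot_cons_le {m : ℕ} {σ : OnlineRule G} {P : Fin m → G.Subgraph}
    (hσ : IsPiecewiseGreedy σ P) {α : ℝ} (hα : 0 < α) (hα1 : α ≤ 1) (i : Fin m)
    (hexp : IsExpander (P i) α) (hreg : IsWeaklyRegular (P i) (α / 4)) (h : List (Edge G)) :
    ∑ e : Edge G, (piecePot (potRate α) σ (P i) (e :: h) - piecePot (potRate α) σ (P i) h)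
      ≤ wvol (adjMat (P i)) Finset.univ := by
  classical
  set l := potRate α with hl
  have hl0 : 0 < l := by rw [hl, potRate]; positivity
  have hl1 : l ≤ 1 := by rw [hl, potRate]; nlinarith
  set x : Fin n → ℝ := fun v => disc (arcsIn σ (P i) h) v with hx
  set A := adjMat (P i) with hA
  have hs := adjMat_symm (P i)
  have h0 := adjMat_nonneg (P i)
  have step : ∑ e : Edge G, (piecePot l σ (P i) (e :: h) - piecePot l σ (P i) h)
      = ∑ e : Edge G, (fun u w => A u w * greedyChange l (x u) (x w)) e.1.1 e.1.2 := by
    refine Finset.sum_congr rfl fun e _ => ?_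
    by_cases he : (P i).Adj e.1.1 e.1.2
    · rw [piecePot_cons hσ hl0.le i h he]; simp [hA, adjMat, he, hx]
    · simp only [hA, adjMat, he, if_false, zero_mul]
      unfold piecePot
      rw [arcsIn_cons_of_not_adj σ he, sub_self]
  have hord := sum_edge (G := G) (fun u w => A u w * greedyChange l (x u) (x w)) (fun u w => by
    rw [hA, hs, greedyChange_comm])
  have htop : ∀ u w, adjMat (⊤ : G.Subgraph) u w * (A u w * greedyChange l (x u) (x w))
      = A u w * greedyChange l (x u) (x w) := by
    intro u w
    by_cases hadj : (P i).Adj u w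
    · simp [adjMat, hA, hadj, hadj.adj_sub]
    · simp [adjMat, hA, hadj]
  simp only [htop] at hord
  set W : Finset (Fin n) := (P i).verts.toFinset with hW
  have hvar := sinh_variation hs h0 hα hα1 W (x := x) (l := l) (by
      intro v hv
      have := hreg v (by simpa [hW] using hv)
      rwa [← wvol_adjMat, ← wdeg_adjMat, Set.ncard_eq_toFinset_card'] at this) (by
      intro v hv
      simp only [hx]
      rw [disc_arcsIn_eq_zero σ (P i) h (by simpa [hW] using hv)]; simp) (by
      simp only [hx]; exact_mod_cast sum_disc _) hl0 (hexp.cut_ge hα.le)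
  have hcosh : ∑ u, ∑ w, A u w * (Real.cosh (l * x u) + Real.cosh (l * x w))
      = 2 * ∑ u, wdeg A u * Real.cosh (l * x u) := by
    have d1 : ∑ u, ∑ w, A u w * Real.cosh (l * x u) = ∑ u, wdeg A u * Real.cosh (l * x u) :=
      Finset.sum_congr rfl fun u _ => by rw [wdeg, Finset.sum_mul]
    have d2 : ∑ u, ∑ w, A u w * Real.cosh (l * x w) = ∑ u, wdeg A u * Real.cosh (l * x u) := by
      rw [Finset.sum_comm, ← d1]
      exact Finset.sum_congr rfl fun u _ => Finset.sum_congr rfl fun w _ => by rw [hA, hs]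
    simp only [mul_add, Finset.sum_add_distrib, d1, d2]; ring
  have hexpand : ∑ u, ∑ w, A u w * greedyChange l (x u) (x w)
      = (Real.cosh l - 1) * (2 * ∑ u, wdeg A u * Real.cosh (l * x u))
        - Real.sinh l * ∑ u, ∑ w, A u w * |Real.sinh (l * x u) - Real.sinh (l * x w)| := by
    rw [← hcosh, Finset.mul_sum, Finset.mul_sum, ← Finset.sum_sub_distrib]
    refine Finset.sum_congr rfl fun u _ => ?_
    rw [Finset.mul_sum, Finset.mul_sum, ← Finset.sum_sub_distrib]
    refine Finset.sum_congr rfl fun w _ => ?_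
    rw [greedyChange]; ring
  have hle : ∑ u, wdeg A u * Real.cosh (l * x u)
      ≤ wvol A Finset.univ + ∑ u, wdeg A u * |Real.sinh (l * x u)| := by
    rw [wvol, ← Finset.sum_add_distrib]
    refine Finset.sum_le_sum fun u _ => ?_
    have : Real.cosh (l * x u) ≤ 1 + |Real.sinh (l * x u)| := by
      refine abs_le_of_sq_le_sq' ?_ (by positivity) |>.2
      rw [Real.cosh_sq]
      nlinarith [sq_abs (Real.sinh (l * x u)), abs_nonneg (Real.sinh (l * x u))]
    nlinarith [mul_le_mul_of_nonneg_left this (wdeg_nonneg h0 u)]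
  have hc0 : 0 ≤ Real.cosh l - 1 := by linarith [Real.one_le_cosh l]
  have hc1 := cosh_sub_one_le hl0.le
  have hs0 : 0 ≤ Real.sinh l := Real.sinh_nonneg_iff.2 hl0.le
  have hc2 : Real.cosh l - 1 ≤ 1 := by
    have h1 : Real.cosh l ≤ Real.exp (l ^ 2 / 2) := Real.cosh_le_exp_half_sq l
    have h2 : Real.exp (l ^ 2 / 2) ≤ Real.exp (1 / 2) := Real.exp_le_exp.2 (by nlinarith)
    have h3 : Real.exp (1 / 2) ≤ 2 := by
      have : Real.exp (1 / 2) ^ 2 = Real.exp 1 := by rw [← Real.exp_nat_mul]; norm_num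
      have h4 := Real.exp_one_lt_d9
      nlinarith [Real.exp_pos (1 / 2 : ℝ)]
    linarith
  set D := ∑ u, wdeg A u * |Real.sinh (l * x u)| with hD
  have hD0 : 0 ≤ D := Finset.sum_nonneg fun u _ => mul_nonneg (wdeg_nonneg h0 u) (abs_nonneg _)
  have hv0 : 0 ≤ wvol A Finset.univ := wvol_nonneg h0 _
  have ha : (Real.cosh l - 1) * D ≤ l / 2 * Real.sinh l * D := mul_le_mul_of_nonneg_right hc1 hD0
  have hb := mul_le_mul_of_nonneg_left hvar hs0
  have hc := mul_le_mul_of_nonneg_left hle hc0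
  have hd : (Real.cosh l - 1) * wvol A Finset.univ ≤ 1 * wvol A Finset.univ :=
    mul_le_mul_of_nonneg_right hc2 hv0
  have he : Real.sinh l * (2 * (α ^ 2 / 9) * D) = 2 * (l / 2 * Real.sinh l * D) := by
    rw [show 2 * (α ^ 2 / 9) = l by rw [hl, potRate]; ring]; ring
  rw [step]
  rw [hexpand] at hord
  linarith

/-- The total potential of a decomposition. -/
noncomputable def totalPot {m : ℕ} (l : ℝ) (σ : OnlineRule G) (P : Fin m → G.Subgraph)
    (h : List (Edge G)) : ℝ := ∑ i, piecePot l σ (P i) h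

lemma sum_totalPot_cons_le {m : ℕ} {σ : OnlineRule G} {P : Fin m → G.Subgraph}
    (hσ : IsPiecewiseGreedy σ P) {α K : ℝ} (hα : 0 < α) (hα1 : α ≤ 1)
    (hP : IsExpanderDecomposition P α K) (h : List (Edge G)) :
    ∑ e : Edge G, totalPot (potRate α) σ P (e :: h)
      ≤ Fintype.card (Edge G) * (totalPot (potRate α) σ P h + 2) := by
  classical
  have h1 : ∑ e : Edge G, (totalPot (potRate α) σ P (e :: h) - totalPot (potRate α) σ P h)
      ≤ ∑ i, wvol (adjMat (P i)) Finset.univ := by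
    simp only [totalPot, ← Finset.sum_sub_distrib]
    rw [Finset.sum_comm]
    exact Finset.sum_le_sum fun i _ =>
      sum_piecePot_cons_le hσ hα hα1 i (hP.expander i) (hP.weaklyRegular i) h
  have h2 : ∑ i, wvol (adjMat (P i)) Finset.univ = 2 * Fintype.card (Edge G) := by
    have := sum_edge (G := G) (fun _ _ => 1) (fun _ _ => rfl)
    simp only [Finset.sum_const, Finset.card_univ, nsmul_eq_mul, mul_one] at this
    rw [this]
    simp only [wvol, wdeg]
    rw [Finset.sum_comm]
    refine Finset.sum_congr rfl fun u _ => ?_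
    rw [Finset.sum_comm]
    refine Finset.sum_congr rfl fun w _ => ?_
    by_cases hadj : G.Adj u w
    · obtain ⟨i, hi, huniq⟩ := hP.edge_partition u w hadj
      rw [Finset.sum_eq_single i]
      · simp [adjMat, hi, hadj]
      · intro j _ hj
        simp only [adjMat]
        rw [if_neg fun h => hj (huniq j h)]
      · simp
    · have : ∀ i, ¬ (P i).Adj u w := fun i h => hadj h.adj_sub
      simp [adjMat, this, hadj]
  rw [h2, Finset.sum_sub_distrib] at h1
  simp only [Finset.sum_const, Finset.card_univ, nsmul_eq_mul] at h1
  linarith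

lemma piecePot_nonneg (l : ℝ) (σ : OnlineRule G) (H : G.Subgraph) (h : List (Edge G)) :
    0 ≤ piecePot l σ H h :=
  Finset.sum_nonneg fun v _ => by linarith [Real.one_le_cosh (l * disc (arcsIn σ H h) v)]

lemma totalPot_nonneg {m : ℕ} (l : ℝ) (σ : OnlineRule G) (P : Fin m → G.Subgraph)
    (h : List (Edge G)) : 0 ≤ totalPot l σ P h :=
  Finset.sum_nonneg fun i _ => piecePot_nonneg l σ (P i) h

/-- A small potential keeps the discrepancy of every vertex small. -/
lemma abs_disc_le {m : ℕ} (σ : OnlineRule G) {P : Fin m → G.Subgraph} {α K : ℝ}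
    (hP : IsExpanderDecomposition P α K) {l X : ℝ} (hl : 0 < l) (hX : 0 ≤ X)
    (h : List (Edge G)) (hpot : totalPot l σ P h ≤ X) (w : Fin n) :
    |(disc (arcs σ h) w : ℝ)| ≤ K * (Real.log (2 + 2 * X) / l) := by
  classical
  have hlog : 0 ≤ Real.log (2 + 2 * X) := Real.log_nonneg (by linarith)
  have each : ∀ i, |(disc (arcsIn σ (P i) h) w : ℝ)| ≤ Real.log (2 + 2 * X) / l := by
    intro i
    set x : ℝ := ((disc (arcsIn σ (P i) h) w : ℤ) : ℝ) with hx
    have h1 : Real.cosh (l * x) - 1 ≤ X := by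
      refine le_trans ?_ hpot
      refine le_trans ?_ (Finset.single_le_sum (fun j _ => piecePot_nonneg l σ (P j) h)
        (Finset.mem_univ i))
      exact Finset.single_le_sum (f := fun v => Real.cosh (l * disc (arcsIn σ (P i) h) v) - 1)
        (fun v _ => by linarith [Real.one_le_cosh (l * disc (arcsIn σ (P i) h) v)])
        (Finset.mem_univ w)
    have h2 : Real.exp |l * x| ≤ 2 + 2 * X := by
      have : Real.exp |l * x| ≤ 2 * Real.cosh (l * x) := by
        rw [← Real.cosh_abs, Real.cosh_eq]
        have := Real.exp_pos (-|l * x|)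
        linarith
      linarith
    have h3 : |l * x| ≤ Real.log (2 + 2 * X) := (Real.le_log_iff_exp_le (by linarith)).2 h2
    rw [abs_mul, abs_of_pos hl] at h3
    rw [le_div_iff₀ hl, mul_comm]; exact h3
  rw [disc_arcs_eq_sum σ hP.edge_partition, Int.cast_sum]
  set I : Finset (Fin m) := Finset.univ.filter fun i => w ∈ (P i).verts with hI
  have hsub : ∑ i, (disc (arcsIn σ (P i) h) w : ℝ) = ∑ i ∈ I, (disc (arcsIn σ (P i) h) w : ℝ) := by
    symm
    refine Finset.sum_subset (Finset.subset_univ _) fun i _ hi => ?_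
    rw [disc_arcsIn_eq_zero σ (P i) h (by simpa [hI] using hi)]; simp
  have hIc : (I.card : ℝ) ≤ K := by
    have := hP.overlap w
    rwa [Set.ncard_eq_toFinset_card', Set.toFinset_ofPred] at this
  rw [hsub]
  calc |∑ i ∈ I, (disc (arcsIn σ (P i) h) w : ℝ)|
      ≤ ∑ i ∈ I, |(disc (arcsIn σ (P i) h) w : ℝ)| := Finset.abs_sum_le_sum_abs _ _
    _ ≤ ∑ i ∈ I, Real.log (2 + 2 * X) / l := Finset.sum_le_sum fun i _ => each i
    _ = I.card * (Real.log (2 + 2 * X) / l) := by simp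
    _ ≤ _ := mul_le_mul_of_nonneg_right hIc (by positivity)

/-! ### From the drift to the failure probability -/

lemma history_succ {T : ℕ} (e : Fin T → Edge G) {t : ℕ} (ht : t < T) :
    history e (t + 1) = e ⟨t, ht⟩ :: history e t := by
  simp [history, List.take_add_one, ht]

lemma history_update {T : ℕ} (e : Fin T → Edge G) {t : ℕ} (ht : t < T) (a : Edge G) :
    history (Function.update e ⟨t, ht⟩ a) t = history e t := by
  simp only [history]
  congr 1
  refine List.ext_getElem (by simp) fun j h1 h2 => ?_
  simp only [List.length_take, List.length_ofFn] at h1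
  simp only [List.getElem_take, List.getElem_ofFn]
  rw [Function.update_of_ne]
  intro h
  have := congrArg Fin.val h
  simp only at this
  omega

/-- The arrival at time `t + 1` is independent of the history up to time `t`. -/
lemma sum_history_succ {T : ℕ} {t : ℕ} (ht : t < T) (F : List (Edge G) → ℝ) :
    Fintype.card (Edge G) * ∑ e : Fin T → Edge G, F (history e (t + 1))
      = ∑ e : Fin T → Edge G, ∑ a : Edge G, F (a :: history e t) := by
  classical
  have hinv : ∀ p : (Fin T → Edge G) × Edge G,
      (Function.update (Function.update p.1 ⟨t, ht⟩ p.2) ⟨t, ht⟩ (p.1 ⟨t, ht⟩),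
        (Function.update p.1 ⟨t, ht⟩ p.2) ⟨t, ht⟩) = p := by
    intro p; simp
  let swap : ((Fin T → Edge G) × Edge G) ≃ ((Fin T → Edge G) × Edge G) :=
    { toFun := fun p => (Function.update p.1 ⟨t, ht⟩ p.2, p.1 ⟨t, ht⟩)
      invFun := fun p => (Function.update p.1 ⟨t, ht⟩ p.2, p.1 ⟨t, ht⟩)
      left_inv := hinv
      right_inv := hinv }
  rw [← Fintype.sum_prod_type' (f := fun (e : Fin T → Edge G) a => F (a :: history e t)),
    ← Equiv.sum_comp swap]
  simp only [swap, Equiv.coe_fn_mk, history_update, history_succ _ ht]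
  rw [Fintype.sum_prod_type]
  simp [Finset.mul_sum]

lemma sum_history_le {T : ℕ} (F : List (Edge G) → ℝ) (B : ℝ)
    (hF : ∀ h, ∑ a : Edge G, F (a :: h) ≤ Fintype.card (Edge G) * (F h + B)) (hF0 : F [] = 0)
    [Nonempty (Edge G)] :
    ∀ t ≤ T, ∑ e : Fin T → Edge G, F (history e t)
      ≤ Fintype.card (Fin T → Edge G) * (t * B) := by
  intro t
  induction t with
  | zero => intro _; simp [history, hF0]
  | succ t ih =>
    intro ht
    have hc : (0 : ℝ) < Fintype.card (Edge G) := by exact_mod_cast Fintype.card_pos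
    refine le_of_mul_le_mul_left ?_ hc
    rw [sum_history_succ (by omega)]
    refine le_trans (Finset.sum_le_sum fun e _ => hF _) ?_
    rw [← Finset.mul_sum]
    refine mul_le_mul_of_nonneg_left ?_ hc.le
    rw [Finset.sum_add_distrib]
    have := ih (by omega)
    simp only [Finset.sum_const, Finset.card_univ, nsmul_eq_mul]
    push_cast
    linarith

lemma totalPot_nil {m : ℕ} (l : ℝ) (σ : OnlineRule G) (P : Fin m → G.Subgraph) :
    totalPot l σ P [] = 0 := by
  simp [totalPot, piecePot, arcsIn, arcs, disc]

/-- Markov's inequality for the potential at each of the `T` times. -/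
lemma failureProb_le {m : ℕ} {σ : OnlineRule G} {P : Fin m → G.Subgraph}
    (hσ : IsPiecewiseGreedy σ P) {α K : ℝ} (hα : 0 < α) (hα1 : α ≤ 1)
    (hP : IsExpanderDecomposition P α K) (T : ℕ) {X B : ℝ} (hX : 0 < X)
    (hB : K * (Real.log (2 + 2 * X) / potRate α) ≤ B) :
    failureProb σ T B ≤ T * (T + 1) / X := by
  classical
  have hl : 0 < potRate α := by rw [potRate]; positivity
  unfold failureProb
  rcases isEmpty_or_nonempty (Edge G) with hE | hE
  · rcases Nat.eq_zero_or_pos T with rfl | hT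
    · have : IsEmpty {e : Fin 0 → Edge G //
          ∃ t ≤ 0, ∃ w : Fin n, B < |(disc (arcs σ (history e t)) w : ℝ)|} := by
        refine ⟨fun ⟨e, t, ht, w, hw⟩ => ?_⟩
        have := abs_disc_le σ hP hl hX.le [] (by rw [totalPot_nil]; exact hX.le) w
        simp only [history, List.ofFn_zero, List.take_nil, List.reverse_nil] at hw
        linarith
      rw [Nat.card_of_isEmpty]
      simp
    · have : IsEmpty (Fin T → Edge G) := ⟨fun e => hE.false (e ⟨0, hT⟩)⟩
      simp only [Nat.card_of_isEmpty, Nat.cast_zero, div_zero]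
      positivity
  rw [Nat.card_eq_fintype_card, Nat.card_eq_fintype_card, Fintype.card_subtype]
  set N : ℝ := ((Fintype.card (Fin T → Edge G) : ℕ) : ℝ) with hN
  have hN0 : 0 < N := by rw [hN]; exact_mod_cast Fintype.card_pos
  rw [div_le_div_iff₀ hN0 hX]
  set bad : Finset (Fin T → Edge G) := Finset.univ.filter fun e =>
    ∃ t ≤ T, ∃ w : Fin n, B < |(disc (arcs σ (history e t)) w : ℝ)| with hbad
  have hpt : ∀ e, (if e ∈ bad then X else 0)
      ≤ ∑ t ∈ Finset.range (T + 1), totalPot (potRate α) σ P (history e t) := by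
    intro e
    split_ifs with h
    · simp only [hbad, Finset.mem_filter, Finset.mem_univ, true_and] at h
      obtain ⟨t, ht, w, hw⟩ := h
      refine le_trans ?_ (Finset.single_le_sum
        (f := fun t => totalPot (potRate α) σ P (history e t))
        (fun t _ => totalPot_nonneg _ σ P _) (Finset.mem_range.2 (Nat.lt_succ_of_le ht)))
      by_contra hlt
      push Not at hlt
      have := abs_disc_le σ hP hl hX.le _ hlt.le w
      linarith
    · exact Finset.sum_nonneg fun t _ => totalPot_nonneg _ σ P _
  calc (bad.card : ℝ) * X = ∑ e, if e ∈ bad then X else 0 := by simp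
    _ ≤ ∑ e, ∑ t ∈ Finset.range (T + 1), totalPot (potRate α) σ P (history e t) :=
        Finset.sum_le_sum fun e _ => hpt e
    _ = ∑ t ∈ Finset.range (T + 1), ∑ e : Fin T → Edge G,
          totalPot (potRate α) σ P (history e t) := Finset.sum_comm
    _ ≤ ∑ t ∈ Finset.range (T + 1), N * (t * 2) := Finset.sum_le_sum fun t ht =>
        sum_history_le _ 2 (sum_totalPot_cons_le hσ hα hα1 hP) (totalPot_nil _ σ P) t
          (by simpa [Nat.lt_succ_iff] using ht)
    _ = T * (T + 1) * N := by
        rw [← Finset.mul_sum, ← Finset.sum_mul]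
        have := Finset.sum_range_id_mul_two (T + 1)
        simp only [Nat.add_sub_cancel] at this
        have h2 : (∑ i ∈ Finset.range (T + 1), (i : ℝ)) * 2 = ((T + 1 : ℕ) : ℝ) * T := by
          have h3 := congrArg (Nat.cast (R := ℝ)) this
          push_cast at h3 ⊢
          exact h3
        rw [h2]; push_cast; ring

/-- The discrepancy bound for piecewise greedy rules on decompositions into expanders, in terms of
the parameters of the decomposition. -/
lemma failureProb_le_of_decomposition {m : ℕ} {σ : OnlineRule G} {P : Fin m → G.Subgraph}
    (hσ : IsPiecewiseGreedy σ P) {α K : ℝ} (hα : 0 < α) (hα1 : α ≤ 1)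
    (hP : IsExpanderDecomposition P α K) (hn : 2 ≤ n) {T : ℕ} (hT : 1 ≤ T) (c : ℕ) {B : ℝ}
    (hB : 5 * (c + 5) * K * Real.log (n * T) / α ^ 2 ≤ B) :
    failureProb σ T B ≤ 1 / ((n : ℝ) * T) ^ c := by
  set z : ℝ := n * T with hz
  have hT1 : (1 : ℝ) ≤ T := by exact_mod_cast hT
  have hn2 : (2 : ℝ) ≤ n := by exact_mod_cast hn
  have hz2 : 2 ≤ z := by nlinarith
  have hTz : (T : ℝ) ≤ z := by nlinarith
  have hK : 0 ≤ K := le_trans (by positivity) (hP.overlap ⟨0, by omega⟩)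
  have hlz : 0 ≤ Real.log z := Real.log_nonneg (by linarith)
  have hX : 0 < 2 * z ^ (c + 2) := by positivity
  refine le_trans (failureProb_le hσ hα hα1 hP T hX (le_trans ?_ hB)) ?_
  · have h1 : Real.log (2 + 2 * (2 * z ^ (c + 2))) ≤ (c + 5) * Real.log z := by
      have e : ((c : ℝ) + 5) * Real.log z = Real.log (z ^ (c + 5)) := by
        rw [Real.log_pow]; push_cast; ring
      rw [e]
      refine Real.log_le_log (by positivity) ?_
      have h8 : (8 : ℝ) ≤ z ^ 3 := by
        calc (8 : ℝ) = 2 ^ 3 := by norm_num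
          _ ≤ z ^ 3 := by gcongr
      have h1z : 1 ≤ z ^ (c + 2) := one_le_pow₀ (by linarith)
      calc 2 + 2 * (2 * z ^ (c + 2)) ≤ 8 * z ^ (c + 2) := by linarith
        _ ≤ z ^ 3 * z ^ (c + 2) := by gcongr
        _ = z ^ (c + 5) := by ring
    rw [potRate]
    calc K * (Real.log (2 + 2 * (2 * z ^ (c + 2))) / (2 * α ^ 2 / 9))
        ≤ K * ((c + 5) * Real.log z / (2 * α ^ 2 / 9)) := by gcongr
      _ = (9 / 2) * ((c + 5) * K * Real.log z / α ^ 2) := by field_simp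
      _ ≤ 5 * ((c + 5) * K * Real.log z / α ^ 2) := by
          refine mul_le_mul_of_nonneg_right (by norm_num) ?_
          positivity
      _ = _ := by ring
  · rw [div_le_div_iff₀ hX (by positivity)]
    have : (T : ℝ) * (T + 1) ≤ 2 * z ^ 2 := by nlinarith
    calc (T : ℝ) * (T + 1) * z ^ c ≤ 2 * z ^ 2 * z ^ c := by gcongr
      _ = 1 * (2 * z ^ (c + 2)) := by ring

end


/-! ### Splitting clusters along sparse cuts -/

/-- The entropy-like potential `a log (a p)` of a cluster with volume `a` and `p` vertices. -/
noncomputable def clusterPot (a p : ℕ) : ℝ := a * Real.log (a * p)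

lemma clusterPot_le_of_le {a a' p s r : ℕ} (h : a' ≤ a) (has : a ≤ s) (hp : p ≤ r) (hr : 1 ≤ r)
    (hp1 : 1 ≤ p) : clusterPot a' p ≤ a * Real.log (s * r) := by
  unfold clusterPot
  rcases Nat.eq_zero_or_pos a with rfl | ha
  · simp [Nat.le_zero.1 h]
  have hlog : 0 ≤ Real.log ((s : ℝ) * r) := by
    refine Real.log_nonneg ?_
    exact_mod_cast Nat.mul_pos (lt_of_lt_of_le ha has) hr
  rcases Nat.eq_zero_or_pos a' with rfl | ha'
  · simp only [Nat.cast_zero, zero_mul]; positivity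
  have h1 : Real.log ((a' : ℝ) * p) ≤ Real.log (s * r) := by
    refine Real.log_le_log (by exact_mod_cast Nat.mul_pos ha' hp1) ?_
    exact_mod_cast Nat.mul_le_mul (h.trans has) hp
  calc (a' : ℝ) * Real.log (a' * p) ≤ a' * Real.log (s * r) := by gcongr
    _ ≤ a * Real.log (s * r) := by gcongr

lemma clusterPot_split_balanced {σ a b cut p q : ℕ} (hp : 1 ≤ p) (hq : 1 ≤ q)
    (h : σ * cut ≤ a + cut) (hab : a ≤ b) :
    2 / 3 * (σ * cut : ℝ) + clusterPot a p + clusterPot b q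
      ≤ clusterPot (a + cut + (b + cut)) (p + q) := by
  set s := a + cut + (b + cut) with hs
  rcases Nat.eq_zero_or_pos (a + cut) with h0 | h0
  · obtain ⟨rfl, rfl⟩ : a = 0 ∧ cut = 0 := by omega
    have h1 := clusterPot_le_of_le (le_refl b) (le_refl b) (Nat.le_add_left q p) (by omega) hq
    simp only [clusterPot, hs] at h1 ⊢
    simpa using h1
  have hb := clusterPot_le_of_le (a := b + cut) (s := s) (Nat.le_add_right b cut) (by omega)
    (Nat.le_add_left q p) (by omega) hq
  have hL : Real.log ((s : ℝ) * (p + q : ℕ)) = Real.log (s * (p + q : ℕ) / 2) + Real.log 2 := by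
    have : (s : ℝ) * (p + q : ℕ) ≠ 0 := by
      exact_mod_cast (Nat.mul_pos (by omega) (by omega)).ne'
    rw [Real.log_div this (by norm_num)]; ring
  have hge : 0 ≤ Real.log ((s : ℝ) * (p + q : ℕ) / 2) := by
    refine Real.log_nonneg ?_
    rw [le_div_iff₀ (by norm_num), one_mul]
    have : 2 ≤ s * (p + q) := by nlinarith
    exact_mod_cast this
  have ha : clusterPot a p ≤ (a + cut : ℕ) * Real.log (s * (p + q : ℕ) / 2) := by
    unfold clusterPot
    rcases Nat.eq_zero_or_pos a with rfl | ha'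
    · simp only [Nat.cast_zero, zero_mul]; positivity
    have h1 : Real.log ((a : ℝ) * p) ≤ Real.log (s * (p + q : ℕ) / 2) := by
      refine Real.log_le_log (by exact_mod_cast Nat.mul_pos ha' hp) ?_
      rw [le_div_iff₀ (by norm_num)]
      have : a * p * 2 ≤ s * (p + q) := by nlinarith [Nat.zero_le (a * q), Nat.zero_le (s * q)]
      exact_mod_cast this
    calc (a : ℝ) * Real.log (a * p) ≤ a * Real.log (s * (p + q : ℕ) / 2) := by gcongr
      _ ≤ _ := by gcongr; omega
  have hlog2 : (2 / 3 : ℝ) ≤ Real.log 2 := by linarith [Real.log_two_gt_d9]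
  have hcut : (σ * cut : ℝ) ≤ (a + cut : ℕ) := by exact_mod_cast h
  have e : clusterPot s (p + q) = (a + cut : ℕ) * Real.log (s * (p + q : ℕ))
      + (b + cut : ℕ) * Real.log (s * (p + q : ℕ)) := by
    unfold clusterPot
    rw [← add_mul]; congr 1; rw [hs]; push_cast; ring
  have h0' : (0 : ℝ) ≤ (a + cut : ℕ) := by positivity
  rw [e]
  nth_rewrite 1 [hL]
  nlinarith

/-- The potential pays for the edges that a split of a cluster removes. In the first case the cut is
sparse, and the logarithm of the smaller volume drops by a constant; in the second case the cut is
below the average degree, and the logarithm of the number of vertices drops. -/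
lemma clusterPot_split {σ a b cut p q : ℕ} (hp : 1 ≤ p) (hq : 1 ≤ q)
    (h : (σ * cut ≤ a + cut ∧ σ * cut ≤ b + cut) ∨
      σ * (p + q) * cut ≤ a + cut + (b + cut)) :
    2 / 3 * (σ * cut : ℝ) + clusterPot a p + clusterPot b q
      ≤ clusterPot (a + cut + (b + cut)) (p + q) := by
  rcases h with h | h
  · rcases le_total a b with hab | hab
    · exact clusterPot_split_balanced hp hq h.1 hab
    · have := clusterPot_split_balanced hq hp h.2 hab
      rw [add_comm (b + cut), add_comm q] at this
      linarith
  · set s := a + cut + (b + cut) with hs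
    rcases Nat.eq_zero_or_pos s with h0 | h0
    · obtain ⟨rfl, rfl, rfl⟩ : a = 0 ∧ b = 0 ∧ cut = 0 := by omega
      simp [clusterPot, h0]
    have ha := clusterPot_le_of_le (a := a + cut) (s := s) (p := p) (r := p + q - 1)
      (Nat.le_add_right a cut) (by omega) (by omega) (by omega) hp
    have hb := clusterPot_le_of_le (a := b + cut) (s := s) (p := q) (r := p + q - 1)
      (Nat.le_add_right b cut) (by omega) (by omega) (by omega) hq
    have hsR : (0 : ℝ) < s := by exact_mod_cast h0
    have hr : ((p + q - 1 : ℕ) : ℝ) = (p + q : ℕ) - 1 := by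
      rw [Nat.cast_sub (by omega)]; simp
    have hr2 : (2 : ℝ) ≤ (p + q : ℕ) := by exact_mod_cast (by omega : 2 ≤ p + q)
    set r : ℝ := ((p + q : ℕ) : ℝ) with hrdef
    have hlog : Real.log (s * (r - 1)) ≤ Real.log (s * r) - 1 / r := by
      rw [Real.log_mul hsR.ne' (by linarith), Real.log_mul hsR.ne' (by linarith)]
      have h1 := Real.log_le_sub_one_of_pos (x := (r - 1) / r) (div_pos (by linarith) (by linarith))
      rw [Real.log_div (by linarith) (by linarith)] at h1
      have : (r - 1) / r = 1 - 1 / r := by field_simp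
      linarith
    rw [hr] at ha hb
    have hsum : ((a + cut : ℕ) : ℝ) + (b + cut : ℕ) = s := by rw [hs]; push_cast; ring
    have hcut : (σ * cut : ℝ) ≤ s / r := by
      rw [le_div_iff₀ (by linarith)]
      have : (σ * (p + q) * cut : ℝ) ≤ s := by exact_mod_cast h
      rw [hrdef]; push_cast; linarith
    have h5 : s * Real.log (s * (r - 1)) ≤ s * (Real.log (s * r) - 1 / r) := by gcongr
    have h6 : (s : ℝ) * (1 / r) = s / r := by ring
    have h7 : (0 : ℝ) ≤ σ * cut := by positivity
    have e : clusterPot s (p + q) = s * Real.log (s * r) := rfl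
    have h8 : (a + cut : ℕ) * Real.log (s * (r - 1)) + (b + cut : ℕ) * Real.log (s * (r - 1))
        = s * Real.log (s * (r - 1)) := by rw [← add_mul, hsum]
    rw [mul_sub (s : ℝ) (Real.log (s * r))] at h5
    rw [e]
    linarith

section Clusters

variable {V : Type*} [Fintype V]

/-- The cluster with the index `c`. -/
def cluster (comp : V → ℕ) (c : ℕ) : Finset V := Finset.univ.filter fun v => comp v = c

lemma mem_cluster {comp : V → ℕ} {c : ℕ} {v : V} : v ∈ cluster comp c ↔ comp v = c := by
  simp [cluster]

/-- The edges of `F` inside the cluster with the index `c`. -/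
def clusterMat (F : V → V → ℕ) (comp : V → ℕ) (c : ℕ) (u w : V) : ℕ :=
  if comp u = c ∧ comp w = c then F u w else 0

/-- The volume of `S` in the multigraph with adjacency matrix `A`. -/
def nvol (A : V → V → ℕ) (S : Finset V) : ℕ := ∑ u ∈ S, ∑ w, A u w

/-- Twice the number of edges between different clusters. -/
def crossing (F : V → V → ℕ) (comp : V → ℕ) : ℕ :=
  ∑ u, ∑ w, if comp u ≠ comp w then F u w else 0

/-- What holds for every partition that arises by admissible splits: the clusters are indexed by
`0, …, cnt - 1`, none is empty, and the potential has paid for the crossing edges. -/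
structure PartitionInv (σ : ℕ) (F : V → V → ℕ) (comp : V → ℕ) (cnt : ℕ) : Prop where
  lt : ∀ v, comp v < cnt
  surj : ∀ c < cnt, ∃ v, comp v = c
  pot : σ / 3 * (crossing F comp : ℝ)
      + ∑ c ∈ Finset.range cnt,
          clusterPot (nvol (clusterMat F comp c) Finset.univ) (cluster comp c).card
    ≤ clusterPot (nvol F Finset.univ) (Fintype.card V)

lemma PartitionInv.cnt_le {σ : ℕ} {F : V → V → ℕ} {comp : V → ℕ} {cnt : ℕ}
    (h : PartitionInv σ F comp cnt) : cnt ≤ Fintype.card V := by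
  choose f hf using fun c : Fin cnt => h.surj c c.2
  have hinj : Function.Injective f := fun a b hab => Fin.ext (by rw [← hf a, ← hf b, hab])
  simpa using Fintype.card_le_of_injective f hinj

lemma partitionInv_zero [Nonempty V] (σ : ℕ) (F : V → V → ℕ) :
    PartitionInv σ F (fun _ => 0) 1 where
  lt _ := by simp
  surj c hc := ⟨Classical.arbitrary V, by omega⟩
  pot := by
    have h1 : clusterMat F (fun _ => 0) 0 = F := by
      funext u w; simp [clusterMat]
    have h2 : cluster (V := V) (fun _ => 0) 0 = Finset.univ := by simp [cluster]
    simp [crossing, h1, h2]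

/-- If `σ` is large enough, at most half of the edges of `F` cross. -/
lemma PartitionInv.crossing_le {σ : ℕ} {F : V → V → ℕ} {comp : V → ℕ} {cnt : ℕ}
    (h : PartitionInv σ F comp cnt) (hF : ∀ u w, F u w ≤ 1)
    (hσ : 18 * Real.log (Fintype.card V) ≤ σ) (hσ0 : 0 < σ) :
    2 * crossing F comp ≤ nvol F Finset.univ := by
  have hpos : 0 ≤ ∑ c ∈ Finset.range cnt,
      clusterPot (nvol (clusterMat F comp c) Finset.univ) (cluster comp c).card := by
    refine Finset.sum_nonneg fun c hc => ?_
    obtain ⟨v, hv⟩ := h.surj c (Finset.mem_range.1 hc)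
    have hp : 1 ≤ (cluster comp c).card := Finset.card_pos.2 ⟨v, by simp [cluster, hv]⟩
    unfold clusterPot
    refine mul_nonneg (by positivity) ?_
    rcases Nat.eq_zero_or_pos (nvol (clusterMat F comp c) Finset.univ) with h0 | h0
    · simp [h0]
    · exact Real.log_nonneg (by exact_mod_cast Nat.mul_pos h0 hp)
  have hpot := h.pot
  set a := nvol F Finset.univ with ha
  set n := Fintype.card V with hn
  have han : a ≤ n * n := by
    calc a ≤ ∑ _u : V, ∑ _w : V, 1 := Finset.sum_le_sum fun u _ => Finset.sum_le_sum fun w _ => hF u w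
      _ = n * n := by simp [hn]
  have hle : clusterPot a n ≤ a * (σ / 6) := by
    unfold clusterPot
    rcases Nat.eq_zero_or_pos a with h0 | h0
    · simp [h0]
    have hn0 : 0 < n := by
      rcases Nat.eq_zero_or_pos n with h' | h'
      · rw [h'] at han; omega
      · exact h'
    refine mul_le_mul_of_nonneg_left ?_ (by positivity)
    calc Real.log ((a : ℝ) * n) ≤ Real.log ((n : ℝ) ^ 3) := by
          refine Real.log_le_log (by exact_mod_cast Nat.mul_pos h0 hn0) ?_
          have : a * n ≤ n ^ 3 := by nlinarith
          exact_mod_cast this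
      _ = 3 * Real.log n := by rw [Real.log_pow]; norm_num
      _ ≤ σ / 6 := by linarith
  have hσR : (0 : ℝ) < σ := by exact_mod_cast hσ0
  have : (σ : ℝ) * (2 * crossing F comp) ≤ σ * a := by linarith
  exact_mod_cast le_of_mul_le_mul_left this hσR

variable [DecidableEq V]

/-- The number of edges of `A` between `S` and its complement. -/
def ncut (A : V → V → ℕ) (S : Finset V) : ℕ := ∑ u ∈ S, ∑ w ∈ Sᶜ, A u w

/-- The split of the cluster with the index `c` into `S` and the rest is admissible: the cut is
sparse, or the number of its edges is below a fraction of the average degree. -/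
def Splittable (σ : ℕ) (F : V → V → ℕ) (comp : V → ℕ) (c : ℕ) (S : Finset V) : Prop :=
  S.Nonempty ∧ S ⊂ cluster comp c ∧
    ((σ * ncut (clusterMat F comp c) S ≤ nvol (clusterMat F comp c) S ∧
      σ * ncut (clusterMat F comp c) S ≤ nvol (clusterMat F comp c) Sᶜ) ∨
      σ * (cluster comp c).card * ncut (clusterMat F comp c) S
        ≤ nvol (clusterMat F comp c) Finset.univ)

/-- The partition after splitting `S` off as the cluster with the index `k`. -/
def splitOff (comp : V → ℕ) (S : Finset V) (k : ℕ) (v : V) : ℕ := if v ∈ S then k else comp v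

lemma splitOff_sum {F : V → V → ℕ} (hs : ∀ u w, F u w = F w u) {comp : V → ℕ} {c k : ℕ}
    {S : Finset V} (hS : S ⊆ cluster comp c) (hk : ∀ v, comp v ≠ k) (hck : c ≠ k) :
    (nvol (clusterMat F (splitOff comp S k) k) Finset.univ + ncut (clusterMat F comp c) S
        = nvol (clusterMat F comp c) S) ∧
    (nvol (clusterMat F (splitOff comp S k) c) Finset.univ + ncut (clusterMat F comp c) S
        = nvol (clusterMat F comp c) Sᶜ) ∧
    crossing F (splitOff comp S k) = crossing F comp + 2 * ncut (clusterMat F comp c) S := by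
  have hS' : ∀ v ∈ S, comp v = c := fun v hv => by simpa [cluster] using hS hv
  have e1 : ncut (clusterMat F comp c) S
      = ∑ u, ∑ w, if u ∈ S ∧ w ∉ S then clusterMat F comp c u w else 0 := by
    unfold ncut
    rw [← Finset.sum_filter_add_sum_filter_not Finset.univ (fun u => u ∈ S)]
    rw [Finset.sum_eq_zero (s := Finset.univ.filter fun u => u ∉ S)]
    · simp only [Finset.filter_univ_mem, add_zero]
      refine Finset.sum_congr rfl fun u hu => ?_
      rw [← Finset.sum_filter]
      refine Finset.sum_congr ?_ fun _ _ => rfl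
      ext w; simp [hu]
    · intro u hu
      simp only [Finset.mem_filter, Finset.mem_univ, true_and] at hu
      simp [hu]
  have e1' : ncut (clusterMat F comp c) S
      = ∑ u, ∑ w, if u ∉ S ∧ w ∈ S then clusterMat F comp c u w else 0 := by
    rw [e1, Finset.sum_comm]
    refine Finset.sum_congr rfl fun u _ => Finset.sum_congr rfl fun w _ => ?_
    simp only [clusterMat, hs w u, and_comm]
  have e2 : ∀ T : Finset V, nvol (clusterMat F comp c) T
      = ∑ u, ∑ w, if u ∈ T then clusterMat F comp c u w else 0 := by
    intro T
    simp only [nvol]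
    rw [← Finset.sum_filter_add_sum_filter_not Finset.univ (fun u => u ∈ T)]
    rw [Finset.sum_eq_zero (s := Finset.univ.filter fun u => u ∉ T)]
    · simp only [Finset.filter_univ_mem, add_zero]
      exact Finset.sum_congr rfl fun u hu => by simp [hu]
    · intro u hu
      simp only [Finset.mem_filter, Finset.mem_univ, true_and] at hu
      simp [hu]
  refine ⟨?_, ?_, ?_⟩
  · rw [e1, e2]
    simp only [nvol, ← Finset.sum_add_distrib]
    refine Finset.sum_congr rfl fun u _ => Finset.sum_congr rfl fun w _ => ?_
    have hu := hS' u; have hw := hS' w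
    have hku := hk u; have hkw := hk w
    by_cases h1 : u ∈ S <;> by_cases h2 : w ∈ S <;> simp_all [clusterMat, splitOff]
  · rw [e1', e2]
    simp only [nvol, ← Finset.sum_add_distrib]
    refine Finset.sum_congr rfl fun u _ => Finset.sum_congr rfl fun w _ => ?_
    have hu := hS' u; have hw := hS' w
    by_cases h1 : u ∈ S <;> by_cases h2 : w ∈ S <;> simp_all [clusterMat, splitOff, Ne.symm hck]
  · rw [two_mul]
    nth_rewrite 1 [e1]
    rw [e1']
    simp only [crossing, ← Finset.sum_add_distrib]
    refine Finset.sum_congr rfl fun u _ => Finset.sum_congr rfl fun w _ => ?_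
    have hu := hS' u; have hw := hS' w
    have hku := hk u; have hkw := hk w
    by_cases h1 : u ∈ S <;> by_cases h2 : w ∈ S
    · simp [splitOff, h1, h2, hu h1, hw h2]
    · by_cases h3 : comp w = c
      · simp [clusterMat, splitOff, h1, h2, hu h1, h3, Ne.symm hck]
      · simp [clusterMat, splitOff, h1, h2, hu h1, h3, Ne.symm hkw, Ne.symm h3]
    · by_cases h3 : comp u = c
      · simp [clusterMat, splitOff, h1, h2, hw h2, h3, hck]
      · simp [clusterMat, splitOff, h1, h2, hw h2, h3, hku]
    · simp [splitOff, h1, h2]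

lemma PartitionInv.split {σ : ℕ} {F : V → V → ℕ} (hs : ∀ u w, F u w = F w u) {comp : V → ℕ}
    {cnt : ℕ} (h : PartitionInv σ F comp cnt) {c : ℕ} {S : Finset V}
    (hS : Splittable σ F comp c S) : PartitionInv σ F (splitOff comp S cnt) (cnt + 1) := by
  obtain ⟨hne, hsub, hcond⟩ := hS
  have hS' : ∀ v ∈ S, comp v = c := fun v hv => by simpa [cluster] using hsub.1 hv
  obtain ⟨v0, hv0⟩ := hne
  have hc : c < cnt := hS' v0 hv0 ▸ h.lt v0
  obtain ⟨z, hz, hzS⟩ := Finset.exists_of_ssubset hsub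
  have hz' : comp z = c := by simpa [cluster] using hz
  have hk : ∀ v, comp v ≠ cnt := fun v => (h.lt v).ne
  obtain ⟨i1, i2, i3⟩ := splitOff_sum hs hsub.1 hk hc.ne
  have c1 : cluster (splitOff comp S cnt) cnt = S := by
    ext v; by_cases hv : v ∈ S <;> simp [cluster, splitOff, hv, hk v]
  have c2 : (cluster (splitOff comp S cnt) c).card + S.card = (cluster comp c).card := by
    have : cluster (splitOff comp S cnt) c = cluster comp c \ S := by
      ext v; by_cases hv : v ∈ S <;> simp [mem_cluster, splitOff, hv, hc.ne']
    rw [this, Finset.card_sdiff_add_card_eq_card hsub.1]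
  have other : ∀ c' ∈ (Finset.range cnt).erase c,
      clusterPot (nvol (clusterMat F (splitOff comp S cnt) c') Finset.univ)
        (cluster (splitOff comp S cnt) c').card
      = clusterPot (nvol (clusterMat F comp c') Finset.univ) (cluster comp c').card := by
    intro c' hc'
    simp only [Finset.mem_erase, Finset.mem_range] at hc'
    have e : ∀ v, splitOff comp S cnt v = c' ↔ comp v = c' := by
      intro v
      unfold splitOff
      split_ifs with hv
      · rw [hS' v hv]; constructor <;> intro h'' <;> omega
      · rfl
    have e1 : cluster (splitOff comp S cnt) c' = cluster comp c' := by
      ext v; simp [cluster, e]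
    have e2 : clusterMat F (splitOff comp S cnt) c' = clusterMat F comp c' := by
      funext u w; simp [clusterMat, e]
    rw [e1, e2]
  refine ⟨fun v => ?_, fun c' hc' => ?_, ?_⟩
  · unfold splitOff; split_ifs
    · omega
    · exact (h.lt v).trans (by omega)
  · rcases Nat.lt_succ_iff_lt_or_eq.1 hc' with h' | rfl
    · rcases eq_or_ne c' c with rfl | hcc
      · exact ⟨z, by simp [splitOff, hzS, hz']⟩
      · obtain ⟨v, hv⟩ := h.surj c' h'
        refine ⟨v, ?_⟩
        rw [splitOff, if_neg fun hvS => hcc (by rw [← hv, hS' v hvS]), hv]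
    · exact ⟨v0, by simp [splitOff, hv0]⟩
  · refine le_trans ?_ h.pot
    rw [Finset.sum_range_succ, ← Finset.add_sum_erase _ _ (Finset.mem_range.2 hc),
      Finset.sum_congr rfl other, ← Finset.add_sum_erase (Finset.range cnt)
        (fun c => clusterPot (nvol (clusterMat F comp c) Finset.univ) (cluster comp c).card)
        (Finset.mem_range.2 hc), i3, c1]
    set A := clusterMat F comp c with hA
    have hvol : nvol A Finset.univ = nvol A S + nvol A Sᶜ := by
      simp only [nvol]; exact (Finset.sum_add_sum_compl S _).symm
    have hq : 1 ≤ (cluster (splitOff comp S cnt) c).card :=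
      Finset.card_pos.2 ⟨z, by simp [mem_cluster, splitOff, hzS, hz']⟩
    have key := clusterPot_split (σ := σ) (cut := ncut A S)
      (a := nvol (clusterMat F (splitOff comp S cnt) cnt) Finset.univ)
      (b := nvol (clusterMat F (splitOff comp S cnt) c) Finset.univ) (Finset.card_pos.2 ⟨v0, hv0⟩) hq (by
      rw [i1, i2, add_comm S.card, c2, ← hvol]
      exact hcond)
    rw [i1, i2, add_comm S.card, c2, ← hvol] at key
    push_cast
    linarith

end Clusters


/-! ### Stable partitions and the labelling of the edges, level by level -/

section Levels

variable {V : Type*} [Fintype V]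

/-- A real matrix from a matrix of natural numbers. -/
def realMat (A : V → V → ℕ) (u w : V) : ℝ := A u w

lemma wvol_realMat (A : V → V → ℕ) (S : Finset V) : wvol (realMat A) S = nvol A S := by
  simp [wvol, wdeg, nvol, realMat]

variable [DecidableEq V]

lemma wcut_realMat (A : V → V → ℕ) (S : Finset V) : wcut (realMat A) S = ncut A S := by
  simp [wcut, ncut, realMat]

/-- The clusters of `comp` are `α`-expanders and `1 / σ`-weakly-regular, and at most half of the
edges of `F` run between them. -/
structure GoodPartition (α : ℝ) (σ : ℕ) (F : V → V → ℕ) (comp : V → ℕ) : Prop where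
  lt : ∀ v, comp v < Fintype.card V
  crossing_le : 2 * crossing F comp ≤ nvol F Finset.univ
  expand : ∀ c, ∀ S, S ⊆ cluster comp c →
    α * min (nvol (clusterMat F comp c) S : ℝ) (nvol (clusterMat F comp c) Sᶜ)
      ≤ ncut (clusterMat F comp c) S
  regular : ∀ c, ∀ v ∈ cluster comp c, nvol (clusterMat F comp c) Finset.univ
    ≤ σ * (cluster comp c).card * ∑ w, clusterMat F comp c v w

lemma ncut_singleton {F : V → V → ℕ} (hF : ∀ v, F v v = 0) {comp : V → ℕ} {c : ℕ} (v : V) :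
    ncut (clusterMat F comp c) {v} = ∑ w, clusterMat F comp c v w := by
  simp only [ncut, Finset.sum_singleton]
  refine Finset.sum_subset (Finset.subset_univ _) fun w _ hw => ?_
  simp only [Finset.mem_compl, Finset.mem_singleton, not_not] at hw
  simp [clusterMat, hw, hF]

/-- Weak regularity holds as soon as no single vertex can be split off. -/
lemma regular_of_not_splittable {σ : ℕ} {F : V → V → ℕ} (hF : ∀ v, F v v = 0) {comp : V → ℕ}
    {c : ℕ} {v : V} (hv : v ∈ cluster comp c) (h : ¬ Splittable σ F comp c {v}) :
    nvol (clusterMat F comp c) Finset.univ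
      ≤ σ * (cluster comp c).card * ∑ w, clusterMat F comp c v w := by
  by_cases hss : {v} ⊂ cluster comp c
  · by_contra hlt
    push Not at hlt
    refine h ⟨by simp, hss, Or.inr ?_⟩
    rw [ncut_singleton hF]
    exact hlt.le
  · have he : cluster comp c = {v} := by
      by_contra hne
      exact hss (Finset.ssubset_iff_subset_ne.2 ⟨by simpa using hv, Ne.symm hne⟩)
    have hmem : ∀ u, comp u = c → u = v := by
      intro u hu
      have : u ∈ cluster comp c := mem_cluster.2 hu
      simpa [he] using this
    have : nvol (clusterMat F comp c) Finset.univ = 0 := by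
      refine Finset.sum_eq_zero fun u _ => Finset.sum_eq_zero fun w _ => ?_
      unfold clusterMat
      split_ifs with huw
      · rw [hmem u huw.1, hmem w huw.2, hF]
      · rfl
    omega

/-- Expansion by `1 / σ` of a set along which the cluster cannot be split. -/
lemma min_le_of_not_splittable {σ : ℕ} {F : V → V → ℕ} {comp : V → ℕ} {c : ℕ} {S : Finset V}
    (hS : S ⊆ cluster comp c) (h : ¬ Splittable σ F comp c S) :
    min (nvol (clusterMat F comp c) S) (nvol (clusterMat F comp c) Sᶜ)
      ≤ σ * ncut (clusterMat F comp c) S := by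
  rcases S.eq_empty_or_nonempty with rfl | hne
  · simp [nvol]
  by_cases hss : S ⊂ cluster comp c
  · by_contra hlt
    push Not at hlt
    rw [lt_min_iff] at hlt
    exact h ⟨hne, hss, Or.inl ⟨hlt.1.le, hlt.2.le⟩⟩
  · have he : S = cluster comp c := by
      by_contra hne'
      exact hss (Finset.ssubset_iff_subset_ne.2 ⟨hS, hne'⟩)
    have : nvol (clusterMat F comp c) Sᶜ = 0 := by
      refine Finset.sum_eq_zero fun u hu => Finset.sum_eq_zero fun w _ => ?_
      rw [he, Finset.mem_compl, mem_cluster] at hu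
      simp [clusterMat, hu]
    simp [this]

/-- A partition without admissible splits exists, because every split increases the number of
clusters. -/
lemma exists_goodPartition [Nonempty V] {σ : ℕ} {F : V → V → ℕ} (hs : ∀ u w, F u w = F w u)
    (hF : ∀ u w, F u w ≤ 1) (hF0 : ∀ v, F v v = 0)
    (hσ : 18 * Real.log (Fintype.card V) ≤ σ) (hσ0 : 0 < σ) :
    ∃ comp, GoodPartition (1 / (σ : ℝ)) σ F comp := by
  have main : ∀ k comp cnt, PartitionInv σ F comp cnt → Fintype.card V - cnt = k →
      ∃ comp' cnt', PartitionInv σ F comp' cnt' ∧ ∀ c S, ¬ Splittable σ F comp' c S := by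
    intro k
    induction k with
    | zero =>
      intro comp cnt h hk
      refine ⟨comp, cnt, h, fun c S hS => ?_⟩
      have := (h.split hs hS).cnt_le
      omega
    | succ k ih =>
      intro comp cnt h hk
      by_cases hsp : ∃ c S, Splittable σ F comp c S
      · obtain ⟨c, S, hS⟩ := hsp
        exact ih _ _ (h.split hs hS) (by omega)
      · push Not at hsp
        exact ⟨comp, cnt, h, hsp⟩
  obtain ⟨comp, cnt, h, hstab⟩ := main _ _ _ (partitionInv_zero σ F) rfl
  refine ⟨comp, fun v => (h.lt v).trans_le h.cnt_le, h.crossing_le hF hσ hσ0, fun c S hS => ?_,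
    fun c v hv => regular_of_not_splittable hF0 hv (hstab c _)⟩
  have hσR : (0 : ℝ) < σ := by exact_mod_cast hσ0
  rw [div_mul_eq_mul_div, one_mul, div_le_iff₀ hσR, mul_comm]
  have := min_le_of_not_splittable hS (hstab c S)
  exact_mod_cast this

end Levels

section Labels

variable {n : ℕ} (G : SimpleGraph (Fin n))

open scoped Classical in
/-- The adjacency matrix of the edges with the label `i` (where `0` means unlabelled). -/
noncomputable def labMat (lab : Fin n → Fin n → ℕ) (i : ℕ) (u w : Fin n) : ℕ :=
  if G.Adj u w ∧ lab u w = i then 1 else 0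

/-- The state after `L` levels: the edges labelled at level `ℓ` carry the labels `ℓ n + c + 1`, where
`c` is the cluster of the edge in the partition of that level, and form good pieces; the number of
unlabelled edges has dropped by the factor `2 ^ L`. -/
structure LevelInv (α : ℝ) (σ L : ℕ) (lab : Fin n → Fin n → ℕ) (comps : ℕ → Fin n → ℕ) :
    Prop where
  symm : ∀ u w, G.Adj u w → lab u w = lab w u
  lt : ∀ l < L, ∀ v, comps l v < n
  eq : ∀ u w, G.Adj u w → lab u w ≠ 0 →
    ∃ l < L, lab u w = l * n + comps l u + 1 ∧ comps l w = comps l u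
  expand : ∀ l < L, ∀ c < n, ∀ S, S ⊆ cluster (comps l) c →
    α * min (nvol (labMat G lab (l * n + c + 1)) S : ℝ) (nvol (labMat G lab (l * n + c + 1)) Sᶜ)
      ≤ ncut (labMat G lab (l * n + c + 1)) S
  regular : ∀ l < L, ∀ c < n, ∀ v ∈ cluster (comps l) c,
    nvol (labMat G lab (l * n + c + 1)) Finset.univ
      ≤ σ * (cluster (comps l) c).card * ∑ w, labMat G lab (l * n + c + 1) v w
  vol : 2 ^ L * nvol (labMat G lab 0) Finset.univ ≤ n * n

/-- The labels after the level `l` with the partition `comp`. -/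
def relabel (lab : Fin n → Fin n → ℕ) (l : ℕ) (comp : Fin n → ℕ) (u w : Fin n) : ℕ :=
  if lab u w = 0 ∧ comp u = comp w then l * n + comp u + 1 else lab u w

variable {G}

lemma labMat_symm {lab : Fin n → Fin n → ℕ} (h : ∀ u w, G.Adj u w → lab u w = lab w u) (i : ℕ)
    (u w : Fin n) : labMat G lab i u w = labMat G lab i w u := by
  unfold labMat
  by_cases hadj : G.Adj u w
  · rw [h u w hadj, G.adj_comm]
  · have : ¬ G.Adj w u := fun h' => hadj h'.symm
    simp [hadj, this]

lemma labMat_le_one (lab : Fin n → Fin n → ℕ) (i : ℕ) (u w : Fin n) : labMat G lab i u w ≤ 1 := by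
  unfold labMat; split_ifs <;> omega

lemma labMat_self (lab : Fin n → Fin n → ℕ) (i : ℕ) (v : Fin n) : labMat G lab i v v = 0 := by
  simp [labMat]

lemma levelInv_zero (α : ℝ) (σ : ℕ) : LevelInv G α σ 0 (fun _ _ => 0) (fun _ _ => 0) where
  symm _ _ _ := rfl
  lt _ h := by omega
  eq _ _ _ h := by simp at h
  expand _ h := by omega
  regular _ h := by omega
  vol := by
    calc 2 ^ 0 * nvol (labMat G (fun _ _ => 0) 0) Finset.univ
        ≤ 1 * ∑ _u : Fin n, ∑ _w : Fin n, 1 := by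
          refine Nat.mul_le_mul (by simp) ?_
          exact Finset.sum_le_sum fun u _ => Finset.sum_le_sum fun w _ => labMat_le_one _ _ u w
      _ = n * n := by simp

/-- Labelling the clusters of a good partition of the unlabelled edges. -/
lemma LevelInv.succ {α : ℝ} {σ L : ℕ} {lab : Fin n → Fin n → ℕ} {comps : ℕ → Fin n → ℕ}
    (h : LevelInv G α σ L lab comps) {comp : Fin n → ℕ}
    (hc : GoodPartition α σ (labMat G lab 0) comp) :
    LevelInv G α σ (L + 1) (relabel lab L comp) (Function.update comps L comp) := by
  have hlt : ∀ v, comp v < n := fun v => by simpa using hc.lt v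
  have hlab : ∀ u w, G.Adj u w → lab u w ≤ L * n := by
    intro u w hadj
    by_cases h0 : lab u w = 0
    · omega
    · obtain ⟨l, hl, he, -⟩ := h.eq u w hadj h0
      have := h.lt l hl u
      have : (l + 1) * n ≤ L * n := Nat.mul_le_mul_right n hl
      rw [Nat.add_mul] at this
      omega
  have old : ∀ l < L, ∀ c < n, labMat G (relabel lab L comp) (l * n + c + 1)
      = labMat G lab (l * n + c + 1) := by
    intro l hl c hcn
    have h1 : (l + 1) * n ≤ L * n := Nat.mul_le_mul_right n hl
    rw [Nat.add_mul] at h1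
    funext u w
    unfold labMat
    congr 1
    refine propext (and_congr_right fun _ => ?_)
    unfold relabel
    split_ifs with h2
    · constructor <;> intro h3 <;> omega
    · rfl
  have new : ∀ c < n, labMat G (relabel lab L comp) (L * n + c + 1)
      = clusterMat (labMat G lab 0) comp c := by
    intro c hcn
    funext u w
    unfold labMat clusterMat relabel
    by_cases hadj : G.Adj u w
    · have h1 := hlab u w hadj
      by_cases h0 : lab u w = 0
      · by_cases h2 : comp u = comp w
        · by_cases h3 : comp w = c
          · simp [hadj, h0, h2, h3]
          · simp [hadj, h0, h2, h3]
        · have : ¬ (comp u = c ∧ comp w = c) := fun h3 => h2 (h3.1.trans h3.2.symm)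
          simp [hadj, h0, h2, this]
      · have : lab u w ≠ L * n + c + 1 := by omega
        simp [hadj, h0, this]
    · simp [hadj]
  refine ⟨fun u w hadj => ?_, fun l hl v => ?_, fun u w hadj hne => ?_, fun l hl c hcn S hS => ?_,
    fun l hl c hcn v hv => ?_, ?_⟩
  · unfold relabel
    rw [h.symm u w hadj]
    by_cases h2 : comp u = comp w
    · simp [h2]
    · simp [h2, Ne.symm h2]
  · rcases Nat.lt_succ_iff_lt_or_eq.1 hl with h' | rfl
    · rw [Function.update_of_ne h'.ne]; exact h.lt l h' v
    · rw [Function.update_self]; exact hlt v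
  · unfold relabel at hne ⊢
    split_ifs at hne ⊢ with h2
    · exact ⟨L, by omega, by simp, by simp [h2.2]⟩
    · obtain ⟨l, hl, h3, h4⟩ := h.eq u w hadj hne
      refine ⟨l, by omega, ?_, ?_⟩ <;> rw [Function.update_of_ne hl.ne] <;> assumption
  · rcases Nat.lt_succ_iff_lt_or_eq.1 hl with h' | rfl
    · rw [Function.update_of_ne h'.ne] at hS
      rw [old l h' c hcn]
      exact h.expand l h' c hcn S hS
    · rw [Function.update_self] at hS
      rw [new c hcn]
      exact hc.expand c S hS
  · rcases Nat.lt_succ_iff_lt_or_eq.1 hl with h' | rfl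
    · rw [Function.update_of_ne h'.ne] at hv ⊢
      rw [old l h' c hcn]
      exact h.regular l h' c hcn v hv
    · rw [Function.update_self] at hv ⊢
      rw [new c hcn]
      exact hc.regular c v hv
  · have : nvol (labMat G (relabel lab L comp) 0) Finset.univ = crossing (labMat G lab 0) comp := by
      refine Finset.sum_congr rfl fun u _ => Finset.sum_congr rfl fun w _ => ?_
      have hr : relabel lab L comp u w = 0 ↔ lab u w = 0 ∧ comp u ≠ comp w := by
        by_cases h0 : lab u w = 0 <;> by_cases h2 : comp u = comp w <;> simp [relabel, h0, h2]
      by_cases h2 : comp u = comp w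
      · rw [labMat, if_neg fun h' => (hr.1 h'.2).2 h2, if_neg (not_not.2 h2)]
      · classical
        rw [if_pos h2, labMat, labMat]
        exact if_congr (and_congr_right fun _ => by simp [hr, h2]) rfl rfl
    rw [this, pow_succ, mul_assoc]
    exact (Nat.mul_le_mul_left _ hc.crossing_le).trans h.vol

/-- The pieces of a labelling: piece `l n + c` lives on the cluster `c` of level `l`. -/
def labPiece {α : ℝ} {σ L : ℕ} {lab : Fin n → Fin n → ℕ} {comps : ℕ → Fin n → ℕ}
    (h : LevelInv G α σ L lab comps) (i : Fin (L * n)) : G.Subgraph where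
  verts := {v | comps (i / n) v = i % n}
  Adj u w := G.Adj u w ∧ lab u w = i + 1
  adj_sub h := h.1
  edge_vert := by
    rintro u w ⟨hadj, hl⟩
    obtain ⟨l, hl', h1, h2⟩ := h.eq u w hadj (by omega)
    have hlt := h.lt l hl' u
    have : (i : ℕ) = comps l u + n * l := by
      have := mul_comm n l
      omega
    simp only [Set.mem_ofPred_eq, this]
    rw [Nat.add_mul_div_left _ _ (by omega), Nat.div_eq_of_lt hlt, Nat.add_mul_mod_self_left,
      Nat.mod_eq_of_lt hlt, zero_add]
  symm := ⟨fun u w ⟨hadj, hl⟩ => ⟨hadj.symm, by rw [← h.symm u w hadj]; exact hl⟩⟩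

/-- Once `2 ^ L` exceeds the number of vertex pairs all edges are labelled, and the pieces are an
expander decomposition with overlap at most `L`. -/
lemma LevelInv.isExpanderDecomposition {α : ℝ} {σ L : ℕ} {lab : Fin n → Fin n → ℕ}
    {comps : ℕ → Fin n → ℕ} (h : LevelInv G α σ L lab comps) (hL : n * n < 2 ^ L) {α' K : ℝ}
    (hα0 : 0 ≤ α') (hα : α' ≤ α) (hσ : α' * σ ≤ 4) (hK : (L : ℝ) ≤ K) :
    IsExpanderDecomposition (labPiece h) α' K := by
  have hzero : ∀ u w, G.Adj u w → lab u w ≠ 0 := by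
    intro u w hadj h0
    have h1 : 1 ≤ nvol (labMat G lab 0) Finset.univ := by
      have : labMat G lab 0 u w = 1 := by simp [labMat, hadj, h0]
      rw [← this]
      refine le_trans (Finset.single_le_sum (f := fun w => labMat G lab 0 u w)
        (fun _ _ => Nat.zero_le _) (Finset.mem_univ w)) ?_
      exact Finset.single_le_sum (f := fun u => ∑ w, labMat G lab 0 u w)
        (fun _ _ => Nat.zero_le _) (Finset.mem_univ u)
    have := h.vol
    nlinarith
  have hmat : ∀ i : Fin (L * n), adjMat (labPiece h i)
      = realMat (labMat G lab ((i : ℕ) / n * n + (i : ℕ) % n + 1)) := by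
    intro i
    funext u w
    rw [Nat.div_add_mod']
    by_cases hi : G.Adj u w ∧ lab u w = i + 1
    · rw [adjMat, realMat, labMat, if_pos hi, if_pos (show (labPiece h i).Adj u w from hi),
        Nat.cast_one]
    · rw [adjMat, realMat, labMat, if_neg hi, if_neg (show ¬ (labPiece h i).Adj u w from hi),
        Nat.cast_zero]
  have hn : ∀ i : Fin (L * n), 0 < n := fun i => by
    rcases Nat.eq_zero_or_pos n with h0 | h0
    · have := i.2; simp [h0] at this
    · exact h0
  have hl : ∀ i : Fin (L * n), (i : ℕ) / n < L := fun i =>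
    (Nat.div_lt_iff_lt_mul (hn i)).2 i.2
  have hcl : ∀ i : Fin (L * n), ∀ v, v ∈ (labPiece h i).verts
      ↔ v ∈ cluster (comps ((i : ℕ) / n)) ((i : ℕ) % n) := by
    intro i v
    rw [mem_cluster]; rfl
  refine ⟨fun u w hadj => ?_, fun i S hS => ?_, fun i v hv => ?_, fun v => ?_⟩
  · have h0 := hzero u w hadj
    obtain ⟨l, hl', h1, h2⟩ := h.eq u w hadj h0
    have hlt := h.lt l hl' u
    have hb : (l + 1) * n ≤ L * n := Nat.mul_le_mul_right n hl'
    rw [Nat.add_mul] at hb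
    refine ⟨⟨lab u w - 1, by omega⟩, ⟨hadj, ?_⟩, ?_⟩
    · simp only; omega
    · rintro j ⟨-, hj⟩
      ext; simp only; omega
  · rw [← wvol_adjMat, ← wvol_adjMat, ← wcut_adjMat, hmat, wvol_realMat, wvol_realMat,
      wcut_realMat]
    refine le_trans (mul_le_mul_of_nonneg_right hα (by positivity))
      (h.expand _ (hl i) _ (Nat.mod_lt _ (hn i)) S fun v hv => (hcl i v).1 (hS hv))
  · have hr := h.regular _ (hl i) _ (Nat.mod_lt _ (hn i)) v ((hcl i v).1 hv)
    rw [← wvol_adjMat, ← wdeg_adjMat, hmat, wvol_realMat]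
    set A := labMat G lab ((i : ℕ) / n * n + (i : ℕ) % n + 1) with hA
    have hd : wdeg (realMat A) v = ((∑ w, A v w : ℕ) : ℝ) := by simp [wdeg, realMat]
    have hcard : (labPiece h i).verts.ncard = (cluster (comps ((i : ℕ) / n)) ((i : ℕ) % n)).card := by
      rw [← Set.ncard_coe_finset]
      congr 1
      ext v; rw [hcl]; simp
    have hpos : 0 < (cluster (comps ((i : ℕ) / n)) ((i : ℕ) % n)).card :=
      Finset.card_pos.2 ⟨v, (hcl i v).1 hv⟩
    rw [hd, hcard]
    set p := (cluster (comps ((i : ℕ) / n)) ((i : ℕ) % n)).card with hp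
    have hpR : (0 : ℝ) < p := by exact_mod_cast hpos
    have hrR : (nvol A Finset.univ : ℝ) ≤ σ * p * ((∑ w, A v w : ℕ) : ℝ) := by exact_mod_cast hr
    rw [mul_div_assoc', div_le_iff₀ hpR]
    calc α' / 4 * (nvol A Finset.univ : ℝ) ≤ α' / 4 * (σ * p * ((∑ w, A v w : ℕ) : ℝ)) := by gcongr
      _ = (α' * σ) / 4 * (p * ((∑ w, A v w : ℕ) : ℝ)) := by ring
      _ ≤ 1 * (p * ((∑ w, A v w : ℕ) : ℝ)) := by gcongr; linarith
      _ = _ := by ring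
  · refine le_trans ?_ hK
    have : {i | v ∈ (labPiece h i).verts}.ncard ≤ (Finset.range L : Set ℕ).ncard := by
      refine Set.ncard_le_ncard_of_injOn (fun i => (i : ℕ) / n) (fun i _ => by simpa using hl i) ?_
      intro i hi j hj hij
      have hi' : comps ((i : ℕ) / n) v = (i : ℕ) % n := hi
      have hj' : comps ((j : ℕ) / n) v = (j : ℕ) % n := hj
      simp only at hij
      rw [hij] at hi'
      ext
      rw [← Nat.div_add_mod' i n, ← Nat.div_add_mod' j n, hij, ← hi', hj']
    rw [Set.ncard_coe_finset, Finset.card_range] at this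
    exact_mod_cast this

/-- Every graph has an expander decomposition with overlap `O(log n)`. -/
lemma exists_isExpanderDecomposition (G : SimpleGraph (Fin n)) (hn : 0 < n) {σ L : ℕ}
    (hσ : 18 * Real.log n ≤ σ) (hσ0 : 0 < σ) (hL : n * n < 2 ^ L) {α K : ℝ} (hα0 : 0 ≤ α)
    (hα : α * σ ≤ 1) (hK : (L : ℝ) ≤ K) :
    ∃ (m : ℕ) (P : Fin m → G.Subgraph), IsExpanderDecomposition P α K := by
  have : Nonempty (Fin n) := ⟨⟨0, hn⟩⟩
  have main : ∀ l, ∃ lab comps, LevelInv G (1 / (σ : ℝ)) σ l lab comps := by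
    intro l
    induction l with
    | zero => exact ⟨_, _, levelInv_zero _ _⟩
    | succ l ih =>
      obtain ⟨lab, comps, h⟩ := ih
      obtain ⟨comp, hc⟩ := exists_goodPartition (σ := σ) (labMat_symm h.symm 0)
        (labMat_le_one lab 0) (labMat_self lab 0) (by simpa using hσ) hσ0
      exact ⟨_, _, h.succ hc⟩
  obtain ⟨lab, comps, h⟩ := main L
  have hσR : (0 : ℝ) < σ := by exact_mod_cast hσ0
  exact ⟨_, _, h.isExpanderDecomposition hL hα0 (by rwa [le_div_iff₀ hσR]) (by linarith) hK⟩

end Labels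


/-! ### Lazy random walks with rounding certify expansion -/

section Walk

variable {V : Type*} [Fintype V]

/-- One step of the lazy random walk, in the form of its action on densities. -/
noncomputable def walk (A : V → V → ℝ) (x : V → ℝ) (u : V) : ℝ :=
  (∑ w, A u w * (x u + x w)) / (2 * wdeg A u)

lemma wdeg_mul_walk {A : V → V → ℝ} (h0 : ∀ u w, 0 ≤ A u w) (x : V → ℝ) (u : V) :
    2 * (wdeg A u * walk A x u) = ∑ w, A u w * (x u + x w) := by
  unfold walk
  rcases eq_or_ne (wdeg A u) 0 with h | h
  · have : ∀ w, A u w = 0 := fun w =>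
      (Finset.sum_eq_zero_iff_of_nonneg fun w _ => h0 u w).1 h w (Finset.mem_univ w)
    simp [h, this]
  · field_simp

lemma sum_mul_left_wdeg (A : V → V → ℝ) (f : V → ℝ) :
    ∑ u, ∑ w, A u w * f u = ∑ u, wdeg A u * f u :=
  Finset.sum_congr rfl fun u _ => by rw [wdeg, Finset.sum_mul]

lemma sum_mul_right_wdeg {A : V → V → ℝ} (hs : ∀ u w, A u w = A w u) (f : V → ℝ) :
    ∑ u, ∑ w, A u w * f w = ∑ u, wdeg A u * f u := by
  rw [Finset.sum_comm, ← sum_mul_left_wdeg]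
  exact Finset.sum_congr rfl fun u _ => Finset.sum_congr rfl fun w _ => by rw [hs]

lemma sum_wdeg_walk {A : V → V → ℝ} (hs : ∀ u w, A u w = A w u) (h0 : ∀ u w, 0 ≤ A u w)
    (x : V → ℝ) : ∑ u, wdeg A u * walk A x u = ∑ u, wdeg A u * x u := by
  have h1 : 2 * ∑ u, wdeg A u * walk A x u = 2 * ∑ u, wdeg A u * x u := by
    rw [Finset.mul_sum, Finset.sum_congr rfl fun u _ => wdeg_mul_walk h0 x u]
    simp only [mul_add, Finset.sum_add_distrib]
    rw [sum_mul_left_wdeg, sum_mul_right_wdeg hs]; ring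
  linarith

/-- The walk decreases the quadratic norm around any centre by a quarter of the Dirichlet form. -/
lemma sum_walk_sub_sq_le {A : V → V → ℝ} (hs : ∀ u w, A u w = A w u) (h0 : ∀ u w, 0 ≤ A u w)
    (x : V → ℝ) (μ : ℝ) :
    ∑ u, wdeg A u * (walk A x u - μ) ^ 2
      ≤ ∑ u, wdeg A u * (x u - μ) ^ 2 - 1 / 4 * ∑ u, ∑ w, A u w * (x u - x w) ^ 2 := by
  have h1 : ∀ u, wdeg A u * (walk A x u - μ) ^ 2
      ≤ ∑ w, A u w * ((x u + x w) / 2 - μ) ^ 2 := by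
    intro u
    set z := walk A x u with hz
    -- the weighted variance of the averages around their mean is nonnegative
    have hvar : 0 ≤ ∑ w, A u w * ((x u + x w) / 2 - z) ^ 2 :=
      Finset.sum_nonneg fun w _ => mul_nonneg (h0 u w) (sq_nonneg _)
    have e : ∑ w, A u w * ((x u + x w) / 2 - μ) ^ 2
        = ∑ w, A u w * ((x u + x w) / 2 - z) ^ 2
          + (z - μ) * ∑ w, A u w * (x u + x w) - (z ^ 2 - μ ^ 2) * wdeg A u := by
      rw [wdeg, Finset.mul_sum, Finset.mul_sum, ← Finset.sum_add_distrib, ← Finset.sum_sub_distrib]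
      exact Finset.sum_congr rfl fun w _ => by ring
    rw [e, ← wdeg_mul_walk h0 x u, ← hz]
    nlinarith
  have h2 : ∑ u, ∑ w, A u w * ((x u + x w) / 2 - μ) ^ 2
      = 1 / 2 * (∑ u, ∑ w, A u w * (x u - μ) ^ 2 + ∑ u, ∑ w, A u w * (x w - μ) ^ 2)
        - 1 / 4 * ∑ u, ∑ w, A u w * (x u - x w) ^ 2 := by
    simp only [Finset.mul_sum, ← Finset.sum_add_distrib, ← Finset.sum_sub_distrib]
    exact Finset.sum_congr rfl fun u _ => Finset.sum_congr rfl fun w _ => by ring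
  refine le_trans (Finset.sum_le_sum fun u _ => h1 u) (le_of_eq ?_)
  rw [h2, sum_mul_left_wdeg A (fun u => (x u - μ) ^ 2),
    sum_mul_right_wdeg hs (fun u => (x u - μ) ^ 2)]
  ring

/-- The mean of `x` with respect to the stationary distribution. -/
noncomputable def wmean (A : V → V → ℝ) (x : V → ℝ) : ℝ :=
  (∑ u, wdeg A u * x u) / wvol A Finset.univ

/-- The unnormalised variance of `x` with respect to the stationary distribution. -/
noncomputable def wvar (A : V → V → ℝ) (x : V → ℝ) : ℝ := ∑ u, wdeg A u * (x u - wmean A x) ^ 2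

lemma wvar_le {A : V → V → ℝ} (hv : 0 < wvol A Finset.univ) (x : V → ℝ) (c : ℝ) :
    wvar A x ≤ ∑ u, wdeg A u * (x u - c) ^ 2 := by
  have hmean : ∑ u, wdeg A u * x u = wmean A x * wvol A Finset.univ := by
    rw [wmean, div_mul_cancel₀ _ hv.ne']
  have e : ∑ u, wdeg A u * (x u - c) ^ 2 = wvar A x
      + 2 * (wmean A x - c) * ∑ u, wdeg A u * x u
      - (wmean A x ^ 2 - c ^ 2) * wvol A Finset.univ := by
    rw [wvar, wvol, Finset.mul_sum, Finset.mul_sum, ← Finset.sum_add_distrib,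
      ← Finset.sum_sub_distrib]
    exact Finset.sum_congr rfl fun u _ => by ring
  rw [e, hmean]
  nlinarith [mul_nonneg hv.le (sq_nonneg (wmean A x - c))]

lemma walk_mono {A : V → V → ℝ} (h0 : ∀ u w, 0 ≤ A u w) {x y : V → ℝ} {u : V}
    (hu : x u ≤ y u) (h : ∀ w, 0 < A u w → x w ≤ y w) : walk A x u ≤ walk A y u := by
  unfold walk
  refine div_le_div_of_nonneg_right (Finset.sum_le_sum fun w _ => ?_)
    (mul_nonneg zero_le_two (wdeg_nonneg h0 u))
  rcases (h0 u w).eq_or_lt with hA | hA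
  · simp [← hA]
  · exact mul_le_mul_of_nonneg_left (add_le_add hu (h w hA)) hA.le

variable [DecidableEq V]

/-- One rounded step of the walk: if the sweep cuts of `x` expand by `ε`, then the variance decays by
a constant factor, up to the rounding error. -/
lemma wvar_step [Nonempty V] {A : V → V → ℝ} (hs : ∀ u w, A u w = A w u) (h0 : ∀ u w, 0 ≤ A u w)
    (hv : 0 < wvol A Finset.univ) {ε δ : ℝ} (hε : 0 < ε) (hε1 : ε ≤ 1) (hδ : δ = ε ^ 2 / 4)
    {x y : V → ℝ} (hx : SweepsExpand A ε x)
    (hy : ∀ u, 0 < wdeg A u → y u ≤ walk A x u ∧ walk A x u ≤ y u + 1) :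
    wvar A y ≤ (1 - δ / 2) * wvar A x + (1 + 2 / δ) * wvol A Finset.univ := by
  have hδ0 : 0 < δ := by rw [hδ]; positivity
  have hδ1 : δ ≤ 1 := by rw [hδ]; nlinarith
  obtain ⟨m, -, hm⟩ := hx.exists_median hs h0
  have hch := hm hε.le
  set μ := wmean A x with hμ
  have h1 := sum_walk_sub_sq_le hs h0 x μ
  have h2 := wvar_le hv x (x m)
  have h3 : ∑ u, wdeg A u * (walk A x u - μ) ^ 2 ≤ (1 - δ) * wvar A x := by
    have e : ∑ u, wdeg A u * (x u - μ) ^ 2 = wvar A x := rfl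
    have : ε ^ 2 * wvar A x ≤ ∑ u, ∑ w, A u w * (x u - x w) ^ 2 :=
      le_trans (mul_le_mul_of_nonneg_left h2 (sq_nonneg ε)) hch
    rw [e] at h1
    rw [hδ]
    linarith
  have h4 : ∑ u, wdeg A u * (y u - μ) ^ 2
      ≤ (1 + δ / 2) * ∑ u, wdeg A u * (walk A x u - μ) ^ 2 + (1 + 2 / δ) * wvol A Finset.univ := by
    rw [wvol, Finset.mul_sum, Finset.mul_sum, ← Finset.sum_add_distrib]
    refine Finset.sum_le_sum fun u _ => ?_
    rcases (wdeg_nonneg h0 u).eq_or_lt with hd | hd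
    · simp [← hd]
    obtain ⟨ha, hb⟩ := hy u hd
    set r := walk A x u - y u with hr
    have hr0 : 0 ≤ r := by linarith
    have hr1 : r ≤ 1 := by linarith
    have e : y u - μ = (walk A x u - μ) - r := by rw [hr]; ring
    set z := walk A x u - μ with hz
    -- `2 z r ≤ (δ / 2) z ^ 2 + (2 / δ) r ^ 2`
    have key : (z - r) ^ 2 ≤ (1 + δ / 2) * z ^ 2 + (1 + 2 / δ) := by
      have h5 : 0 ≤ (2 / δ) * (δ / 2 * z + r) ^ 2 := by positivity
      have h6 : (2 / δ) * (δ / 2 * z + r) ^ 2 = δ / 2 * z ^ 2 + 2 * z * r + 2 / δ * r ^ 2 := by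
        field_simp
        ring
      have h7 : 2 / δ * r ^ 2 ≤ 2 / δ * 1 :=
        mul_le_mul_of_nonneg_left (by nlinarith) (by positivity)
      nlinarith
    rw [e]
    nlinarith [mul_le_mul_of_nonneg_left key hd.le]
  have hvar0 : 0 ≤ wvar A x :=
    Finset.sum_nonneg fun u _ => mul_nonneg (wdeg_nonneg h0 u) (sq_nonneg _)
  have h5 : (1 + δ / 2) * ((1 - δ) * wvar A x) ≤ (1 - δ / 2) * wvar A x := by
    nlinarith [mul_nonneg (sq_nonneg δ) hvar0]
  have h6 := mul_le_mul_of_nonneg_left h3 (by positivity : 0 ≤ 1 + δ / 2)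
  linarith [wvar_le hv y μ]

/-- The mass that a set `S` loses in one step of the walk is carried by the edges of the cut. -/
lemma sum_sub_walk_le {A : V → V → ℝ} (hs : ∀ u w, A u w = A w u) (h0 : ∀ u w, 0 ≤ A u w)
    (S : Finset V) {q : V → ℝ} (hq0 : ∀ u, 0 ≤ q u) (hq1 : ∀ u, q u ≤ 1) :
    ∑ u ∈ S, wdeg A u * q u - ∑ u ∈ S, wdeg A u * walk A q u ≤ wcut A S / 2 := by
  have h1 : ∀ u, wdeg A u * q u - wdeg A u * walk A q u
      = 1 / 2 * ∑ w, A u w * (q u - q w) := by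
    intro u
    have := wdeg_mul_walk h0 q u
    have e : ∑ w, A u w * (q u - q w) = 2 * (wdeg A u * q u) - ∑ w, A u w * (q u + q w) := by
      rw [wdeg, Finset.sum_mul, Finset.mul_sum, ← Finset.sum_sub_distrib]
      exact Finset.sum_congr rfl fun w _ => by ring
    rw [e]; linarith
  have hanti : ∑ u ∈ S, ∑ w ∈ S, A u w * (q u - q w) = 0 := by
    have : ∑ u ∈ S, ∑ w ∈ S, A u w * (q u - q w) = - ∑ u ∈ S, ∑ w ∈ S, A u w * (q u - q w) := by
      conv_lhs => rw [Finset.sum_comm]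
      rw [← Finset.sum_neg_distrib]
      refine Finset.sum_congr rfl fun u _ => ?_
      rw [← Finset.sum_neg_distrib]
      exact Finset.sum_congr rfl fun w _ => by rw [hs]; ring
    linarith
  have h2 : ∑ u ∈ S, ∑ w, A u w * (q u - q w) ≤ wcut A S := by
    rw [wcut, ← sub_nonneg]
    have : ∑ u ∈ S, ∑ w, A u w * (q u - q w)
        = ∑ u ∈ S, ∑ w ∈ S, A u w * (q u - q w) + ∑ u ∈ S, ∑ w ∈ Sᶜ, A u w * (q u - q w) := by
      rw [← Finset.sum_add_distrib]
      exact Finset.sum_congr rfl fun u _ => (Finset.sum_add_sum_compl S _).symm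
    rw [this, hanti, zero_add, ← Finset.sum_sub_distrib]
    refine Finset.sum_nonneg fun u _ => ?_
    rw [← Finset.sum_sub_distrib]
    refine Finset.sum_nonneg fun w _ => ?_
    nlinarith [mul_nonneg (h0 u w) (by linarith [hq1 u, hq0 w] : 0 ≤ 1 - (q u - q w))]
  rw [← Finset.sum_sub_distrib, Finset.sum_congr rfl fun u _ => h1 u, ← Finset.mul_sum]
  linarith

/-- If the rounded lazy walks from all vertices find no sweep cut of expansion below `ε` during `t`
steps, then they mix, and so every cut has expansion at least `1 / (2 t)`. -/
theorem cut_ge_of_walks {A : V → V → ℝ} (hs : ∀ u w, A u w = A w u) (h0 : ∀ u w, 0 ≤ A u w)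
    (hdeg : ∀ u, 0 < wdeg A u → 1 ≤ wdeg A u) {N : ℝ} (hN : wvol A Finset.univ ≤ N)
    {ε δ M : ℝ} {t : ℕ} (hε : 0 < ε) (hε1 : ε ≤ 1) (hδ : δ = ε ^ 2 / 4) (hM : 0 < M)
    (hdecay : 32 * N ^ 3 * (1 - δ / 2) ^ t ≤ 1) (hround : 64 * N ^ 3 * (1 + 2 / δ) ≤ δ * M ^ 2)
    (hmass : 4 * N * t ≤ M)
    (y : V → ℕ → V → ℝ) (hy0 : ∀ s u, y s 0 u = if u = s then M else 0)
    (hynn : ∀ s j u, 0 ≤ y s j u)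
    (hy : ∀ s j u, 0 < wdeg A u → y s (j + 1) u ≤ walk A (y s j) u ∧
      walk A (y s j) u ≤ y s (j + 1) u + 1)
    (hsweep : ∀ s, 0 < wdeg A s → ∀ j < t, ∃ x, (∀ u, 0 < wdeg A u → x u = y s j u) ∧
      SweepsExpand A ε x)
    (S : Finset V) : min (wvol A S) (wvol A Sᶜ) ≤ 2 * t * wcut A S := by
  wlog hle : wvol A S ≤ wvol A Sᶜ generalizing S
  · have := this Sᶜ (by rw [compl_compl]; linarith)
    rwa [compl_compl, min_comm, wcut_compl hs] at this
  rw [min_eq_left hle]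
  have hcut0 := wcut_nonneg h0 S
  rcases (wvol_nonneg h0 S).eq_or_lt with hS0 | hS0
  · rw [← hS0]; positivity
  have htot : wvol A Finset.univ = wvol A S + wvol A Sᶜ := (Finset.sum_add_sum_compl S _).symm
  set vol := wvol A Finset.univ with hvol
  have hv : 0 < vol := by linarith
  have hNpos : 0 < N := by linarith
  have hδ0 : 0 < δ := by rw [hδ]; positivity
  have hδ1 : δ ≤ 1 := by rw [hδ]; nlinarith
  have wcongr : ∀ {x z : V → ℝ}, (∀ u, 0 < wdeg A u → x u = z u) →
      ∀ u, 0 < wdeg A u → walk A x u = walk A z u := by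
    intro x z hxz u hu
    have hpos : ∀ w, 0 < A u w → 0 < wdeg A w := fun w hw => by
      rw [hs] at hw
      exact lt_of_lt_of_le hw (Finset.single_le_sum (f := fun u => A w u) (fun u _ => h0 w u)
        (Finset.mem_univ u))
    refine le_antisymm (walk_mono h0 (hxz u hu).le fun w hw => (hxz w (hpos w hw)).le)
      (walk_mono h0 (hxz u hu).ge fun w hw => (hxz w (hpos w hw)).ge)
  have scongr : ∀ {x z : V → ℝ} (f : ℝ → ℝ), (∀ u, 0 < wdeg A u → x u = z u) →
      ∑ u, wdeg A u * f (x u) = ∑ u, wdeg A u * f (z u) := by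
    intro x z f hxz
    refine Finset.sum_congr rfl fun u _ => ?_
    rcases (wdeg_nonneg h0 u).eq_or_lt with hd | hd
    · simp [← hd]
    · rw [hxz u hd]
  -- the walks mix
  have hmix : ∀ s, 0 < wdeg A s → ∀ u, 0 < wdeg A u → M * wdeg A s / (2 * vol) ≤ y s t u := by
    intro s hds u hdu
    have : Nonempty V := ⟨s⟩
    have hds1 := hdeg s hds
    have hdsN : wdeg A s ≤ N := le_trans (Finset.single_le_sum (f := wdeg A)
      (fun u _ => wdeg_nonneg h0 u) (Finset.mem_univ s)) hN
    have e0 : ∀ f : ℝ → ℝ, f 0 = 0 → ∑ u, wdeg A u * f (y s 0 u) = wdeg A s * f M := by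
      intro f hf
      rw [Finset.sum_eq_single s]
      · simp [hy0]
      · intro b _ hb; simp [hy0, hb, hf]
      · simp
    have hmassj : ∀ j, wdeg A s * M - j * vol ≤ ∑ u, wdeg A u * y s j u := by
      intro j
      induction j with
      | zero => simpa using (e0 id rfl).ge
      | succ j ih =>
        have h1 : ∑ u, wdeg A u * walk A (y s j) u - vol ≤ ∑ u, wdeg A u * y s (j + 1) u := by
          rw [hvol, wvol, ← Finset.sum_sub_distrib]
          refine Finset.sum_le_sum fun u _ => ?_
          rcases (wdeg_nonneg h0 u).eq_or_lt with hd | hd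
          · simp [← hd]
          · nlinarith [(hy s j u hd).2]
        rw [sum_wdeg_walk hs h0] at h1
        push_cast
        linarith
    have hvarj : ∀ j ≤ t, wvar A (y s j)
        ≤ (1 - δ / 2) ^ j * (N * M ^ 2) + 2 / δ * (1 + 2 / δ) * N := by
      intro j
      induction j with
      | zero =>
        intro _
        have h1 := wvar_le hv (y s 0) 0
        have h2 := e0 (fun z => z ^ 2) (by simp)
        simp only [sub_zero] at h1
        rw [h2] at h1
        have h3 : wdeg A s * M ^ 2 ≤ N * M ^ 2 := by gcongr
        have h4 : 0 ≤ 2 / δ * (1 + 2 / δ) * N := by positivity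
        simp only [pow_zero, one_mul]
        linarith
      | succ j ih =>
        intro hj
        obtain ⟨x, hxy, hx⟩ := hsweep s hds j (by omega)
        have hstep := wvar_step hs h0 hv hε hε1 hδ hx (y := y s (j + 1)) (fun u hu => by
          rw [wcongr hxy u hu]; exact hy s j u hu)
        have hmean : wmean A x = wmean A (y s j) := by
          have h4 := scongr id hxy
          simp only [id] at h4
          unfold wmean; rw [h4]
        have hvareq : wvar A x = wvar A (y s j) := by
          unfold wvar; rw [hmean]; exact scongr (fun z => (z - wmean A (y s j)) ^ 2) hxy
        rw [hvareq] at hstep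
        have h1 := mul_le_mul_of_nonneg_left (ih (by omega)) (by linarith : 0 ≤ 1 - δ / 2)
        have h2 : (1 + 2 / δ) * vol ≤ (1 + 2 / δ) * N := by gcongr
        have h3 : (1 - δ / 2) * (2 / δ * (1 + 2 / δ) * N) + (1 + 2 / δ) * N
            = 2 / δ * (1 + 2 / δ) * N := by field_simp; ring
        rw [pow_succ]
        linarith
    have hvart : wvar A (y s t) ≤ (M / (4 * N)) ^ 2 := by
      refine le_trans (hvarj t le_rfl) ?_
      have h1 : (1 - δ / 2) ^ t * (N * M ^ 2) ≤ M ^ 2 / (32 * N ^ 2) := by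
        rw [le_div_iff₀ (by positivity)]
        calc (1 - δ / 2) ^ t * (N * M ^ 2) * (32 * N ^ 2)
            = (32 * N ^ 3 * (1 - δ / 2) ^ t) * M ^ 2 := by ring
          _ ≤ 1 * M ^ 2 := by gcongr
          _ = M ^ 2 := one_mul _
      have h2 : 2 / δ * (1 + 2 / δ) * N ≤ M ^ 2 / (32 * N ^ 2) := by
        rw [le_div_iff₀ (by positivity)]
        calc 2 / δ * (1 + 2 / δ) * N * (32 * N ^ 2)
            = (64 * N ^ 3 * (1 + 2 / δ)) / δ := by ring
          _ ≤ δ * M ^ 2 / δ := by gcongr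
          _ = M ^ 2 := by field_simp
      have h3 : (M / (4 * N)) ^ 2 = M ^ 2 / (32 * N ^ 2) + M ^ 2 / (32 * N ^ 2) := by
        field_simp; norm_num
      linarith
    have hdev : |y s t u - wmean A (y s t)| ≤ M / (4 * N) := by
      refine abs_le_of_sq_le_sq ?_ (by positivity)
      refine le_trans ?_ hvart
      refine le_trans ?_ (Finset.single_le_sum
        (f := fun u => wdeg A u * (y s t u - wmean A (y s t)) ^ 2)
        (fun u _ => mul_nonneg (wdeg_nonneg h0 u) (sq_nonneg _)) (Finset.mem_univ u))
      nlinarith [sq_nonneg (y s t u - wmean A (y s t)), hdeg u hdu]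
    have hmean : wdeg A s * M / vol - t ≤ wmean A (y s t) := by
      rw [wmean, ← hvol, le_div_iff₀ hv, sub_mul, div_mul_cancel₀ _ hv.ne']
      exact hmassj t
    have ht : (t : ℝ) ≤ M / (4 * N) := by rw [le_div_iff₀ (by positivity)]; linarith
    have hcmp : M / (2 * N) ≤ M * wdeg A s / (2 * vol) := by
      rw [div_le_div_iff₀ (by positivity) (by positivity)]
      have : 2 * vol ≤ 2 * N * wdeg A s := by nlinarith
      nlinarith
    have h1 := (abs_le.1 hdev).1
    have h2 : M / (4 * N) + M / (4 * N) = M / (2 * N) := by field_simp; norm_num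
    have h3 : wdeg A s * M / vol = M * wdeg A s / (2 * vol) + M * wdeg A s / (2 * vol) := by
      field_simp; norm_num
    linarith
  -- Rounding down only loses mass, so the exact walk from `S` dominates the sum of the rounded walks,
  -- and it leaks out of `S` only through the cut.
  set q : ℕ → V → ℝ := fun j => (walk A)^[j] (fun u => if u ∈ S then 1 else 0) with hq
  have hqsucc : ∀ j, q (j + 1) = walk A (q j) := fun j => by
    simp only [hq, Function.iterate_succ', Function.comp]
  have hqb : ∀ j u, 0 ≤ q j u ∧ q j u ≤ 1 := by
    intro j
    induction j with
    | zero => intro u; simp only [hq, Function.iterate_zero, id]; split_ifs <;> norm_num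
    | succ j ih =>
      intro u
      rw [hqsucc, walk]
      constructor
      · exact div_nonneg (Finset.sum_nonneg fun w _ => mul_nonneg (h0 u w)
          (add_nonneg (ih u).1 (ih w).1)) (mul_nonneg zero_le_two (wdeg_nonneg h0 u))
      · refine div_le_one_of_le₀ ?_ (mul_nonneg zero_le_two (wdeg_nonneg h0 u))
        rw [wdeg, Finset.mul_sum]
        refine Finset.sum_le_sum fun w _ => ?_
        nlinarith [h0 u w, (ih u).2, (ih w).2,
          mul_nonneg (h0 u w) (by linarith [(ih u).2, (ih w).2] : 0 ≤ 2 - (q j u + q j w))]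
  have hdom : ∀ j u, 0 < wdeg A u → ∑ s ∈ S, y s j u ≤ M * q j u := by
    intro j
    induction j with
    | zero => intro u _; simp [hq, hy0]
    | succ j ih =>
      intro u hu
      have hpos : ∀ w, 0 < A u w → 0 < wdeg A w := fun w hw => by
        rw [hs] at hw
        exact lt_of_lt_of_le hw (Finset.single_le_sum (f := fun u => A w u) (fun u _ => h0 w u)
          (Finset.mem_univ u))
      have e1 : ∑ s ∈ S, walk A (y s j) u = walk A (fun w => ∑ s ∈ S, y s j w) u := by
        simp only [walk]
        rw [← Finset.sum_div, Finset.sum_comm]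
        congr 1
        refine Finset.sum_congr rfl fun w _ => ?_
        rw [← Finset.mul_sum, Finset.sum_add_distrib]
      have e2 : walk A (fun w => M * q j w) u = M * q (j + 1) u := by
        rw [hqsucc]
        simp only [walk]
        rw [← mul_div_assoc, Finset.mul_sum]
        congr 1
        exact Finset.sum_congr rfl fun w _ => by ring
      rw [← e2]
      refine le_trans (Finset.sum_le_sum fun s _ => (hy s j u hu).1) ?_
      rw [e1]
      exact walk_mono h0 (ih u hu) fun w hw => ih w (hpos w hw)
  have hstay : ∀ j, wvol A S - j * (wcut A S / 2) ≤ ∑ u ∈ S, wdeg A u * q j u := by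
    intro j
    induction j with
    | zero =>
      simp only [CharP.cast_eq_zero, zero_mul, sub_zero, wvol]
      refine Finset.sum_le_sum fun u hu => ?_
      simp [hq, hu]
    | succ j ih =>
      have := sum_sub_walk_le hs h0 S (fun u => (hqb j u).1) (fun u => (hqb j u).2)
      rw [← hqsucc] at this
      push_cast
      linarith
  have htotal : ∀ j, ∑ u, wdeg A u * q j u = wvol A S := by
    intro j
    induction j with
    | zero => simp [hq, wvol]
    | succ j ih => rw [hqsucc, sum_wdeg_walk hs h0, ih]
  have hesc : ∑ u ∈ Sᶜ, wdeg A u * q t u ≤ t * (wcut A S / 2) := by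
    have h1 := Finset.sum_add_sum_compl S (fun u => wdeg A u * q t u)
    rw [htotal] at h1
    linarith [hstay t]
  have hlow : M * (wvol A S / 4) ≤ M * ∑ u ∈ Sᶜ, wdeg A u * q t u := by
    have h1 : ∀ u, wdeg A u * (M * wvol A S / (2 * vol)) ≤ wdeg A u * (M * q t u) := by
      intro u
      rcases (wdeg_nonneg h0 u).eq_or_lt with hd | hd
      · simp [← hd]
      refine mul_le_mul_of_nonneg_left (le_trans ?_ (hdom t u hd)) hd.le
      rw [wvol, Finset.mul_sum, Finset.sum_div]
      refine Finset.sum_le_sum fun s _ => ?_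
      rcases (wdeg_nonneg h0 s).eq_or_lt with hd' | hd'
      · rw [← hd']; simpa using hynn s t u
      · exact hmix s hd' u hd
    have h2 : ∑ u ∈ Sᶜ, wdeg A u * (M * wvol A S / (2 * vol))
        ≤ ∑ u ∈ Sᶜ, wdeg A u * (M * q t u) := Finset.sum_le_sum fun u _ => h1 u
    rw [← Finset.sum_mul] at h2
    have h3 : M * (wvol A S / 4) ≤ wvol A Sᶜ * (M * wvol A S / (2 * vol)) := by
      rw [mul_div_assoc', mul_div_assoc', div_le_div_iff₀ (by norm_num) (by positivity)]
      have : 0 < M * wvol A S := by positivity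
      nlinarith
    have h4 : ∑ u ∈ Sᶜ, wdeg A u * (M * q t u) = M * ∑ u ∈ Sᶜ, wdeg A u * q t u := by
      rw [Finset.mul_sum]; exact Finset.sum_congr rfl fun u _ => by ring
    rw [h4] at h2
    exact h3.trans h2
  have := le_of_mul_le_mul_left hlow hM
  linarith

end Walk


/-! ### A loop language with automatic polynomial time bounds -/

/-- The state of a loop program: variables and infinite arrays, all of natural numbers. -/
structure LState where
  v : ℕ → ℕ
  a : ℕ → ℕ → ℕ

/-- The state `s` with the value `k` of the variable `x`. -/
def LState.setv (s : LState) (x k : ℕ) : LState := { s with v := Function.update s.v x k }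

/-- The state `s` with the value `k` in the cell `i` of the array `r`. -/
def LState.seta (s : LState) (r i k : ℕ) : LState :=
  { s with a := Function.update s.a r (Function.update (s.a r) i k) }

/-- Expressions. The only products are those with the number `n` of vertices, so that evaluating
an expression lengthens the numbers by an additive amount. -/
inductive Expr : Type
  | lit (k : ℕ)
  | var (x : ℕ)
  | add (e f : Expr)
  | sub (e f : Expr)
  | div (e f : Expr)
  /-- `e * n`. -/
  | muln (e : Expr)
  /-- The cell `e` of the array `r`. -/
  | get (r : ℕ) (e : Expr)
  /-- The cell `e` of the adjacency matrix. -/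
  | inp (e : Expr)
  /-- `if c ≠ 0 then e else f`. -/
  | ite (c e f : Expr)
  /-- The sum of `e` over the values `0, …, n - 1` of the variable `i`. -/
  | sum (i : ℕ) (e : Expr)

/-- Commands. The number of rounds of a loop is one of three fixed polynomials in `n`. -/
inductive Cmd : Type
  | assign (x : ℕ) (e : Expr)
  | store (r : ℕ) (e f : Expr)
  | seq (c d : Cmd)
  | ite (e : Expr) (c d : Cmd)
  /-- `for x < loopBound b do c`. -/
  | loop (b x : ℕ) (c : Cmd)

/-- A number of rounds that suffices for every iteration of the algorithm. It exceeds the number of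
levels, of passes, and of steps of the walks. -/
def bigBound (n : ℕ) : ℕ := 4194304 * n * n * n

/-- The numbers of rounds of the three kinds of loops. -/
def loopBound (n : ℕ) : ℕ → ℕ
  | 0 => n
  | 1 => n * n
  | _ => bigBound n

/-- The value of an expression. -/
def Expr.eval (n : ℕ) (inp : ℕ → ℕ) : Expr → LState → ℕ
  | lit k, _ => k
  | var x, s => s.v x
  | add e f, s => e.eval n inp s + f.eval n inp s
  | sub e f, s => e.eval n inp s - f.eval n inp s
  | div e f, s => e.eval n inp s / f.eval n inp s
  | muln e, s => e.eval n inp s * n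
  | get r e, s => s.a r (e.eval n inp s)
  | .inp e, s => if e.eval n inp s < n * n then inp (e.eval n inp s) else 0
  | ite c e f, s => if c.eval n inp s ≠ 0 then e.eval n inp s else f.eval n inp s
  | sum i e, s => ∑ j ∈ Finset.range n, e.eval n inp (s.setv i j)

/-- The effect of a command. -/
def Cmd.run (n : ℕ) (inp : ℕ → ℕ) : Cmd → LState → LState
  | assign x e, s => s.setv x (e.eval n inp s)
  | store r e f, s => s.seta r (e.eval n inp s) (f.eval n inp s)
  | seq c d, s => d.run n inp (c.run n inp s)
  | ite e c d, s => if e.eval n inp s ≠ 0 then c.run n inp s else d.run n inp s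
  | loop b x c, s => Nat.rec s (fun j s' => c.run n inp (s'.setv x j)) (loopBound n b)

/-- Variables are below `40` and arrays below `8`. -/
def Expr.WF : Expr → Prop
  | lit _ => True
  | var x => x < 40
  | add e f => e.WF ∧ f.WF
  | sub e f => e.WF ∧ f.WF
  | div e f => e.WF ∧ f.WF
  | muln e => e.WF
  | get r e => r < 8 ∧ e.WF
  | inp e => e.WF
  | ite c e f => c.WF ∧ e.WF ∧ f.WF
  | sum i e => i < 40 ∧ e.WF

/-- Variables are below `40` and arrays below `8`. -/
def Cmd.WF : Cmd → Prop
  | assign x e => x < 40 ∧ e.WF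
  | store r e f => r < 8 ∧ e.WF ∧ f.WF
  | seq c d => c.WF ∧ d.WF
  | ite e c d => e.WF ∧ c.WF ∧ d.WF
  | loop _ x c => x < 40 ∧ c.WF

/-! ### Compilation -/

/-- The register of a loop bound. -/
def boundReg : ℕ → ℕ
  | 0 => 40
  | 1 => 41
  | _ => 42

/-- Turns the index `i` in register `t` into the address `n ^ 2 + 8 i + r`, where the cell `i` of the
array `r` lives. The adjacency matrix occupies the first `n ^ 2` cells. -/
def addrProg (r t : ℕ) : Prog :=
  .seq (.add t t t) <| .seq (.add t t t) <| .seq (.add t t t) <| .seq (.add t t 41) <|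
    .seq (.const (t + 1) r) (.add t t (t + 1))

/-- Evaluates an expression into register `t`, with the registers above `t` for scratch. -/
def Expr.compile : Expr → ℕ → Prog
  | lit k, t => .const t k
  | var x, t => .seq (.const t 0) (.add t x t)
  | add e f, t => .seq (e.compile t) <| .seq (f.compile (t + 1)) (.add t t (t + 1))
  | sub e f, t => .seq (e.compile t) <| .seq (f.compile (t + 1)) (.sub t t (t + 1))
  | div e f, t => .seq (e.compile t) <| .seq (f.compile (t + 1)) (.div t t (t + 1))
  | muln e, t => .seq (e.compile t) (.mul t t 40)
  | get r e, t => .seq (e.compile t) <| .seq (addrProg r t) (.load t t)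
  | inp e, t => .seq (e.compile t) <| .seq (.sub (t + 1) 41 t) <|
      .ite (t + 1) (.load t t) (.const t 0)
  | ite c e f, t => .seq (c.compile t) (.ite t (e.compile t) (f.compile t))
  | sum i e, t => .seq (.const t 0) <| .seq (.add (t + 1) i t) <| .seq (.add (t + 2) 40 t) <|
      .seq (.loop (t + 2) (.seq (.sub i 40 (t + 2)) <| .seq (e.compile (t + 3)) <|
        .seq (.add t t (t + 3)) <| .seq (.const (t + 3) 1) (.sub (t + 2) (t + 2) (t + 3)))) <|
      .seq (.const (t + 2) 0) (.add i (t + 1) (t + 2))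

/-- Executes a command, with the registers from `t` on for scratch. -/
def Cmd.compile : Cmd → ℕ → Prog
  | assign x e, t => .seq (e.compile t) <| .seq (.const (t + 1) 0) (.add x t (t + 1))
  | store r e f, t => .seq (e.compile t) <| .seq (addrProg r t) <|
      .seq (f.compile (t + 1)) (.store t (t + 1))
  | seq c d, t => .seq (c.compile t) (d.compile t)
  | ite e c d, t => .seq (e.compile t) (.ite t (c.compile t) (d.compile t))
  | loop b x c, t => .seq (.const t 0) <| .seq (.add t (boundReg b) t) <|
      .loop t (.seq (.sub x (boundReg b) t) <| .seq (c.compile (t + 1)) <|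
        .seq (.const (t + 1) 1) (.sub t t (t + 1)))

/-- A bound for the number of steps of `e.compile t`, in which products and constants are weighted
by the lengths of their operands. It also bounds the growth of the lengths of all numbers. -/
def Expr.steps (n : ℕ) : Expr → ℕ
  | lit k => k + 1
  | var _ => 2
  | add e f => e.steps n + f.steps n + 1
  | sub e f => e.steps n + f.steps n + 1
  | div e f => e.steps n + f.steps n + 1
  | muln e => e.steps n + (n + 1)
  | get r e => e.steps n + (r + 7)
  | inp e => e.steps n + 3
  | ite c e f => c.steps n + (e.steps n + f.steps n + 1)
  | sum _ e => n * (e.steps n + 6) + 6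

/-- A bound for the number of steps of `c.compile t`, weighted as in `Expr.steps`. -/
def Cmd.steps (n : ℕ) : Cmd → ℕ
  | assign _ e => e.steps n + 2
  | store r e f => e.steps n + f.steps n + (r + 7)
  | seq c d => c.steps n + d.steps n
  | ite e c d => e.steps n + (c.steps n + d.steps n + 1)
  | loop b _ c => loopBound n b * (c.steps n + 5) + 3

/-- All numbers in the configuration have at most `B` bits. -/
def Bits (B : ℕ) (s : RamState) : Prop := (∀ x, s.reg x < 2 ^ B) ∧ ∀ a, s.mem a < 2 ^ B

/-- `p` leads from `s`, with numbers of `B` bits, to `s'` in about `T` steps. Each step lengthens the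
numbers by at most one bit, so that `T` bounds both the number of instructions and the growth of the
lengths, and the logarithmic cost is quadratic in `B + T`. -/
def Runs (p : Prog) (s s' : RamState) (T B : ℕ) : Prop :=
  (∃ c ≤ T * (4 * (B + T) + 4), Exec p s c s') ∧ Bits (B + T) s'

lemma Bits.mono {B B' : ℕ} {s : RamState} (h : Bits B s) (hB : B ≤ B') : Bits B' s :=
  ⟨fun x => (h.1 x).trans_le (Nat.pow_le_pow_right (by norm_num) hB),
    fun x => (h.2 x).trans_le (Nat.pow_le_pow_right (by norm_num) hB)⟩

lemma Bits.set {B : ℕ} {s : RamState} (h : Bits B s) {x k : ℕ} (hk : k < 2 ^ B) :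
    Bits B (s.set x k) := by
  refine ⟨fun y => ?_, h.2⟩
  simp only [RamState.set, Function.update_apply]
  split_ifs
  · exact hk
  · exact h.1 y

lemma Bits.put {B : ℕ} {s : RamState} (h : Bits B s) {x k : ℕ} (hk : k < 2 ^ B) :
    Bits B (s.put x k) := by
  refine ⟨h.1, fun y => ?_⟩
  simp only [RamState.put, Function.update_apply]
  split_ifs
  · exact hk
  · exact h.2 y

lemma Bits.size_reg {B : ℕ} {s : RamState} (h : Bits B s) (x : ℕ) : (s.reg x).size ≤ B :=
  Nat.size_le.2 (h.1 x)

lemma Bits.size_mem {B : ℕ} {s : RamState} (h : Bits B s) (x : ℕ) : (s.mem x).size ≤ B :=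
  Nat.size_le.2 (h.2 x)

@[simp] lemma RamState.set_reg (s : RamState) (x k y : ℕ) :
    (s.set x k).reg y = if y = x then k else s.reg y := by
  simp [RamState.set, Function.update_apply]

@[simp] lemma RamState.set_mem (s : RamState) (x k : ℕ) : (s.set x k).mem = s.mem := rfl

lemma Runs.mono {p : Prog} {s s' : RamState} {T T' B : ℕ} (h : Runs p s s' T B) (hT : T ≤ T') :
    Runs p s s' T' B := by
  obtain ⟨⟨c, hc, he⟩, hb⟩ := h
  refine ⟨⟨c, hc.trans ?_, he⟩, hb.mono (by omega)⟩
  gcongr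

lemma Runs.seq {p q : Prog} {s s' s'' : RamState} {T T' B : ℕ} (h : Runs p s s' T B)
    (h' : Runs q s' s'' T' (B + T)) : Runs (.seq p q) s s'' (T + T') B := by
  obtain ⟨⟨c, hc, he⟩, hb⟩ := h
  obtain ⟨⟨c', hc', he'⟩, hb'⟩ := h'
  refine ⟨⟨c + c', ?_, Exec.seq _ _ _ _ _ _ _ he he'⟩, hb'.mono (by omega)⟩
  calc c + c' ≤ T * (4 * (B + T) + 4) + T' * (4 * (B + T + T') + 4) := add_le_add hc hc'
    _ ≤ T * (4 * (B + (T + T')) + 4) + T' * (4 * (B + (T + T')) + 4) :=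
        add_le_add (Nat.mul_le_mul_left _ (by omega)) (Nat.mul_le_mul_left _ (by omega))
    _ = (T + T') * (4 * (B + (T + T')) + 4) := by ring

lemma lt_two_pow_add {a B : ℕ} (k : ℕ) (h : a < 2 ^ B) : a < 2 ^ (B + k) :=
  h.trans_le (Nat.pow_le_pow_right (by norm_num) (by omega))

lemma runs_const {B : ℕ} {s : RamState} (h : Bits B s) (x k : ℕ) :
    Runs (.const x k) s (s.set x k) (k + 1) B := by
  have hk : k < 2 ^ (B + (k + 1)) :=
    Nat.lt_two_pow_self.trans_le (Nat.pow_le_pow_right (by norm_num) (by omega))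
  refine ⟨⟨_, ?_, Exec.const s x k⟩, (h.mono (by omega)).set hk⟩
  have : k.size ≤ k := Nat.size_le.2 Nat.lt_two_pow_self
  nlinarith

lemma runs_add {B : ℕ} {s : RamState} (h : Bits B s) (x y z : ℕ) :
    Runs (.add x y z) s (s.set x (s.reg y + s.reg z)) 1 B := by
  have h1 := h.size_reg y
  have h2 := h.size_reg z
  refine ⟨⟨_, by omega, Exec.add s x y z⟩, (h.mono (by omega)).set ?_⟩
  rw [pow_succ]
  have := h.1 y; have := h.1 z
  omega

lemma runs_sub {B : ℕ} {s : RamState} (h : Bits B s) (x y z : ℕ) :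
    Runs (.sub x y z) s (s.set x (s.reg y - s.reg z)) 1 B := by
  have h1 := h.size_reg y
  have h2 := h.size_reg z
  exact ⟨⟨_, by omega, Exec.sub s x y z⟩, (h.mono (by omega)).set
    (lt_two_pow_add 1 ((Nat.sub_le _ _).trans_lt (h.1 y)))⟩

lemma runs_div {B : ℕ} {s : RamState} (h : Bits B s) (x y z : ℕ) :
    Runs (.div x y z) s (s.set x (s.reg y / s.reg z)) 1 B := by
  have h1 := h.size_reg y
  have h2 := h.size_reg z
  exact ⟨⟨_, by omega, Exec.div s x y z⟩, (h.mono (by omega)).set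
    (lt_two_pow_add 1 ((Nat.div_le_self _ _).trans_lt (h.1 y)))⟩

lemma runs_mul {B n : ℕ} {s : RamState} (h : Bits B s) (x y z : ℕ) (hz : s.reg z < 2 ^ n) :
    Runs (.mul x y z) s (s.set x (s.reg y * s.reg z)) (n + 1) B := by
  have h1 := h.size_reg y
  have h2 := h.size_reg z
  refine ⟨⟨_, ?_, Exec.mul s x y z⟩, (h.mono (by omega)).set (lt_two_pow_add (B := B + n) 1 ?_)⟩
  · nlinarith
  · rw [pow_add]
    exact Nat.mul_lt_mul'' (h.1 y) hz

lemma runs_load {B : ℕ} {s : RamState} (h : Bits B s) (x y : ℕ) :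
    Runs (.load x y) s (s.set x (s.mem (s.reg y))) 1 B := by
  have h1 := h.size_reg y
  have h2 := h.size_mem (s.reg y)
  exact ⟨⟨_, by omega, Exec.load s x y⟩, (h.mono (by omega)).set (lt_two_pow_add 1 (h.2 _))⟩

lemma runs_store {B : ℕ} {s : RamState} (h : Bits B s) (x y : ℕ) :
    Runs (.store x y) s (s.put (s.reg x) (s.reg y)) 1 B := by
  have h1 := h.size_reg x
  have h2 := h.size_reg y
  exact ⟨⟨_, by omega, Exec.store s x y⟩, (h.mono (by omega)).put (lt_two_pow_add 1 (h.1 _))⟩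

lemma runs_ite {B T : ℕ} {s s' : RamState} (h : Bits B s) {x : ℕ} {p q : Prog}
    (hp : s.reg x ≠ 0 → Runs p s s' T B) (hq : s.reg x = 0 → Runs q s s' T B) :
    Runs (.ite x p q) s s' (T + 1) B := by
  have h1 := h.size_reg x
  by_cases hx : s.reg x = 0
  · obtain ⟨⟨c, hc, he⟩, hb⟩ := hq hx
    exact ⟨⟨_, by nlinarith, Exec.ite_false x p q s s' c hx he⟩, hb.mono (by omega)⟩
  · obtain ⟨⟨c, hc, he⟩, hb⟩ := hp hx
    exact ⟨⟨_, by nlinarith, Exec.ite_true x p q s s' c hx he⟩, hb.mono (by omega)⟩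

/-- A loop whose counter `x` runs down from `k`, with the invariant `I j` after `j` rounds. -/
lemma runs_loop {x k T : ℕ} {p : Prog} (I : ℕ → RamState → Prop)
    (hstep : ∀ j < k, ∀ s B, I j s → s.reg x = k - j → Bits B s →
      ∃ s', Runs p s s' T B ∧ I (j + 1) s' ∧ s'.reg x = k - (j + 1)) :
    ∀ i j, i + j = k → ∀ s B, I j s → s.reg x = i → Bits B s →
      ∃ s', Runs (.loop x p) s s' (i * (T + 1) + 1) B ∧ I k s' := by
  intro i
  induction i with
  | zero =>
    intro j hj s B hI hx hb
    obtain rfl : j = k := by omega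
    exact ⟨s, ⟨⟨1, by nlinarith, Exec.loop_done x p s hx⟩, hb.mono (by omega)⟩, hI⟩
  | succ i ih =>
    intro j hj s B hI hx hb
    obtain ⟨s', ⟨⟨c, hc, he⟩, hb'⟩, hI', hx'⟩ := hstep j (by omega) s B hI (by omega) hb
    obtain ⟨s'', ⟨⟨c', hc', he'⟩, hb''⟩, hI''⟩ :=
      ih (j + 1) (by omega) s' (B + T) hI' (by omega) hb'
    have h1 := hb.size_reg x
    refine ⟨s'', ⟨⟨_, ?_, Exec.loop_step x p s s' s'' c c' (by omega) he he'⟩,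
      hb''.mono (by rw [Nat.add_mul]; omega)⟩, hI''⟩
    set W := 4 * (B + ((i + 1) * (T + 1) + 1)) + 4 with hW
    have e1 : T * (4 * (B + T) + 4) ≤ T * W := by
      refine Nat.mul_le_mul_left _ ?_
      rw [hW, Nat.add_mul]; omega
    have e2 : (i * (T + 1) + 1) * (4 * (B + T + (i * (T + 1) + 1)) + 4) ≤ (i * (T + 1) + 1) * W := by
      refine Nat.mul_le_mul_left _ ?_
      rw [hW, Nat.add_mul]; omega
    have e3 : 1 + (s.reg x).size ≤ W := by omega
    calc 1 + (s.reg x).size + c + c' ≤ 1 * W + T * W + (i * (T + 1) + 1) * W := by omega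
      _ = ((i + 1) * (T + 1) + 1) * W := by ring

/-- The configuration `r` of the machine represents the state `s` of a loop program: the variables are
in the registers below `40`, the loop bounds in the registers `40`, `41`, `42`, and the arrays are
interleaved in the memory behind the adjacency matrix. -/
structure Represents (n : ℕ) (inp : ℕ → ℕ) (s : LState) (r : RamState) : Prop where
  var : ∀ x < 40, r.reg x = s.v x
  bound : ∀ b, r.reg (boundReg b) = loopBound n b
  arr : ∀ j < 8, ∀ i, r.mem (n * n + (8 * i + j)) = s.a j i
  inp : ∀ i < n * n, r.mem i = inp i

lemma Represents.congr {n : ℕ} {inp : ℕ → ℕ} {s : LState} {r r' : RamState}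
    (h : Represents n inp s r) (hm : r'.mem = r.mem) (hr : ∀ x < 50, r'.reg x = r.reg x) :
    Represents n inp s r' where
  var x hx := by rw [hr x (by omega), h.var x hx]
  bound b := by
    rw [← h.bound b]
    apply hr
    unfold boundReg; split <;> omega
  arr := by rw [hm]; exact h.arr
  inp := by rw [hm]; exact h.inp

lemma Represents.reg40 {n : ℕ} {inp : ℕ → ℕ} {s : LState} {r : RamState}
    (h : Represents n inp s r) : r.reg 40 = n := h.bound 0

lemma Represents.reg41 {n : ℕ} {inp : ℕ → ℕ} {s : LState} {r : RamState}
    (h : Represents n inp s r) : r.reg 41 = n * n := h.bound 1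

lemma Represents.setv {n : ℕ} {inp : ℕ → ℕ} {s : LState} {r r' : RamState}
    (h : Represents n inp s r) {x k : ℕ} (hx : x < 40) (hm : r'.mem = r.mem) (hk : r'.reg x = k)
    (hr : ∀ y < 50, y ≠ x → r'.reg y = r.reg y) : Represents n inp (s.setv x k) r' where
  var y hy := by
    simp only [LState.setv, Function.update_apply]
    split_ifs with h'
    · rw [h', hk]
    · rw [hr y (by omega) h', h.var y hy]
  bound b := by
    rw [← h.bound b]
    apply hr <;> unfold boundReg <;> split <;> omega
  arr := by rw [hm]; exact h.arr
  inp := by rw [hm]; exact h.inp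

lemma runs_addr {B n : ℕ} {s : RamState} (hs : Bits B s) {t : ℕ} (ht : 50 ≤ t) (r : ℕ)
    (h41 : s.reg 41 = n * n) :
    ∃ s', Runs (addrProg r t) s s' (r + 6) B ∧ s'.mem = s.mem ∧
      (∀ x < t, s'.reg x = s.reg x) ∧ s'.reg t = n * n + (8 * s.reg t + r) := by
  have r1 := runs_add hs t t t
  have r2 := runs_add r1.2 t t t
  have r3 := runs_add r2.2 t t t
  have r4 := runs_add r3.2 t t 41
  have r5 := runs_const r4.2 (t + 1) r
  have r6 := runs_add r5.2 t t (t + 1)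
  refine ⟨_, (r1.seq (r2.seq (r3.seq (r4.seq (r5.seq r6))))).mono (by omega), rfl, ?_, ?_⟩
  · intro x hx
    have h1 : x ≠ t := by omega
    have h2 : x ≠ t + 1 := by omega
    simp [h1, h2]
  · have h1 : 41 ≠ t := by omega
    simp [h1, h41]
    ring

/-- Compiled expressions evaluate correctly within their step bounds. -/
lemma Expr.compile_correct {n : ℕ} {inp : ℕ → ℕ} (e : Expr) :
    e.WF → ∀ t, 50 ≤ t → ∀ s r B, Represents n inp s r → Bits B r →
    ∃ r', Runs (e.compile t) r r' (e.steps n) B ∧ r'.mem = r.mem ∧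
      (∀ x < t, r'.reg x = r.reg x) ∧ r'.reg t = e.eval n inp s := by
  induction e with
  | lit k =>
    intro _ t ht s r B hr hb
    refine ⟨_, runs_const hb t k, rfl, fun x hx => ?_, by simp [eval]⟩
    simp [(show x ≠ t by omega)]
  | var x =>
    intro hx t ht s r B hr hb
    have r1 := runs_const hb t 0
    have r2 := runs_add r1.2 t x t
    simp only [WF] at hx
    refine ⟨_, r1.seq r2, rfl, fun y hy => ?_, ?_⟩
    · simp [(show y ≠ t by omega)]
    · simp [(show x ≠ t by omega), eval, hr.var x hx]
  | add e f ihe ihf =>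
    intro hwf t ht s r B hr hb
    obtain ⟨r1, h1, m1, k1, v1⟩ := ihe hwf.1 t ht s r B hr hb
    obtain ⟨r2, h2, m2, k2, v2⟩ := ihf hwf.2 (t + 1) (by omega) s r1 _
      (hr.congr m1 fun x hx => k1 x (by omega)) h1.2
    have h3 := runs_add h2.2 t t (t + 1)
    refine ⟨_, (h1.seq (h2.seq h3)).mono (by simp only [steps]; omega), by simp [m1, m2],
      fun x hx => ?_, ?_⟩
    · simp [(show x ≠ t by omega), k2 x (by omega), k1 x hx]
    · simp [k2 t (by omega), v1, v2, eval]
  | sub e f ihe ihf =>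
    intro hwf t ht s r B hr hb
    obtain ⟨r1, h1, m1, k1, v1⟩ := ihe hwf.1 t ht s r B hr hb
    obtain ⟨r2, h2, m2, k2, v2⟩ := ihf hwf.2 (t + 1) (by omega) s r1 _
      (hr.congr m1 fun x hx => k1 x (by omega)) h1.2
    have h3 := runs_sub h2.2 t t (t + 1)
    refine ⟨_, (h1.seq (h2.seq h3)).mono (by simp only [steps]; omega), by simp [m1, m2],
      fun x hx => ?_, ?_⟩
    · simp [(show x ≠ t by omega), k2 x (by omega), k1 x hx]
    · simp [k2 t (by omega), v1, v2, eval]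
  | div e f ihe ihf =>
    intro hwf t ht s r B hr hb
    obtain ⟨r1, h1, m1, k1, v1⟩ := ihe hwf.1 t ht s r B hr hb
    obtain ⟨r2, h2, m2, k2, v2⟩ := ihf hwf.2 (t + 1) (by omega) s r1 _
      (hr.congr m1 fun x hx => k1 x (by omega)) h1.2
    have h3 := runs_div h2.2 t t (t + 1)
    refine ⟨_, (h1.seq (h2.seq h3)).mono (by simp only [steps]; omega), by simp [m1, m2],
      fun x hx => ?_, ?_⟩
    · simp [(show x ≠ t by omega), k2 x (by omega), k1 x hx]
    · simp [k2 t (by omega), v1, v2, eval]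
  | muln e ihe =>
    intro hwf t ht s r B hr hb
    obtain ⟨r1, h1, m1, k1, v1⟩ := ihe hwf t ht s r B hr hb
    have h40 : r1.reg 40 = n := by rw [k1 40 (by omega), hr.reg40]
    have h2 := runs_mul h1.2 t t 40 (n := n) (by rw [h40]; exact Nat.lt_two_pow_self)
    refine ⟨_, h1.seq h2, m1, fun x hx => ?_, ?_⟩
    · simp [(show x ≠ t by omega), k1 x hx]
    · simp [v1, h40, eval]
  | get j e ihe =>
    intro hwf t ht s r B hr hb
    obtain ⟨r1, h1, m1, k1, v1⟩ := ihe hwf.2 t ht s r B hr hb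
    obtain ⟨r2, h2, m2, k2, v2⟩ := runs_addr h1.2 ht j
      (show r1.reg 41 = n * n by rw [k1 41 (by omega), hr.reg41])
    have h3 := runs_load h2.2 t t
    refine ⟨_, (h1.seq (h2.seq h3)).mono (by simp only [steps]; omega), by simp [m1, m2],
      fun x hx => ?_, ?_⟩
    · simp [(show x ≠ t by omega), k2 x hx, k1 x hx]
    · simp only [RamState.set_reg, if_true, eval, v2, v1, m2, m1]
      exact hr.arr j hwf.1 _
  | inp e ihe =>
    intro hwf t ht s r B hr hb
    obtain ⟨r1, h1, m1, k1, v1⟩ := ihe hwf t ht s r B hr hb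
    have h41 : r1.reg 41 = n * n := by rw [k1 41 (by omega), hr.reg41]
    have h2 := runs_sub h1.2 (t + 1) 41 t
    set r2 := r1.set (t + 1) (r1.reg 41 - r1.reg t) with hr2
    have ht2 : r2.reg t = e.eval n inp s := by simp [hr2, v1]
    have hc : r2.reg (t + 1) = n * n - e.eval n inp s := by simp [hr2, v1, h41]
    have h3 := runs_ite h2.2 (x := t + 1) (p := .load t t) (q := .const t 0) (T := 1)
      (s' := r2.set t (if e.eval n inp s < n * n then inp (e.eval n inp s) else 0))
      (fun hne => by
        have hlt : e.eval n inp s < n * n := by omega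
        have := runs_load h2.2 t t
        rw [ht2, hr2, RamState.set_mem, m1, hr.inp _ hlt] at this
        rw [if_pos hlt]
        exact this)
      (fun heq => by
        have hlt : ¬ e.eval n inp s < n * n := by omega
        rw [if_neg hlt]
        exact runs_const h2.2 t 0)
    refine ⟨_, (h1.seq (h2.seq h3)).mono (by simp only [steps]; omega), by simp [hr2, m1],
      fun x hx => ?_, ?_⟩
    · simp [(show x ≠ t by omega), (show x ≠ t + 1 by omega), hr2, k1 x hx]
    · simp [eval]
  | ite c e f ihc ihe ihf =>
    intro hwf t ht s r B hr hb
    obtain ⟨r1, h1, m1, k1, v1⟩ := ihc hwf.1 t ht s r B hr hb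
    have hr1 := hr.congr m1 fun x hx => k1 x (by omega)
    by_cases h0 : c.eval n inp s = 0
    · obtain ⟨r2, h2, m2, k2, v2⟩ := ihf hwf.2.2 t ht s r1 _ hr1 h1.2
      have h3 := runs_ite h1.2 (x := t) (p := e.compile t) (q := f.compile t) (s' := r2)
        (T := e.steps n + f.steps n) (fun hne => absurd (v1.trans h0) hne)
        (fun _ => h2.mono (by omega))
      refine ⟨_, h1.seq h3, by rw [m2, m1], fun x hx => by rw [k2 x hx, k1 x hx], ?_⟩
      simp [eval, h0, v2]
    · obtain ⟨r2, h2, m2, k2, v2⟩ := ihe hwf.2.1 t ht s r1 _ hr1 h1.2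
      have h3 := runs_ite h1.2 (x := t) (p := e.compile t) (q := f.compile t) (s' := r2)
        (T := e.steps n + f.steps n) (fun _ => h2.mono (by omega))
        (fun heq => absurd (v1.symm.trans heq) h0)
      refine ⟨_, h1.seq h3, by rw [m2, m1], fun x hx => by rw [k2 x hx, k1 x hx], ?_⟩
      simp [eval, h0, v2]
  | sum i e ihe =>
    intro hwf t ht s r B hr hb
    obtain ⟨hi, hwf⟩ := hwf
    have r1 := runs_const hb t 0
    have r2 := runs_add r1.2 (t + 1) i t
    have r3 := runs_add r2.2 (t + 2) 40 t
    have r4 := runs_loop (k := n) (x := t + 2) (T := e.steps n + 5)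
      (p := (.seq (.sub i 40 (t + 2)) <| .seq (e.compile (t + 3)) <|
        .seq (.add t t (t + 3)) <| .seq (.const (t + 3) 1) (.sub (t + 2) (t + 2) (t + 3))))
      (fun j r' => r'.mem = r.mem ∧ (∀ x < t, x ≠ i → r'.reg x = r.reg x) ∧
        r'.reg (t + 1) = r.reg i ∧
        r'.reg t = ∑ j' ∈ Finset.range j, e.eval n inp (s.setv i j'))
      (by
        rintro j hj r' B' ⟨hm, hk, hsave, hacc⟩ hctr hb'
        have q1 := runs_sub hb' i 40 (t + 2)
        have hj' : r'.reg 40 - r'.reg (t + 2) = j := by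
          rw [hk 40 (by omega) (by omega), hr.reg40, hctr]; omega
        rw [hj'] at q1
        have hrep : Represents n inp (s.setv i j) (r'.set i j) :=
          hr.setv hi hm (by simp) fun y hy hyi => by simp [hyi, hk y (by omega) hyi]
        obtain ⟨r'', q2, m2, k2, v2⟩ := ihe hwf (t + 3) (by omega) _ _ _ hrep q1.2
        have q3 := runs_add q2.2 t t (t + 3)
        have q4 := runs_const q3.2 (t + 3) 1
        have q5 := runs_sub q4.2 (t + 2) (t + 2) (t + 3)
        refine ⟨_, (q1.seq (q2.seq (q3.seq (q4.seq q5)))).mono (by omega),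
          ⟨by simp [m2, hm], fun x hx hxi => ?_, ?_, ?_⟩, ?_⟩
        · simp [(show x ≠ t by omega), (show x ≠ t + 2 by omega), (show x ≠ t + 3 by omega),
            k2 x (by omega), hxi, hk x hx hxi]
        · simp [k2 (t + 1) (by omega), (show t + 1 ≠ i by omega), hsave]
        · simp [k2 t (by omega), (show t ≠ i by omega), hacc, v2, Finset.sum_range_succ]
        · simp [k2 (t + 2) (by omega), (show t + 2 ≠ i by omega), hctr]
          omega)
      n 0 (by omega) _ _
      (by
        refine ⟨by simp, fun x hx hxi => ?_, ?_, ?_⟩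
        · simp [(show x ≠ t by omega), (show x ≠ t + 1 by omega), (show x ≠ t + 2 by omega)]
        · simp [(show i ≠ t by omega)]
        · simp)
      (by simp [(show 40 ≠ t by omega), (show 40 ≠ t + 1 by omega), hr.reg40]) r3.2
    obtain ⟨r5, h5, hm5, hk5, hs5, ha5⟩ := r4
    have r6 := runs_const h5.2 (t + 2) 0
    have r7 := runs_add r6.2 i (t + 1) (t + 2)
    refine ⟨_, (r1.seq (r2.seq (r3.seq (h5.seq (r6.seq r7))))).mono ?_, by simp [hm5],
      fun x hx => ?_, ?_⟩
    · simp only [steps]; ring_nf; omega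
    · by_cases hxi : x = i
      · simp [hxi, hs5]
      · simp [hxi, (show x ≠ t + 2 by omega), hk5 x hx hxi]
    · simp [(show t ≠ i by omega), ha5, eval]

/-- Compiled commands have the correct effect within their step bounds. -/
lemma Cmd.compile_correct {n : ℕ} {inp : ℕ → ℕ} (c : Cmd) :
    c.WF → ∀ t, 50 ≤ t → ∀ s r B, Represents n inp s r → Bits B r →
    ∃ r', Runs (c.compile t) r r' (c.steps n) B ∧ Represents n inp (c.run n inp s) r' ∧
      ∀ x < t, 50 ≤ x → r'.reg x = r.reg x := by
  induction c with
  | assign x e =>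
    rintro ⟨hx, hwf⟩ t ht s r B hr hb
    obtain ⟨r1, h1, m1, k1, v1⟩ := e.compile_correct hwf t ht s r B hr hb
    have h2 := runs_const h1.2 (t + 1) 0
    have h3 := runs_add h2.2 x t (t + 1)
    refine ⟨_, (h1.seq (h2.seq h3)).mono (by simp only [steps]; omega), ?_, fun y hy hy' => ?_⟩
    · refine hr.setv hx (by simp [m1]) (by simp [v1]) fun y hy hyx => ?_
      simp [hyx, (show y ≠ t + 1 by omega), k1 y (by omega)]
    · simp [(show y ≠ x by omega), (show y ≠ t + 1 by omega), k1 y hy]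
  | store j e f =>
    rintro ⟨hj, hwf, hwf'⟩ t ht s r B hr hb
    obtain ⟨r1, h1, m1, k1, v1⟩ := e.compile_correct hwf t ht s r B hr hb
    obtain ⟨r2, h2, m2, k2, v2⟩ := runs_addr h1.2 ht j
      (show r1.reg 41 = n * n by rw [k1 41 (by omega), hr.reg41])
    obtain ⟨r3, h3, m3, k3, v3⟩ := f.compile_correct hwf' (t + 1) (by omega) s r2 _
      (hr.congr (m2.trans m1) fun x hx => by rw [k2 x (by omega), k1 x (by omega)]) h2.2
    have h4 := runs_store h3.2 t (t + 1)
    have hkeep : ∀ x < t, r3.reg x = r.reg x := fun x hx => by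
      rw [k3 x (by omega), k2 x hx, k1 x hx]
    refine ⟨_, (h1.seq (h2.seq (h3.seq h4))).mono (by simp only [steps]; omega), ?_,
      fun y hy _ => hkeep y hy⟩
    have hmem : r3.mem = r.mem := by rw [m3, m2, m1]
    rw [k3 t (by omega), v2, v1, v3]
    refine ⟨fun x hx => ?_, fun b => ?_, fun j' hj' i => ?_, fun i hi => ?_⟩
    · exact (hkeep x (by omega)).trans (hr.var x hx)
    · rw [← hr.bound b]
      exact hkeep _ (by unfold boundReg; split <;> omega)
    · simp only [RamState.put, Function.update_apply, run, LState.seta, hmem]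
      by_cases hjj : j' = j
      · subst hjj
        simp only [if_true, Function.update_apply]
        by_cases hii : i = e.eval n inp s
        · simp [hii]
        · rw [if_neg (by omega), if_neg hii, hr.arr j' hj']
      · rw [if_neg (by omega), if_neg hjj, hr.arr j' hj']
    · simp only [RamState.put, Function.update_apply, hmem]
      rw [if_neg (by omega), hr.inp i hi]
  | seq c d ihc ihd =>
    rintro ⟨hc, hd⟩ t ht s r B hr hb
    obtain ⟨r1, h1, R1, k1⟩ := ihc hc t ht s r B hr hb
    obtain ⟨r2, h2, R2, k2⟩ := ihd hd t ht _ r1 _ R1 h1.2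
    exact ⟨r2, h1.seq h2, R2, fun x hx hx' => by rw [k2 x hx hx', k1 x hx hx']⟩
  | ite e c d ihc ihd =>
    rintro ⟨he, hc, hd⟩ t ht s r B hr hb
    obtain ⟨r1, h1, m1, k1, v1⟩ := e.compile_correct he t ht s r B hr hb
    have hr1 := hr.congr m1 fun x hx => k1 x (by omega)
    by_cases h0 : e.eval n inp s = 0
    · obtain ⟨r2, h2, R2, k2⟩ := ihd hd t ht s r1 _ hr1 h1.2
      have h3 := runs_ite h1.2 (x := t) (p := c.compile t) (q := d.compile t) (s' := r2)
        (T := c.steps n + d.steps n) (fun hne => absurd (v1.trans h0) hne)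
        (fun _ => h2.mono (by omega))
      refine ⟨_, h1.seq h3, ?_, fun x hx hx' => by rw [k2 x hx hx', k1 x hx]⟩
      simpa [run, h0] using R2
    · obtain ⟨r2, h2, R2, k2⟩ := ihc hc t ht s r1 _ hr1 h1.2
      have h3 := runs_ite h1.2 (x := t) (p := c.compile t) (q := d.compile t) (s' := r2)
        (T := c.steps n + d.steps n) (fun _ => h2.mono (by omega))
        (fun heq => absurd (v1.symm.trans heq) h0)
      refine ⟨_, h1.seq h3, ?_, fun x hx hx' => by rw [k2 x hx hx', k1 x hx]⟩
      simpa [run, h0] using R2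
  | loop b x c ih =>
    rintro ⟨hx, hwf⟩ t ht s r B hr hb
    have hbr : boundReg b < 43 := by unfold boundReg; split <;> omega
    have hbr' : 40 ≤ boundReg b := by unfold boundReg; split <;> omega
    have r1 := runs_const hb t 0
    have r2 := runs_add r1.2 t (boundReg b) t
    obtain ⟨r3, h3, R3, K3⟩ := runs_loop (k := loopBound n b) (x := t) (T := c.steps n + 4)
      (p := (.seq (.sub x (boundReg b) t) <| .seq (c.compile (t + 1)) <|
        .seq (.const (t + 1) 1) (.sub t t (t + 1))))
      (fun j r' => Represents n inp
          (Nat.rec s (fun j s' => c.run n inp (s'.setv x j)) j : LState) r' ∧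
        ∀ y < t, 50 ≤ y → r'.reg y = r.reg y)
      (by
        rintro j hj r' B' ⟨hrep, hk⟩ hctr hb'
        have q1 := runs_sub hb' x (boundReg b) t
        have hj' : r'.reg (boundReg b) - r'.reg t = j := by
          rw [hrep.bound, hctr]; omega
        rw [hj'] at q1
        have hrep' := hrep.setv (r' := r'.set x j) (k := j) hx rfl (by simp)
          fun y hy hyx => by simp [hyx]
        obtain ⟨r'', q2, R2, k2⟩ := ih hwf (t + 1) (by omega) _ _ _ hrep' q1.2
        have q3 := runs_const q2.2 (t + 1) 1
        have q4 := runs_sub q3.2 t t (t + 1)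
        refine ⟨_, (q1.seq (q2.seq (q3.seq q4))).mono (by omega), ⟨?_, fun y hy hy' => ?_⟩, ?_⟩
        · refine R2.congr rfl fun y hy => ?_
          simp [(show y ≠ t by omega), (show y ≠ t + 1 by omega)]
        · simp [(show y ≠ t by omega), (show y ≠ t + 1 by omega), k2 y (by omega) hy',
            (show y ≠ x by omega), hk y hy hy']
        · simp [k2 t (by omega) ht, (show t ≠ x by omega), hctr]
          omega)
      (loopBound n b) 0 (by omega) _ _
      (by
        refine ⟨hr.congr rfl fun y hy => ?_, fun y hy _ => ?_⟩ <;>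
          simp [(show y ≠ t by omega)])
      (by simp [(show boundReg b ≠ t by omega), hr.bound]) r2.2
    refine ⟨r3, (r1.seq (r2.seq h3)).mono ?_, R3, K3⟩
    simp only [steps]; ring_nf; omega


/-! ### Online algorithms from loop programs -/

/-- `f` is bounded by a polynomial. -/
def PolyBounded (f : ℕ → ℕ) : Prop := ∃ d, ∀ n, f n ≤ (n + 2) ^ d

lemma PolyBounded.add {f g : ℕ → ℕ} (hf : PolyBounded f) (hg : PolyBounded g) :
    PolyBounded fun n => f n + g n := by
  obtain ⟨d, hd⟩ := hf
  obtain ⟨e, he⟩ := hg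
  refine ⟨d + e + 1, fun n => ?_⟩
  have h1 : (n + 2) ^ d ≤ (n + 2) ^ (d + e) := Nat.pow_le_pow_right (by omega) (by omega)
  have h2 : (n + 2) ^ e ≤ (n + 2) ^ (d + e) := Nat.pow_le_pow_right (by omega) (by omega)
  calc f n + g n ≤ (n + 2) ^ (d + e) + (n + 2) ^ (d + e) :=
        add_le_add ((hd n).trans h1) ((he n).trans h2)
    _ = (n + 2) ^ (d + e) * 2 := by ring
    _ ≤ (n + 2) ^ (d + e) * (n + 2) := Nat.mul_le_mul_left _ (by omega)
    _ = (n + 2) ^ (d + e + 1) := by ring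

lemma PolyBounded.mul {f g : ℕ → ℕ} (hf : PolyBounded f) (hg : PolyBounded g) :
    PolyBounded fun n => f n * g n := by
  obtain ⟨d, hd⟩ := hf
  obtain ⟨e, he⟩ := hg
  exact ⟨d + e, fun n => by rw [pow_add]; exact Nat.mul_le_mul (hd n) (he n)⟩

lemma polyBounded_const (k : ℕ) : PolyBounded fun _ => k :=
  ⟨k, fun n => Nat.lt_two_pow_self.le.trans (Nat.pow_le_pow_left (by omega) k)⟩

lemma polyBounded_id : PolyBounded fun n => n := ⟨1, fun n => by simp⟩

lemma polyBounded_loopBound (b : ℕ) : PolyBounded fun n => loopBound n b := by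
  unfold loopBound
  match b with
  | 0 => exact polyBounded_id
  | 1 => exact polyBounded_id.mul polyBounded_id
  | _ + 2 =>
    exact (((polyBounded_const _).mul polyBounded_id).mul polyBounded_id).mul polyBounded_id

lemma Expr.polyBounded_steps (e : Expr) : PolyBounded e.steps := by
  induction e with
  | lit k => exact polyBounded_const _
  | var x => exact polyBounded_const _
  | add e f he hf => exact (he.add hf).add (polyBounded_const 1)
  | sub e f he hf => exact (he.add hf).add (polyBounded_const 1)
  | div e f he hf => exact (he.add hf).add (polyBounded_const 1)
  | muln e he => exact he.add (polyBounded_id.add (polyBounded_const 1))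
  | get r e he => exact he.add (polyBounded_const _)
  | inp e he => exact he.add (polyBounded_const _)
  | ite c e f hc he hf => exact hc.add ((he.add hf).add (polyBounded_const 1))
  | sum i e he => exact (polyBounded_id.mul (he.add (polyBounded_const 6))).add (polyBounded_const 6)

lemma Cmd.polyBounded_steps (c : Cmd) : PolyBounded c.steps := by
  induction c with
  | assign x e => exact e.polyBounded_steps.add (polyBounded_const 2)
  | store r e f =>
    exact (e.polyBounded_steps.add f.polyBounded_steps).add (polyBounded_const _)
  | seq c d hc hd => exact hc.add hd
  | ite e c d hc hd => exact e.polyBounded_steps.add ((hc.add hd).add (polyBounded_const 1))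
  | loop b x c hc =>
    exact ((polyBounded_loopBound b).mul (hc.add (polyBounded_const 5))).add (polyBounded_const 3)

/-- Computes the loop bounds from the number `n` of vertices in register `0`. -/
def preludeProg : Prog :=
  .seq (.const 43 0) <| .seq (.add 40 0 43) <| .seq (.mul 41 40 40) <| .seq (.const 42 4194304) <|
    .seq (.mul 42 42 40) <| .seq (.mul 42 42 40) (.mul 42 42 40)

/-- The online algorithm that runs the loop program `init` on the graph and the loop program `step`
on each arrival. -/
def machine (init step : Cmd) : OnlineAlgorithm where
  init := .seq preludeProg (init.compile 50)
  step := step.compile 50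

/-- The adjacency matrix of the graph as the machine reads it. -/
noncomputable def inputMat {n : ℕ} (G : SimpleGraph (Fin n)) : ℕ → ℕ := (inputState G).mem

/-- The initial state of the loop program. -/
def initialState (n : ℕ) : LState where
  v x := if x = 0 then n else 0
  a _ _ := 0

/-- The state of the loop program after the arrivals `h` (most recent first). -/
noncomputable def stateAfter (init step : Cmd) {n : ℕ} (G : SimpleGraph (Fin n)) :
    List (Edge G) → LState
  | [] => init.run n (inputMat G) (initialState n)
  | e :: h => step.run n (inputMat G)
      (((stateAfter init step G h).setv 1 (e.1.1 : ℕ)).setv 2 (e.1.2 : ℕ))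

/-- The online rule that the loop program carries out. -/
noncomputable def ruleOf (init step : Cmd) {n : ℕ} (G : SimpleGraph (Fin n)) : OnlineRule G :=
  fun h e => decide ((stateAfter init step G (e :: h)).v 0 ≠ 0)

lemma bits_inputState {n : ℕ} (G : SimpleGraph (Fin n)) : Bits (n + 1) (inputState G) := by
  constructor
  · intro x
    simp only [inputState]
    split_ifs
    · exact Nat.lt_two_pow_self.trans (Nat.pow_lt_pow_right (by norm_num) (by omega))
    · positivity
  · intro a
    simp only [inputState]
    split_ifs
    · exact Nat.one_lt_two_pow (by omega)
    · positivity

lemma inputMat_eq_zero {n : ℕ} (G : SimpleGraph (Fin n)) {a : ℕ} (ha : n * n ≤ a) :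
    inputMat G a = 0 := by
  simp only [inputMat, inputState]
  rw [if_neg]
  rintro ⟨u, v, -, rfl⟩
  have h1 : ((u : ℕ) + 1) * n ≤ n * n := Nat.mul_le_mul_right n u.2
  rw [Nat.add_mul] at h1
  have := v.2
  omega

lemma runs_prelude {n : ℕ} (G : SimpleGraph (Fin n)) :
    ∃ r, Runs preludeProg (inputState G) r (5 * n + 4194312) (n + 1) ∧
      Represents n (inputMat G) (initialState n) r := by
  have hn : n < 2 ^ n := Nat.lt_two_pow_self
  have r1 := runs_const (bits_inputState G) 43 0
  have r2 := runs_add r1.2 40 0 43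
  have r3 := runs_mul r2.2 41 40 40 (n := n) (by simpa [inputState] using hn)
  have r4 := runs_const r3.2 42 4194304
  have r5 := runs_mul r4.2 42 42 40 (n := n) (by simpa [inputState] using hn)
  have r6 := runs_mul r5.2 42 42 40 (n := n) (by simpa [inputState] using hn)
  have r7 := runs_mul r6.2 42 42 40 (n := n) (by simpa [inputState] using hn)
  refine ⟨_, (r1.seq (r2.seq (r3.seq (r4.seq (r5.seq (r6.seq r7)))))).mono (by omega), ?_⟩
  refine ⟨fun x hx => ?_, fun b => ?_, fun j hj i => ?_, fun i hi => ?_⟩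
  · simp [(show x ≠ 40 by omega), (show x ≠ 41 by omega), (show x ≠ 42 by omega),
      (show x ≠ 43 by omega), inputState, initialState]
  · match b with
    | 0 => simp [boundReg, loopBound, inputState]
    | 1 => simp [boundReg, loopBound, inputState]
    | _ + 2 => simp [boundReg, loopBound, bigBound, inputState]
  · exact inputMat_eq_zero G (by omega)
  · rfl

lemma Bits.present {n B : ℕ} {G : SimpleGraph (Fin n)} {s : RamState} (h : Bits B s) (hB : n ≤ B)
    (e : Edge G) : Bits B (s.present e) := by
  have hlt : ∀ u : Fin n, (u : ℕ) < 2 ^ B := fun u =>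
    u.2.trans (Nat.lt_two_pow_self.trans_le (Nat.pow_le_pow_right (by norm_num) hB))
  exact (h.set (hlt _)).set (hlt _)

lemma Represents.present {n : ℕ} {inp : ℕ → ℕ} {G : SimpleGraph (Fin n)} {s : LState}
    {r : RamState} (h : Represents n inp s r) (e : Edge G) :
    Represents n inp ((s.setv 1 (e.1.1 : ℕ)).setv 2 (e.1.2 : ℕ)) (r.present e) := by
  unfold RamState.present
  refine (h.setv (r' := r.set 1 (e.1.1 : ℕ)) (by omega) rfl (by simp) ?_).setv (by omega) rfl
    (by simp) ?_
  · intro y _ hy; simp [hy]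
  · intro y _ hy; simp [hy]

/-- Loop programs are carried out in polynomial time. The lengths of the numbers grow by a
polynomial in `n` with every arrival. -/
theorem machine_computesInTime (init step : Cmd) (hi : init.WF) (hs : step.WF) :
    ∃ d, ∀ (n : ℕ) (G : SimpleGraph (Fin n)),
      (machine init step).ComputesInTime G (ruleOf init step G) d := by
  set T0 : ℕ → ℕ := fun n => 5 * n + 4194312 + init.steps n with hT0
  have hpT0 : PolyBounded T0 := (((polyBounded_const 5).mul polyBounded_id).add
    (polyBounded_const _)).add init.polyBounded_steps
  obtain ⟨d0, hd0⟩ : PolyBounded fun n => T0 n * (4 * (n + 1 + T0 n) + 4) :=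
    hpT0.mul (((polyBounded_const 4).mul ((polyBounded_id.add (polyBounded_const 1)).add hpT0)).add
      (polyBounded_const 4))
  obtain ⟨d1, hd1⟩ := step.polyBounded_steps
  -- a monotone majorant of the step bound, as a function of `m = n + t`
  obtain ⟨d2, hd2⟩ : PolyBounded fun m =>
      (m + 2) ^ d1 * (4 * (m + 1 + (m + 2) ^ d0 + m * (m + 2) ^ d1 + (m + 2) ^ d1) + 4) := by
    have hp : ∀ d, PolyBounded fun m => (m + 2) ^ d := fun d => ⟨d, fun _ => le_rfl⟩
    exact (hp d1).mul (((polyBounded_const 4).mul ((((polyBounded_id.add (polyBounded_const 1)).add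
      (hp d0)).add (polyBounded_id.mul (hp d1))).add (hp d1))).add (polyBounded_const 4))
  have hT0le : ∀ n, T0 n ≤ (n + 2) ^ d0 := fun n =>
    le_trans (Nat.le_mul_of_pos_right _ (by omega)) (hd0 n)
  refine ⟨d0 + d2, fun n G => ?_⟩
  set B : ℕ → ℕ := fun t => n + 1 + T0 n + t * step.steps n with hB
  let R : List (Edge G) → RamState → Prop := fun h r =>
    Represents n (inputMat G) (stateAfter init step G h) r ∧ Bits (B h.length) r
  obtain ⟨r0, hr0, hR0⟩ : ∃ r, (∃ c ≤ (n + 2) ^ (d0 + d2),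
      Exec (machine init step).init (inputState G) c r) ∧ R [] r := by
    obtain ⟨r1, h1, R1⟩ := runs_prelude G
    obtain ⟨r2, h2, R2, -⟩ := init.compile_correct hi 50 le_rfl _ r1 _ R1 h1.2
    obtain ⟨⟨c, hc, he⟩, hb⟩ := h1.seq h2
    refine ⟨r2, ⟨c, hc.trans ((hd0 n).trans ?_), he⟩, R2, hb.mono (by simp [hB, hT0])⟩
    exact Nat.pow_le_pow_right (by omega) (by omega)
  have hstep : ∀ (h : List (Edge G)) (e : Edge G) (r : {r // R h r}), ∃ r' : {r // R (e :: h) r},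
      ∃ c ≤ (n + h.length + 2) ^ (d0 + d2), Exec (machine init step).step (r.1.present e) c r'.1 := by
    rintro h e ⟨r, hrep, hbits⟩
    have hnB : n ≤ B h.length := by simp only [hB]; omega
    obtain ⟨r', ⟨⟨c, hc, he⟩, hb⟩, R', -⟩ := step.compile_correct hs 50 le_rfl _ _ _
      (hrep.present e) (hbits.present hnB e)
    refine ⟨⟨r', R', hb.mono ?_⟩, c, hc.trans ?_, he⟩
    · simp only [hB, List.length_cons]; rw [Nat.add_mul]; omega
    · set t := h.length with ht
      have hs1 : step.steps n ≤ (n + t + 2) ^ d1 :=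
        (hd1 n).trans (Nat.pow_le_pow_left (by omega) d1)
      have hs0 : T0 n ≤ (n + t + 2) ^ d0 :=
        (hT0le n).trans (Nat.pow_le_pow_left (by omega) d0)
      have hts : t * step.steps n ≤ (n + t) * (n + t + 2) ^ d1 :=
        Nat.mul_le_mul (by omega) hs1
      refine le_trans (Nat.mul_le_mul hs1 ?_) ((hd2 (n + t)).trans
        (Nat.pow_le_pow_right (by omega) (by omega)))
      simp only [hB]
      omega
  choose next hnext using hstep
  let st : ∀ h : List (Edge G), {r // R h r} := fun h =>
    List.rec (motive := fun h => {r // R h r}) ⟨r0, hR0⟩ (fun e h r => next h e r) h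
  refine ⟨fun h => (st h).1, hr0, fun h e => ⟨hnext h e (st h), ?_⟩⟩
  have := (st (e :: h)).2.1.var 0 (by omega)
  rw [this]
  simp [ruleOf]


/-! ### Reasoning about loop programs -/

/-- The variables that a command assigns. -/
def Cmd.assigned : Cmd → List ℕ
  | assign x _ => [x]
  | store _ _ _ => []
  | seq c d => c.assigned ++ d.assigned
  | ite _ c d => c.assigned ++ d.assigned
  | loop _ x c => x :: c.assigned

/-- The arrays that a command stores to. -/
def Cmd.stored : Cmd → List ℕ
  | assign _ _ => []
  | store r _ _ => [r]
  | seq c d => c.stored ++ d.stored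
  | ite _ c d => c.stored ++ d.stored
  | loop _ _ c => c.stored

/-- The arrays that an expression reads. -/
def Expr.reads : Expr → List ℕ
  | lit _ => []
  | var _ => []
  | add e f => e.reads ++ f.reads
  | sub e f => e.reads ++ f.reads
  | div e f => e.reads ++ f.reads
  | muln e => e.reads
  | get r e => r :: e.reads
  | inp e => e.reads
  | ite c e f => c.reads ++ (e.reads ++ f.reads)
  | sum _ e => e.reads

@[simp] lemma LState.setv_v (s : LState) (x k y : ℕ) :
    (s.setv x k).v y = if y = x then k else s.v y := by
  simp [LState.setv, Function.update_apply]

@[simp] lemma LState.setv_a (s : LState) (x k : ℕ) : (s.setv x k).a = s.a := rfl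

@[simp] lemma LState.seta_v (s : LState) (r i k : ℕ) : (s.seta r i k).v = s.v := rfl

lemma LState.seta_a (s : LState) (r i k q j : ℕ) :
    (s.seta r i k).a q j = if q = r ∧ j = i then k else s.a q j := by
  simp only [LState.seta, Function.update_apply]
  by_cases h : q = r
  · subst h; simp [Function.update_apply]
  · simp [h]

section Semantics

variable {n : ℕ} {inp : ℕ → ℕ}

/-- The invariant rule for loops. -/
lemma Cmd.run_loop (b x : ℕ) (c : Cmd) (s : LState) (I : ℕ → LState → Prop) (h0 : I 0 s)
    (hstep : ∀ j < loopBound n b, ∀ s', I j s' → I (j + 1) (c.run n inp (s'.setv x j))) :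
    I (loopBound n b) ((loop b x c).run n inp s) := by
  have : ∀ k ≤ loopBound n b,
      I k (Nat.rec s (fun j s' => c.run n inp (s'.setv x j)) k : LState) := by
    intro k
    induction k with
    | zero => intro _; exact h0
    | succ k ih => intro hk; exact hstep k (by omega) _ (ih (by omega))
  exact this _ le_rfl

lemma Cmd.run_v_of_not_mem (c : Cmd) {x : ℕ} (hx : x ∉ c.assigned) (s : LState) :
    (c.run n inp s).v x = s.v x := by
  induction c generalizing s with
  | assign y e =>
    simp only [assigned, List.mem_singleton] at hx
    simp [run, hx]
  | store r e f => rfl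
  | seq c d hc hd =>
    simp only [assigned, List.mem_append, not_or] at hx
    simp [run, hd hx.2, hc hx.1]
  | ite e c d hc hd =>
    simp only [assigned, List.mem_append, not_or] at hx
    simp only [run]
    split_ifs
    · exact hc hx.1 s
    · exact hd hx.2 s
  | loop b y c hc =>
    simp only [assigned, List.mem_cons, not_or] at hx
    refine Cmd.run_loop b y c s (fun _ s' => s'.v x = s.v x) rfl fun j _ s' h => ?_
    rw [hc hx.2, LState.setv_v, if_neg hx.1, h]

lemma Cmd.run_a_of_not_mem (c : Cmd) {r : ℕ} (hr : r ∉ c.stored) (s : LState) :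
    (c.run n inp s).a r = s.a r := by
  induction c generalizing s with
  | assign y e => rfl
  | store q e f =>
    simp only [stored, List.mem_singleton] at hr
    funext j
    simp [run, LState.seta_a, hr]
  | seq c d hc hd =>
    simp only [stored, List.mem_append, not_or] at hr
    simp [run, hd hr.2, hc hr.1]
  | ite e c d hc hd =>
    simp only [stored, List.mem_append, not_or] at hr
    simp only [run]
    split_ifs
    · exact hc hr.1 s
    · exact hd hr.2 s
  | loop b y c hc =>
    refine Cmd.run_loop b y c s (fun _ s' => s'.a r = s.a r) rfl fun j _ s' h => ?_
    rw [hc hr, LState.setv_a, h]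

lemma Expr.eval_congr (e : Expr) {s s' : LState} (hv : s.v = s'.v)
    (ha : ∀ r ∈ e.reads, s.a r = s'.a r) : e.eval n inp s = e.eval n inp s' := by
  induction e generalizing s s' with
  | lit k => rfl
  | var x => simp [eval, hv]
  | add e f he hf | sub e f he hf | div e f he hf =>
    simp only [reads, List.mem_append] at ha
    simp only [eval]
    rw [he hv fun r hr => ha r (Or.inl hr), hf hv fun r hr => ha r (Or.inr hr)]
  | muln e he => simp only [eval]; rw [he hv ha]
  | get r e he =>
    simp only [reads, List.mem_cons] at ha
    simp only [eval]
    rw [he hv fun r hr => ha r (Or.inr hr), ha r (Or.inl rfl)]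
  | inp e he => simp only [eval]; rw [he hv ha]
  | ite c e f hc he hf =>
    simp only [reads, List.mem_append] at ha
    simp only [eval]
    rw [hc hv fun r hr => ha r (Or.inl hr), he hv fun r hr => ha r (Or.inr (Or.inl hr)),
      hf hv fun r hr => ha r (Or.inr (Or.inr hr))]
  | sum i e he =>
    simp only [eval]
    refine Finset.sum_congr rfl fun j _ => he ?_ ha
    simp [LState.setv, hv]

/-- `a = b`, as `0` or `1`. -/
def Expr.eq (a b : Expr) : Expr := .ite (.add (.sub a b) (.sub b a)) (.lit 0) (.lit 1)

/-- `a ≤ b`, as `0` or `1`. -/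
def Expr.le (a b : Expr) : Expr := .ite (.sub a b) (.lit 0) (.lit 1)

/-- Conjunction of expressions whose values stand for truth values. -/
def Expr.and (a b : Expr) : Expr := .ite a b (.lit 0)

/-- Disjunction of expressions whose values stand for truth values. -/
def Expr.or (a b : Expr) : Expr := .ite a (.lit 1) b

/-- The index of the cell `(a, b)` of a matrix with `n` columns. -/
def Expr.cell (a b : Expr) : Expr := .add (.muln a) b

lemma Expr.eval_ite (c a b : Expr) (s : LState) : (Expr.ite c a b).eval n inp s =
    if c.eval n inp s = 0 then b.eval n inp s else a.eval n inp s := by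
  rw [Expr.eval, ite_not]

@[simp] lemma Expr.eval_eq (a b : Expr) (s : LState) :
    (a.eq b).eval n inp s = if a.eval n inp s = b.eval n inp s then 1 else 0 := by
  rw [Expr.eq, Expr.eval_ite]
  by_cases h : a.eval n inp s = b.eval n inp s
  · rw [if_pos (by simp only [Expr.eval]; omega), if_pos h]; rfl
  · rw [if_neg (by simp only [Expr.eval]; omega), if_neg h]; rfl

@[simp] lemma Expr.eval_le (a b : Expr) (s : LState) :
    (a.le b).eval n inp s = if a.eval n inp s ≤ b.eval n inp s then 1 else 0 := by
  rw [Expr.le, Expr.eval_ite]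
  by_cases h : a.eval n inp s ≤ b.eval n inp s
  · rw [if_pos (by simp only [Expr.eval]; omega), if_pos h]; rfl
  · rw [if_neg (by simp only [Expr.eval]; omega), if_neg h]; rfl

@[simp] lemma Expr.eval_and_ne_zero (a b : Expr) (s : LState) :
    (a.and b).eval n inp s ≠ 0 ↔ a.eval n inp s ≠ 0 ∧ b.eval n inp s ≠ 0 := by
  simp only [Expr.and, Expr.eval_ite]
  simp only [Expr.eval]
  split_ifs <;> simp [*]

@[simp] lemma Expr.eval_or_ne_zero (a b : Expr) (s : LState) :
    (a.or b).eval n inp s ≠ 0 ↔ a.eval n inp s ≠ 0 ∨ b.eval n inp s ≠ 0 := by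
  simp only [Expr.or, Expr.eval_ite]
  simp only [Expr.eval]
  split_ifs <;> simp [*]

lemma Expr.eval_and (a b : Expr) (s : LState) : (a.and b).eval n inp s =
    if a.eval n inp s = 0 then 0 else b.eval n inp s := by
  simp only [Expr.and, Expr.eval_ite]
  simp only [Expr.eval]

lemma Expr.eval_sum (i : ℕ) (e : Expr) (s : LState) : (Expr.sum i e).eval n inp s =
    ∑ j : Fin n, e.eval n inp (s.setv i j) := by
  simp only [Expr.eval, Finset.sum_range]

lemma Cmd.run_ite (e : Expr) (c d : Cmd) (s : LState) : (Cmd.ite e c d).run n inp s =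
    if e.eval n inp s = 0 then d.run n inp s else c.run n inp s := by
  rw [Cmd.run, ite_not]

/-- For all `j` below the bound of kind `b`, replaces the cell `j` of the array `r` by the value of
`e` at `j`, the value of the variable `22`. Array `7` holds the new values until all are computed. -/
def Cmd.fill (b r : ℕ) (e : Expr) : Cmd :=
  .seq (.loop b 22 (.store 7 (.var 22) e)) (.loop b 22 (.store r (.var 22) (.get 7 (.var 22))))

lemma Cmd.run_fill {b r : ℕ} {e : Expr} (hr : r ≠ 7) (he : 7 ∉ e.reads) (s : LState) :
    (∀ j < loopBound n b, ((fill b r e).run n inp s).a r j = e.eval n inp (s.setv 22 j)) ∧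
    ∀ j, loopBound n b ≤ j → ((fill b r e).run n inp s).a r j = s.a r j := by
  have h1 := Cmd.run_loop (n := n) (inp := inp) b 22 (.store 7 (.var 22) e) s
    (fun k s' => (∀ x, x ≠ 22 → s'.v x = s.v x) ∧ (∀ q, q ≠ 7 → s'.a q = s.a q) ∧
      ∀ j < k, s'.a 7 j = e.eval n inp (s.setv 22 j)) (by simp) (by
    rintro j - s' ⟨hv, ha, h7⟩
    refine ⟨fun x hx => by simp [run, hx, hv x hx], fun q hq => ?_, fun i hi => ?_⟩
    · funext i; simp [run, LState.seta_a, hq, ha q hq]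
    · simp only [run, LState.seta_a, Expr.eval, LState.setv_v, if_true, LState.setv_a, true_and]
      split_ifs with hij
      · subst hij
        refine e.eval_congr ?_ fun q hq => ha q fun h => he (h ▸ hq)
        funext x
        by_cases hx : x = 22
        · simp [hx]
        · simp [hx, hv x hx]
      · exact h7 i (by omega))
  set s1 := (loop b 22 (.store 7 (.var 22) e)).run n inp s with hs1
  have h2 := Cmd.run_loop (n := n) (inp := inp) b 22 (.store r (.var 22) (.get 7 (.var 22))) s1
    (fun k s' => (∀ j < k, s'.a r j = s1.a 7 j) ∧ (∀ j, k ≤ j → s'.a r j = s1.a r j) ∧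
      s'.a 7 = s1.a 7) (by simp) (by
    rintro j - s' ⟨h3, h4, h7⟩
    refine ⟨fun i hi => ?_, fun i hi => ?_, ?_⟩
    · simp only [run, LState.seta_a, Expr.eval, LState.setv_v, if_true, LState.setv_a, true_and]
      split_ifs with hij
      · rw [h7, hij]
      · exact h3 i (by omega)
    · simp only [run, LState.seta_a, Expr.eval, LState.setv_v, if_true, LState.setv_a, true_and]
      rw [if_neg (by omega)]
      exact h4 i (by omega)
    · funext i
      simp [run, LState.seta_a, Ne.symm hr, h7])
  refine ⟨fun j hj => ?_, fun j hj => ?_⟩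
  · exact (h2.1 j hj).trans (h1.2.2 j hj)
  · exact (h2.2.1 j hj).trans (by rw [h1.2.1 r hr])

end Semantics

/-! ### The algorithm as a loop program

The arrays are: `0` the labels of the vertex pairs, `1` the cluster and `2` the walk value of each
vertex, `5` and `6` the in-degrees and out-degrees of the vertices in the pieces, `7` scratch. The
variables that matter for several parts are: `1`, `2` the new edge, `3` the approximation `κ` of
`log n`, `4` the splitting parameter `18 κ`, `5` the mass of a walk, `6` the level, `7` the number
of clusters, `9` the start of the walk, `11` the vertex whose sweep is tested. -/

namespace Program

/-- `(a, b)` is an unlabelled edge. The labels are in array `0`. -/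
def free (a b : Expr) : Expr := .and (.inp (.cell a b)) (.eq (.get 0 (.cell a b)) (.lit 0))

/-- `(a, b)` is an unlabelled edge inside the cluster `c`. The clusters are in array `1`. -/
def inside (c a b : Expr) : Expr :=
  .and (.and (.eq (.get 1 a) c) (.eq (.get 1 b) c)) (free a b)

/-- `a` lies in the sweep set, that is, in the cluster number `var 12`, with a value (in array `2`)
of at least `var 13`. -/
def sweep (a : Expr) : Expr := .and (.eq (.get 1 a) (.var 12)) (.le (.var 13) (.get 2 a))

/-- Splits the cluster of the vertex `var 11` along its sweep set at this vertex, if the split is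
admissible for the parameter `var 4`. The number of clusters is `var 7`. -/
def check : Cmd :=
  .seq (.assign 12 (.get 1 (.var 11))) <|
  .seq (.assign 13 (.get 2 (.var 11))) <|
  .seq (.assign 14 (.sum 20 (.eq (.get 1 (.var 20)) (.var 12)))) <|
  .seq (.assign 15 (.sum 20 (sweep (.var 20)))) <|
  .seq (.assign 16 (.sum 20 (.sum 21 (inside (.var 12) (.var 20) (.var 21))))) <|
  .seq (.assign 17 (.sum 20 (.ite (sweep (.var 20))
    (.sum 21 (inside (.var 12) (.var 20) (.var 21))) (.lit 0)))) <|
  .seq (.assign 18 (.sum 20 (.ite (sweep (.var 20))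
    (.sum 21 (.ite (sweep (.var 21)) (.lit 0) (inside (.var 12) (.var 20) (.var 21))))
    (.lit 0)))) <|
  .ite (.and (.sub (.var 14) (.var 15)) (.or
      (.and (.le (.var 18) (.div (.var 17) (.var 4)))
        (.le (.var 18) (.div (.sub (.var 16) (.var 17)) (.var 4))))
      (.le (.var 18) (.div (.div (.var 16) (.var 4)) (.var 14)))))
    (.seq (.fill 0 1 (.ite (sweep (.var 22)) (.var 7) (.get 1 (.var 22))))
      (.assign 7 (.add (.var 7) (.lit 1))))
    (.assign 19 (.lit 0))

/-- One step of the rounded lazy random walk. -/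
def walk : Cmd :=
  .fill 0 2 (.div
    (.sum 21 (.ite (inside (.get 1 (.var 22)) (.var 22) (.var 21))
      (.add (.get 2 (.var 22)) (.get 2 (.var 21))) (.lit 0)))
    (.add (.sum 21 (inside (.get 1 (.var 22)) (.var 22) (.var 21)))
      (.sum 21 (inside (.get 1 (.var 22)) (.var 22) (.var 21)))))

/-- Runs the walk from the vertex `var 9` with the total mass `var 5`, and checks all sweeps. -/
def trial : Cmd :=
  .seq (.fill 0 2 (.ite (.eq (.var 22) (.var 9)) (.var 5) (.lit 0)))
    (.loop 2 10 (.seq (.loop 0 11 check) walk))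

/-- Trials from all vertices. -/
def pass : Cmd := .loop 0 9 trial

/-- Gives the label `var 6 * n + c + 1` to the unlabelled pairs in the cluster `c`. -/
def relabel : Cmd :=
  .fill 1 0 (.ite
    (.and (.eq (.get 0 (.var 22)) (.lit 0))
      (.eq (.get 1 (.div (.var 22) (.muln (.lit 1))))
        (.get 1 (.sub (.var 22) (.muln (.div (.var 22) (.muln (.lit 1))))))))
    (.add (.add (.muln (.var 6)) (.get 1 (.div (.var 22) (.muln (.lit 1))))) (.lit 1))
    (.get 0 (.var 22)))

/-- One level of the decomposition. -/
def level : Cmd :=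
  .seq (.fill 0 1 (.lit 0)) <| .seq (.assign 7 (.lit 1)) <| .seq (.loop 2 8 pass) relabel

/-- An expression for twice `e`. -/
def dbl (e : Expr) : Expr := .add e e

/-- The preprocessing: computes an integer `var 3` close to `log n` from a harmonic sum, then the
parameters, and then the levels. -/
def init : Cmd :=
  .seq (.assign 3 (.add (.div (.sum 20 (.div (.muln (.lit 1)) (.add (.var 20) (.lit 1))))
    (.muln (.lit 1))) (.lit 4))) <|
  .seq (.assign 4 (.add (dbl (dbl (dbl (dbl (.var 3))))) (dbl (.var 3)))) <|
  .seq (.assign 5 (.muln (.muln (.muln (.muln (.muln (.lit 16777216))))))) <|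
  .loop 2 6 (.ite (.sub (.add (.var 3) (dbl (.var 3))) (.var 6)) level (.assign 19 (.lit 0)))

/-- The orientation of the edge `(var 1, var 2)`. Arrays `5` and `6` hold the in-degrees and the
out-degrees of the vertices in the pieces. -/
def step : Cmd :=
  .seq (.assign 14 (.get 0 (.cell (.var 1) (.var 2)))) <|
  .seq (.assign 15 (.cell (.var 14) (.var 1))) <|
  .seq (.assign 16 (.cell (.var 14) (.var 2))) <|
  .ite (.le (.add (.get 5 (.var 16)) (.get 6 (.var 15)))
      (.add (.get 5 (.var 15)) (.get 6 (.var 16))))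
    (.seq (.assign 0 (.lit 1)) <|
      .seq (.store 6 (.var 15) (.add (.get 6 (.var 15)) (.lit 1)))
        (.store 5 (.var 16) (.add (.get 5 (.var 16)) (.lit 1))))
    (.seq (.assign 0 (.lit 0)) <|
      .seq (.store 6 (.var 16) (.add (.get 6 (.var 16)) (.lit 1)))
        (.store 5 (.var 15) (.add (.get 5 (.var 15)) (.lit 1))))

lemma init_wf : init.WF := by
  simp [init, level, relabel, pass, trial, walk, check, sweep, inside, free, dbl, Cmd.fill, Cmd.WF,
    Expr.WF, Expr.eq, Expr.le, Expr.and, Expr.or, Expr.cell]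

lemma step_wf : step.WF := by
  simp [step, Cmd.WF, Expr.WF, Expr.le, Expr.cell]

end Program


/-! ### The sweeps of the walks, as the program computes them -/

section Tests

variable {V : Type*} [Fintype V]

/-- One step of the lazy random walk inside the clusters, rounded down. -/
def walkNat (F : V → V → ℕ) (comp : V → ℕ) (y : V → ℕ) (u : V) : ℕ :=
  (∑ w, clusterMat F comp (comp u) u w * (y u + y w)) /
    (2 * ∑ w, clusterMat F comp (comp u) u w)

/-- The vertices of the cluster of `u` at which `y` is at least `y u`. -/
def sweepSet (comp y : V → ℕ) (u : V) : Finset V :=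
  Finset.univ.filter fun w => comp w = comp u ∧ y u ≤ y w

lemma mem_sweepSet {comp y : V → ℕ} {u w : V} :
    w ∈ sweepSet comp y u ↔ comp w = comp u ∧ y u ≤ y w := by
  simp [sweepSet]

variable [DecidableEq V]

/-- The unit mass `M` at the vertex `s`. -/
def pointMass (M : ℕ) (s u : V) : ℕ := if u = s then M else 0

/-- No sweep of the first `t` steps of the walks from any vertex is an admissible split. -/
def Stable (σ M t : ℕ) (F : V → V → ℕ) (comp : V → ℕ) : Prop :=
  ∀ s, ∀ i < t, ∀ u, ¬ Splittable σ F comp (comp u)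
    (sweepSet comp ((walkNat F comp)^[i] (pointMass M s)) u)

end Tests

/-! ### Correctness of the preprocessing -/

section Checks

variable {n : ℕ}

lemma cell_div (a : ℕ) (v : Fin n) : (a * n + v) / n = a := by
  rw [mul_comm, Nat.mul_add_div (by have := v.2; omega), Nat.div_eq_of_lt v.2, add_zero]

lemma cell_lt (u v : Fin n) : (u : ℕ) * n + v < n * n := by
  have h1 : ((u : ℕ) + 1) * n ≤ n * n := Nat.mul_le_mul_right n u.2
  rw [Nat.add_mul] at h1
  have := v.2
  omega

lemma cell_inj {a a' : ℕ} {v v' : Fin n} (h : a * n + v = a' * n + v') : a = a' ∧ v = v' := by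
  have h1 : a = a' := by rw [← cell_div a v, h, cell_div]
  subst h1
  exact ⟨rfl, Fin.ext (by omega)⟩

/-- The labels in a state of the program. -/
def LState.lab (n : ℕ) (s : LState) (u w : Fin n) : ℕ := s.a 0 ((u : ℕ) * n + w)

/-- The clusters in a state of the program. -/
def LState.comp (n : ℕ) (s : LState) (v : Fin n) : ℕ := s.a 1 v

/-- The vertex values in a state of the program. -/
def LState.val (n : ℕ) (s : LState) (v : Fin n) : ℕ := s.a 2 v

@[simp] lemma LState.comp_setv (s : LState) (x k : ℕ) : (s.setv x k).comp n = s.comp n := rfl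

@[simp] lemma LState.val_setv (s : LState) (x k : ℕ) : (s.setv x k).val n = s.val n := rfl

variable (G : SimpleGraph (Fin n))

/-- The unlabelled edges in a state of the program. -/
noncomputable def LState.rest (s : LState) : Fin n → Fin n → ℕ := labMat G (s.lab n) 0

@[simp] lemma LState.rest_setv (s : LState) (x k : ℕ) : (s.setv x k).rest G = s.rest G := rfl

variable {G}

lemma inputMat_cell_ne_zero (u w : Fin n) : inputMat G ((u : ℕ) * n + w) ≠ 0 ↔ G.Adj u w := by
  simp only [inputMat, inputState]
  constructor
  · intro h
    split_ifs at h with hex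
    swap
    · exact absurd rfl h
    obtain ⟨u', v', hadj, he⟩ := hex
    obtain ⟨h1, rfl⟩ := cell_inj he
    rwa [Fin.ext h1]
  · intro h
    rw [if_pos ⟨u, w, h, rfl⟩]
    norm_num

lemma eval_inp_ne_zero {e : Expr} {s : LState} {u w : Fin n}
    (he : e.eval n (inputMat G) s = (u : ℕ) * n + w) :
    (Expr.inp e).eval n (inputMat G) s ≠ 0 ↔ G.Adj u w := by
  rw [← inputMat_cell_ne_zero, Expr.eval, he, if_pos (cell_lt u w)]

namespace Program

lemma eval_free {a b : Expr} {s : LState} {u w : Fin n}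
    (ha : a.eval n (inputMat G) s = u) (hb : b.eval n (inputMat G) s = w) :
    (free a b).eval n (inputMat G) s = s.rest G u w := by
  have hc : (Expr.cell a b).eval n (inputMat G) s = (u : ℕ) * n + w := by
    simp only [Expr.cell, Expr.eval, ha, hb]
  have h1 := eval_inp_ne_zero (G := G) hc
  have h2 : (Expr.eq (.get 0 (.cell a b)) (.lit 0)).eval n (inputMat G) s
      = if s.lab n u w = 0 then 1 else 0 := by
    rw [Expr.eval_eq]
    simp only [Expr.eval, hc]
    rfl
  rw [free, Expr.eval_and, h2, LState.rest, labMat]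
  by_cases hadj : G.Adj u w
  · rw [if_neg (h1.2 hadj)]
    by_cases hl : s.lab n u w = 0
    · rw [if_pos hl, if_pos ⟨hadj, hl⟩]
    · rw [if_neg hl, if_neg fun h => hl h.2]
  · rw [if_pos (not_not.1 fun h => hadj (h1.1 h)), if_neg fun h => hadj h.1]

lemma eval_inside {c a b : Expr} {s : LState} {u w : Fin n}
    (ha : a.eval n (inputMat G) s = u) (hb : b.eval n (inputMat G) s = w) :
    (inside c a b).eval n (inputMat G) s
      = clusterMat (s.rest G) (s.comp n) (c.eval n (inputMat G) s) u w := by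
  have h1 : (Expr.and (.eq (.get 1 a) c) (.eq (.get 1 b) c)).eval n (inputMat G) s ≠ 0 ↔
      s.comp n u = c.eval n (inputMat G) s ∧ s.comp n w = c.eval n (inputMat G) s := by
    rw [Expr.eval_and_ne_zero, Expr.eval_eq, Expr.eval_eq]
    simp only [Expr.eval, ha, hb, LState.comp]
    simp
  rw [inside, Expr.eval_and, eval_free ha hb, clusterMat]
  by_cases h : s.comp n u = c.eval n (inputMat G) s ∧ s.comp n w = c.eval n (inputMat G) s
  · rw [if_neg (h1.2 h), if_pos h]
  · rw [if_pos (not_not.1 fun h' => h (h1.1 h')), if_neg h]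

lemma eval_sweep_ne_zero {a : Expr} {s : LState} {w : Fin n}
    (ha : a.eval n (inputMat G) s = w) :
    (sweep a).eval n (inputMat G) s ≠ 0 ↔ s.comp n w = s.v 12 ∧ s.v 13 ≤ s.val n w := by
  rw [sweep, Expr.eval_and_ne_zero, Expr.eval_eq, Expr.eval_le]
  simp only [Expr.eval, ha, LState.comp, LState.val]
  simp

lemma eval_sweep {a : Expr} {s : LState} {w : Fin n}
    (ha : a.eval n (inputMat G) s = w) :
    (sweep a).eval n (inputMat G) s
      = if s.comp n w = s.v 12 ∧ s.v 13 ≤ s.val n w then 1 else 0 := by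
  rw [sweep, Expr.eval_and, Expr.eval_eq, Expr.eval_le]
  simp only [Expr.eval, ha, LState.comp, LState.val]
  by_cases h1 : s.a 1 w = s.v 12 <;> by_cases h2 : s.v 13 ≤ s.a 2 w <;> simp [h1, h2]

/-- The fixed data of a level: the labels and the parameters. -/
def SameFrame (s s' : LState) : Prop :=
  s'.a 0 = s.a 0 ∧ s'.v 4 = s.v 4 ∧ s'.v 5 = s.v 5

lemma SameFrame.rest {s s' : LState} (h : SameFrame s s') : s'.rest G = s.rest G := by
  unfold LState.rest LState.lab
  rw [h.1]

/-- `check` performs a split along the sweep at `u` exactly if it is admissible. -/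
lemma run_check {s : LState} {u : Fin n} (hu : s.v 11 = u) (hσ : 0 < s.v 4) :
    let c := s.comp n u
    let S := sweepSet (s.comp n) (s.val n) u
    let s' := check.run n (inputMat G) s
    (Splittable (s.v 4) (s.rest G) (s.comp n) c S ∧ s'.comp n = splitOff (s.comp n) S (s.v 7) ∧
      s'.v 7 = s.v 7 + 1) ∨
    (¬ Splittable (s.v 4) (s.rest G) (s.comp n) c S ∧ s'.comp n = s.comp n ∧ s'.v 7 = s.v 7) := by
  intro c S s'
  set A := clusterMat (s.rest G) (s.comp n) c with hA
  have e12 : (Expr.get 1 (.var 11)).eval n (inputMat G) s = c := by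
    simp [Expr.eval, hu, c, LState.comp]
  set s1 := s.setv 12 c with hs1
  have e13 : (Expr.get 2 (.var 11)).eval n (inputMat G) s1 = s.val n u := by
    simp [Expr.eval, hu, hs1, LState.val]
  set s2 := s1.setv 13 (s.val n u) with hs2
  have e14 : (Expr.sum 20 (.eq (.get 1 (.var 20)) (.var 12))).eval n (inputMat G) s2
      = (cluster (s.comp n) c).card := by
    rw [Expr.eval_sum, cluster, Finset.card_filter]
    refine Finset.sum_congr rfl fun w _ => ?_
    rw [Expr.eval_eq]
    by_cases hw : s.a 1 w = c <;> simp [Expr.eval, hs2, hs1, LState.comp, hw]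
  set s3 := s2.setv 14 (cluster (s.comp n) c).card with hs3
  have e15 : (Expr.sum 20 (sweep (.var 20))).eval n (inputMat G) s3 = S.card := by
    rw [Expr.eval_sum]
    simp only [S, sweepSet]
    rw [Finset.card_filter]
    refine Finset.sum_congr rfl fun w _ => ?_
    rw [eval_sweep (w := w) (by simp [Expr.eval])]
    simp [hs3, hs2, hs1, c]
  set s4 := s3.setv 15 S.card with hs4
  have e16 : (Expr.sum 20 (.sum 21 (inside (.var 12) (.var 20) (.var 21)))).eval n (inputMat G) s4
      = nvol A Finset.univ := by
    rw [Expr.eval_sum]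
    refine Finset.sum_congr rfl fun w _ => ?_
    rw [Expr.eval_sum]
    refine Finset.sum_congr rfl fun z _ => ?_
    rw [eval_inside (u := w) (w := z) (by simp [Expr.eval]) (by simp [Expr.eval])]
    simp [Expr.eval, hs4, hs3, hs2, hs1, hA]
  set s5 := s4.setv 16 (nvol A Finset.univ) with hs5
  have e17 : (Expr.sum 20 (.ite (sweep (.var 20))
      (.sum 21 (inside (.var 12) (.var 20) (.var 21))) (.lit 0))).eval n (inputMat G) s5
      = nvol A S := by
    rw [Expr.eval_sum, nvol]
    simp only [S, sweepSet]
    rw [Finset.sum_filter]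
    refine Finset.sum_congr rfl fun w _ => ?_
    have h := eval_sweep_ne_zero (G := G) (a := .var 20) (s := s5.setv 20 w) (w := w)
      (by simp [Expr.eval])
    have h' : ((s5.setv 20 w).comp n w = (s5.setv 20 w).v 12 ∧
        (s5.setv 20 w).v 13 ≤ (s5.setv 20 w).val n w) ↔
        (s.comp n w = s.comp n u ∧ s.val n u ≤ s.val n w) := by
      simp [hs5, hs4, hs3, hs2, hs1, c]
    rw [h'] at h
    rw [Expr.eval_ite]
    by_cases hw : s.comp n w = s.comp n u ∧ s.val n u ≤ s.val n w
    · rw [if_neg (h.2 hw), if_pos hw, Expr.eval_sum]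
      refine Finset.sum_congr rfl fun z _ => ?_
      rw [eval_inside (u := w) (w := z) (by simp [Expr.eval]) (by simp [Expr.eval])]
      simp [Expr.eval, hs5, hs4, hs3, hs2, hs1, hA]
    · rw [if_pos (not_not.1 fun h' => hw (h.1 h')), if_neg hw]
      rfl
  set s6 := s5.setv 17 (nvol A S) with hs6
  have e18 : (Expr.sum 20 (.ite (sweep (.var 20))
      (.sum 21 (.ite (sweep (.var 21)) (.lit 0) (inside (.var 12) (.var 20) (.var 21))))
      (.lit 0))).eval n (inputMat G) s6 = ncut A S := by
    rw [Expr.eval_sum, ncut]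
    have hSc : Sᶜ = Finset.univ.filter fun w => ¬ (s.comp n w = s.comp n u ∧ s.val n u ≤ s.val n w) := by
      ext w; simp [S, sweepSet]
    rw [hSc]
    simp only [S, sweepSet]
    rw [Finset.sum_filter]
    refine Finset.sum_congr rfl fun w _ => ?_
    have h := eval_sweep_ne_zero (G := G) (a := .var 20) (s := s6.setv 20 w) (w := w)
      (by simp [Expr.eval])
    have h' : ((s6.setv 20 w).comp n w = (s6.setv 20 w).v 12 ∧
        (s6.setv 20 w).v 13 ≤ (s6.setv 20 w).val n w) ↔
        (s.comp n w = s.comp n u ∧ s.val n u ≤ s.val n w) := by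
      simp [hs6, hs5, hs4, hs3, hs2, hs1, c]
    rw [h'] at h
    rw [Expr.eval_ite]
    by_cases hw : s.comp n w = s.comp n u ∧ s.val n u ≤ s.val n w
    · rw [if_neg (h.2 hw), if_pos hw, Expr.eval_sum, Finset.sum_filter]
      refine Finset.sum_congr rfl fun z _ => ?_
      have k := eval_sweep_ne_zero (G := G) (a := .var 21) (s := (s6.setv 20 w).setv 21 z) (w := z)
        (by simp [Expr.eval])
      have k' : (((s6.setv 20 w).setv 21 z).comp n z = ((s6.setv 20 w).setv 21 z).v 12 ∧
          ((s6.setv 20 w).setv 21 z).v 13 ≤ ((s6.setv 20 w).setv 21 z).val n z) ↔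
          (s.comp n z = s.comp n u ∧ s.val n u ≤ s.val n z) := by
        simp [hs6, hs5, hs4, hs3, hs2, hs1, c]
      rw [k'] at k
      rw [Expr.eval_ite]
      by_cases hz : s.comp n z = s.comp n u ∧ s.val n u ≤ s.val n z
      · rw [if_neg (k.2 hz), if_neg (not_not.2 hz)]
        rfl
      · rw [if_pos (not_not.1 fun h' => hz (k.1 h')), if_pos hz,
          eval_inside (u := w) (w := z) (by simp [Expr.eval]) (by simp [Expr.eval])]
        simp [Expr.eval, hs6, hs5, hs4, hs3, hs2, hs1, hA]
    · rw [if_pos (not_not.1 fun h' => hw (h.1 h')), if_neg hw]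
      rfl
  set s7 := s6.setv 18 (ncut A S) with hs7
  have hsub : S ⊆ cluster (s.comp n) c := fun w hw => mem_cluster.2 (mem_sweepSet.1 hw).1
  have huS : u ∈ S := mem_sweepSet.2 ⟨rfl, le_rfl⟩
  have hcard := Finset.card_le_card hsub
  have hpos : 0 < (cluster (s.comp n) c).card := Finset.card_pos.2 ⟨u, hsub huS⟩
  have hvol : nvol A Finset.univ - nvol A S = nvol A Sᶜ := by
    have : nvol A Finset.univ = nvol A S + nvol A Sᶜ := (Finset.sum_add_sum_compl S _).symm
    omega
  have hcond : (Expr.and (.sub (.var 14) (.var 15)) (.or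
      (.and (.le (.var 18) (.div (.var 17) (.var 4)))
        (.le (.var 18) (.div (.sub (.var 16) (.var 17)) (.var 4))))
      (.le (.var 18) (.div (.div (.var 16) (.var 4)) (.var 14))))).eval n (inputMat G) s7 ≠ 0 ↔
      Splittable (s.v 4) (s.rest G) (s.comp n) c S := by
    rw [Expr.eval_and_ne_zero, Expr.eval_or_ne_zero, Expr.eval_and_ne_zero, Expr.eval_le,
      Expr.eval_le, Expr.eval_le]
    have hss : S ⊂ cluster (s.comp n) c ↔ (cluster (s.comp n) c).card - S.card ≠ 0 := by
      constructor
      · intro h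
        have := Finset.card_lt_card h
        omega
      · intro h
        refine Finset.ssubset_iff_subset_ne.2 ⟨hsub, fun h' => h ?_⟩
        rw [h']; simp
    unfold Splittable
    rw [hss, ← hA]
    simp only [Expr.eval, hs7, hs6, hs5, hs4, hs3, hs2, hs1, LState.setv_v]
    simp only [Nat.reduceEqDiff, if_true, if_false, ite_ne_right_iff, ne_eq, one_ne_zero,
      not_false_eq_true, and_true]
    rw [hvol, Nat.div_div_eq_div_mul, Nat.le_div_iff_mul_le hσ, Nat.le_div_iff_mul_le hσ,
      Nat.le_div_iff_mul_le (Nat.mul_pos hσ hpos), mul_comm (ncut A S), mul_comm (ncut A S)]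
    exact ⟨fun h => ⟨⟨u, huS⟩, h⟩, fun h => h.2⟩
  have hrun : s' = (Cmd.ite (.and (.sub (.var 14) (.var 15)) (.or
      (.and (.le (.var 18) (.div (.var 17) (.var 4)))
        (.le (.var 18) (.div (.sub (.var 16) (.var 17)) (.var 4))))
      (.le (.var 18) (.div (.div (.var 16) (.var 4)) (.var 14)))))
    (.seq (.fill 0 1 (.ite (sweep (.var 22)) (.var 7) (.get 1 (.var 22))))
      (.assign 7 (.add (.var 7) (.lit 1))))
    (.assign 19 (.lit 0))).run n (inputMat G) s7 := by
    simp only [s', check]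
    simp only [Cmd.run.eq_1, Cmd.run.eq_3, e12, ← hs1, e13, ← hs2, e14, ← hs3, e15, ← hs4, e16,
      ← hs5, e17, ← hs6, e18, ← hs7]
  rw [hrun, Cmd.run_ite]
  by_cases h : Splittable (s.v 4) (s.rest G) (s.comp n) c S
  · left
    rw [if_neg (hcond.2 h)]
    have hf := Cmd.run_fill (n := n) (inp := inputMat G) (b := 0) (r := 1)
      (e := .ite (sweep (.var 22)) (.var 7) (.get 1 (.var 22))) (by norm_num)
      (by decide) s7
    refine ⟨h, ?_, ?_⟩
    · funext v
      simp only [Cmd.run.eq_3, Cmd.run.eq_1, LState.comp_setv]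
      refine (hf.1 v v.2).trans ?_
      have k := eval_sweep_ne_zero (G := G) (a := .var 22) (s := s7.setv 22 v) (w := v)
        (by simp [Expr.eval])
      have k' : ((s7.setv 22 v).comp n v = (s7.setv 22 v).v 12 ∧
          (s7.setv 22 v).v 13 ≤ (s7.setv 22 v).val n v) ↔ v ∈ S := by
        rw [mem_sweepSet]
        simp [hs7, hs6, hs5, hs4, hs3, hs2, hs1, c]
      rw [k'] at k
      rw [Expr.eval_ite, splitOff]
      by_cases hv : v ∈ S
      · rw [if_neg (k.2 hv), if_pos hv]
        simp [Expr.eval, hs7, hs6, hs5, hs4, hs3, hs2, hs1]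
      · rw [if_pos (not_not.1 fun h' => hv (k.1 h')), if_neg hv]
        simp [Expr.eval, hs7, hs6, hs5, hs4, hs3, hs2, hs1, LState.comp]
    · simp only [Cmd.run.eq_3, Cmd.run.eq_1, Expr.eval, LState.setv_v, if_true]
      rw [Cmd.run_v_of_not_mem _ (by decide)]
      simp [hs7, hs6, hs5, hs4, hs3, hs2, hs1]
  · right
    rw [if_pos (not_not.1 fun h' => h (hcond.1 h'))]
    refine ⟨h, rfl, ?_⟩
    simp [Cmd.run, hs7, hs6, hs5, hs4, hs3, hs2, hs1]

lemma run_walk (s : LState) :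
    (walk.run n (inputMat G) s).val n = walkNat (s.rest G) (s.comp n) (s.val n) := by
  funext v
  have hf := Cmd.run_fill (n := n) (inp := inputMat G) (b := 0) (r := 2)
      (e := .div
        (.sum 21 (.ite (inside (.get 1 (.var 22)) (.var 22) (.var 21))
          (.add (.get 2 (.var 22)) (.get 2 (.var 21))) (.lit 0)))
        (.add (.sum 21 (inside (.get 1 (.var 22)) (.var 22) (.var 21)))
          (.sum 21 (inside (.get 1 (.var 22)) (.var 22) (.var 21))))) (by norm_num)
      (by decide) s
  refine (hf.1 v v.2).trans ?_
  have hin : ∀ w : Fin n, (inside (.get 1 (.var 22)) (.var 22) (.var 21)).eval n (inputMat G)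
      ((s.setv 22 v).setv 21 w) = clusterMat (s.rest G) (s.comp n) (s.comp n v) v w := by
    intro w
    rw [eval_inside (u := v) (w := w) (by simp [Expr.eval]) (by simp [Expr.eval])]
    simp [Expr.eval, LState.comp]
  have hsum : (Expr.sum 21 (inside (.get 1 (.var 22)) (.var 22) (.var 21))).eval n (inputMat G)
      (s.setv 22 v) = ∑ w, clusterMat (s.rest G) (s.comp n) (s.comp n v) v w := by
    rw [Expr.eval_sum]
    exact Finset.sum_congr rfl fun w _ => hin w
  rw [walkNat, Expr.eval, Expr.eval, hsum, two_mul, Expr.eval_sum]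
  congr 1
  refine Finset.sum_congr rfl fun w _ => ?_
  have h1 : clusterMat (s.rest G) (s.comp n) (s.comp n v) v w ≤ 1 := by
    unfold clusterMat
    split_ifs
    · exact labMat_le_one _ _ _ _
    · exact Nat.zero_le _
  rw [Expr.eval_ite]
  by_cases h0 : clusterMat (s.rest G) (s.comp n) (s.comp n v) v w = 0
  · rw [if_pos ((hin w).trans h0), h0, zero_mul]
    rfl
  · rw [if_neg (by rw [hin w]; exact h0), show clusterMat (s.rest G) (s.comp n) (s.comp n v) v w = 1
      by omega, one_mul]
    simp [Expr.eval, LState.val]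

end Program

end Checks


/-! ### The search for admissible splits -/

section Search

variable {n : ℕ} {G : SimpleGraph (Fin n)}

namespace Program

lemma sameFrame_run (c : Cmd) (h0 : 0 ∉ c.stored) (h4 : 4 ∉ c.assigned) (h5 : 5 ∉ c.assigned)
    (s : LState) : SameFrame s (c.run n (inputMat G) s) :=
  ⟨Cmd.run_a_of_not_mem c h0 s, Cmd.run_v_of_not_mem c h4 s, Cmd.run_v_of_not_mem c h5 s⟩

lemma SameFrame.trans {s s' s'' : LState} (h : SameFrame s s') (h' : SameFrame s' s'') :
    SameFrame s s'' :=
  ⟨h'.1.trans h.1, h'.2.1.trans h.2.1, h'.2.2.trans h.2.2⟩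

lemma SameFrame.setv {s s' : LState} (h : SameFrame s s') {x : ℕ} (h4 : x ≠ 4) (h5 : x ≠ 5)
    (k : ℕ) : SameFrame s (s'.setv x k) :=
  ⟨h.1, by simp [h4.symm, h.2.1], by simp [h5.symm, h.2.2]⟩

lemma SameFrame.refl (s : LState) : SameFrame s s := ⟨rfl, rfl, rfl⟩

/-- A part of the search for admissible splits, from the state `s` to the state `s'`: either all its
tests have failed and the partition is the same, or some test has succeeded and the number of
clusters is larger. -/
def Searched (G : SimpleGraph (Fin n)) {ι : Type*} (test done : ι → Prop)
    (s s' : LState) : Prop :=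
  SameFrame s s' ∧ PartitionInv (s.v 4) (s.rest G) (s'.comp n) (s'.v 7) ∧
    ((s'.comp n = s.comp n ∧ s'.v 7 = s.v 7 ∧ ∀ i, done i → ¬ test i) ∨
      (s.v 7 < s'.v 7 ∧ ∃ i, test i))

lemma rest_symm (s : LState) (hs : ∀ u w, G.Adj u w → s.lab n u w = s.lab n w u) :
    ∀ u w, s.rest G u w = s.rest G w u := labMat_symm hs 0

lemma run_checks {s : LState} (hσ : 0 < s.v 4)
    (hs : ∀ u w, s.rest G u w = s.rest G w u)
    (hP : PartitionInv (s.v 4) (s.rest G) (s.comp n) (s.v 7)) :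
    Searched G (fun u => Splittable (s.v 4) (s.rest G) (s.comp n) (s.comp n u)
        (sweepSet (s.comp n) (s.val n) u)) (fun _ => True) s
      ((Cmd.loop 0 11 check).run n (inputMat G) s) := by
  have := Cmd.run_loop (n := n) (inp := inputMat G) 0 11 check s
    (fun j s' => s'.a 2 = s.a 2 ∧
      Searched G (fun u => Splittable (s.v 4) (s.rest G) (s.comp n) (s.comp n u)
        (sweepSet (s.comp n) (s.val n) u)) (fun u => (u : ℕ) < j) s s')
    ⟨rfl, SameFrame.refl s, hP, Or.inl ⟨rfl, rfl, fun u hu => by simp at hu⟩⟩ ?_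
  · obtain ⟨-, h1, h2, h3⟩ := this
    refine ⟨h1, h2, h3.imp_left fun h => ⟨h.1, h.2.1, fun u _ => h.2.2 u u.2⟩⟩
  · rintro j hj s' ⟨ha, hfr, hP', hcase⟩
    have hfr' := hfr.setv (x := 11) (by norm_num) (by norm_num) j
    have hc := run_check (G := G) (s := s'.setv 11 j) (u := ⟨j, hj⟩) (by simp)
      (by rw [hfr'.2.1]; exact hσ)
    rw [hfr'.2.1, hfr'.rest] at hc
    simp only [LState.comp_setv, LState.val_setv, LState.setv_v] at hc
    rw [if_neg (by norm_num)] at hc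
    have hval : s'.val n = s.val n := by funext v; simp [LState.val, ha]
    refine ⟨?_, hfr'.trans (sameFrame_run check (by decide) (by decide) (by decide) _), ?_, ?_⟩
    · rw [Cmd.run_a_of_not_mem _ (by decide)]; exact ha
    · rcases hc with ⟨h1, h2, h3⟩ | ⟨h1, h2, h3⟩
      · rw [h2, h3]
        exact hP'.split hs h1
      · rw [h2, h3]
        exact hP'
    · rcases hcase with ⟨c1, c2, c3⟩ | ⟨c1, c2⟩
      · rw [c1, hval] at hc
        rcases hc with ⟨h1, h2, h3⟩ | ⟨h1, h2, h3⟩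
        · exact Or.inr ⟨by rw [h3]; omega, ⟨j, hj⟩, h1⟩
        · refine Or.inl ⟨h2, h3.trans c2, fun u hu => ?_⟩
          rcases Nat.lt_succ_iff_lt_or_eq.1 hu with h | h
          · exact c3 u h
          · rwa [show u = ⟨j, hj⟩ from Fin.ext h]
      · refine Or.inr ⟨?_, c2⟩
        rcases hc with ⟨h1, h2, h3⟩ | ⟨h1, h2, h3⟩ <;> rw [h3] <;> omega

/-- The test of the sweep at `u` after `i` steps of the walk from `z`. -/
def walkTest (G : SimpleGraph (Fin n)) (s : LState) (z : Fin n) (p : ℕ × Fin n) : Prop :=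
  p.1 < bigBound n ∧ Splittable (s.v 4) (s.rest G) (s.comp n) (s.comp n p.2)
    (sweepSet (s.comp n) ((walkNat (s.rest G) (s.comp n))^[p.1] (pointMass (s.v 5) z)) p.2)

lemma run_trial {s : LState} {z : Fin n} (hz : s.v 9 = z) (hσ : 0 < s.v 4)
    (hs : ∀ u w, s.rest G u w = s.rest G w u)
    (hP : PartitionInv (s.v 4) (s.rest G) (s.comp n) (s.v 7)) :
    Searched G (walkTest G s z) (fun _ => True) s (trial.run n (inputMat G) s) := by
  set s1 := (Cmd.fill 0 2 (.ite (.eq (.var 22) (.var 9)) (.var 5) (.lit 0))).run n (inputMat G) s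
    with hs1
  have hfr1 : SameFrame s s1 := sameFrame_run _ (by decide) (by decide) (by decide) s
  have hcomp1 : s1.comp n = s.comp n := by
    funext v
    simp only [LState.comp, hs1]
    rw [Cmd.run_a_of_not_mem _ (by decide)]
  have h71 : s1.v 7 = s.v 7 := Cmd.run_v_of_not_mem _ (by decide) s
  have hval1 : s1.val n = pointMass (s.v 5) z := by
    funext v
    refine ((Cmd.run_fill (n := n) (inp := inputMat G) (b := 0) (r := 2)
      (e := .ite (.eq (.var 22) (.var 9)) (.var 5) (.lit 0)) (by norm_num) (by decide) s).1 v
      v.2).trans ?_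
    rw [Expr.eval_ite, Expr.eval_eq, pointMass]
    simp only [Expr.eval, LState.setv_v]
    simp only [Nat.reduceEqDiff, if_true, if_false, hz]
    by_cases hv : v = z
    · simp [hv]
    · simp [hv, Fin.ext_iff.not.1 hv]
  have := Cmd.run_loop (n := n) (inp := inputMat G) 2 10 (.seq (.loop 0 11 check) walk) s1
    (fun j s' => Searched G (walkTest G s z) (fun p => p.1 < j) s s' ∧
      (s.v 7 < s'.v 7 ∨
        s'.val n = (walkNat (s.rest G) (s.comp n))^[j] (pointMass (s.v 5) z)))
    ⟨⟨hfr1, by rw [hcomp1, h71]; exact hP, Or.inl ⟨hcomp1, h71, fun u hu => by simp at hu⟩⟩,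
      Or.inr hval1⟩ ?_
  · obtain ⟨⟨h1, h2, h3⟩, -⟩ := this
    refine ⟨h1, h2, h3.imp_left fun h => ⟨h.1, h.2.1, fun p _ hp => h.2.2 p hp.1 hp⟩⟩
  · rintro j hj s' ⟨⟨hfr, hP', hcase⟩, hy⟩
    have hfr2 := hfr.setv (x := 10) (by norm_num) (by norm_num) j
    obtain ⟨k1, k2, k3⟩ := run_checks (G := G) (s := s'.setv 10 j) (by rw [hfr2.2.1]; exact hσ)
      (by rw [hfr2.rest]; exact hs) (by rw [hfr2.2.1, hfr2.rest]; simpa using hP')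
    set s2 := (Cmd.loop 0 11 check).run n (inputMat G) (s'.setv 10 j) with hs2
    rw [hfr2.2.1, hfr2.rest] at k2
    rw [hfr2.2.1, hfr2.rest] at k3
    simp only [LState.comp_setv, LState.val_setv, LState.setv_v] at k3
    rw [if_neg (by norm_num)] at k3
    have hfr3 := hfr2.trans k1
    have hrun : (Cmd.seq (.loop 0 11 check) walk).run n (inputMat G) (s'.setv 10 j)
        = walk.run n (inputMat G) s2 := rfl
    rw [hrun]
    set s3 := walk.run n (inputMat G) s2 with hs3
    have hfr4 : SameFrame s2 s3 := sameFrame_run _ (by decide) (by decide) (by decide) _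
    have hcomp3 : s3.comp n = s2.comp n := by
      funext v
      simp only [LState.comp, hs3]
      rw [Cmd.run_a_of_not_mem _ (by decide)]
    have h73 : s3.v 7 = s2.v 7 := Cmd.run_v_of_not_mem _ (by decide) _
    have hval2 : s2.val n = s'.val n := by
      funext v
      simp only [LState.val, hs2]
      rw [Cmd.run_a_of_not_mem _ (by decide)]
      rfl
    have hval3 : s3.val n = walkNat (s.rest G) (s2.comp n) (s'.val n) := by
      rw [hs3, run_walk, hfr3.rest, hval2]
    refine ⟨⟨hfr3.trans hfr4, by rw [hcomp3, h73]; exact k2, ?_⟩, ?_⟩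
    · rw [hcomp3, h73]
      rcases hcase with ⟨c1, c2, c3⟩ | ⟨c1, c2⟩
      · have hy' := hy.resolve_left (by omega)
        rw [c1, hy'] at k3
        rcases k3 with ⟨d1, d2, d3⟩ | ⟨d1, u, d2⟩
        · refine Or.inl ⟨d1, d2.trans c2, fun p hp => ?_⟩
          rcases Nat.lt_succ_iff_lt_or_eq.1 hp with h | h
          · exact c3 p h
          · intro ht
            refine d3 p.2 trivial ?_
            rw [← h]; exact ht.2
        · exact Or.inr ⟨by omega, (j, u), hj, d2⟩
      · refine Or.inr ⟨?_, c2⟩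
        rcases k3 with ⟨d1, d2, d3⟩ | ⟨d1, -⟩ <;> omega
    · rw [h73]
      by_cases hlt : s.v 7 < s2.v 7
      · exact Or.inl hlt
      right
      rcases hcase with ⟨c1, c2, c3⟩ | ⟨c1, c2⟩
      · rcases k3 with ⟨d1, d2, d3⟩ | ⟨d1, -⟩
        · rw [hval3, d1, c1, hy.resolve_left (by omega), Function.iterate_succ_apply']
        · omega
      · rcases k3 with ⟨d1, d2, d3⟩ | ⟨d1, -⟩ <;> omega

/-- The stability of the partition in a state of the program. -/
def StableState (G : SimpleGraph (Fin n)) (s : LState) : Prop :=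
  Stable (s.v 4) (s.v 5) (bigBound n) (s.rest G) (s.comp n)

lemma run_pass {s : LState} (hσ : 0 < s.v 4)
    (hs : ∀ u w, s.rest G u w = s.rest G w u)
    (hP : PartitionInv (s.v 4) (s.rest G) (s.comp n) (s.v 7)) :
    let s' := pass.run n (inputMat G) s
    SameFrame s s' ∧ PartitionInv (s.v 4) (s.rest G) (s'.comp n) (s'.v 7) ∧
      ((s'.v 7 = s.v 7 ∧ StableState G s') ∨ (s.v 7 < s'.v 7 ∧ ¬ StableState G s)) := by
  intro s'
  have := Cmd.run_loop (n := n) (inp := inputMat G) 0 9 trial s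
    (fun j s' => Searched G (fun p : Fin n × (ℕ × Fin n) => walkTest G s p.1 p.2)
      (fun p => (p.1 : ℕ) < j) s s')
    ⟨SameFrame.refl s, hP, Or.inl ⟨rfl, rfl, fun u hu => by simp at hu⟩⟩ ?_
  · obtain ⟨h1, h2, h3⟩ := this
    change SameFrame s s' at h1
    refine ⟨h1, h2, ?_⟩
    rcases h3 with ⟨c1, c2, c3⟩ | ⟨c1, ⟨z, i, u⟩, hi, hsp⟩
    · refine Or.inl ⟨c2, fun z i hi u hsp => ?_⟩
      rw [h1.2.1, h1.2.2, h1.rest] at hsp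
      rw [show s'.comp n = s.comp n from c1] at hsp
      exact c3 (z, i, u) z.2 ⟨hi, hsp⟩
    · exact Or.inr ⟨c1, fun hst => hst z i hi u hsp⟩
  · rintro j hj s1 ⟨hfr, hP', hcase⟩
    have hfr2 := hfr.setv (x := 9) (by norm_num) (by norm_num) j
    obtain ⟨k1, k2, k3⟩ := run_trial (G := G) (s := s1.setv 9 j) (z := ⟨j, hj⟩) (by simp)
      (by rw [hfr2.2.1]; exact hσ)
      (by rw [hfr2.rest]; exact hs) (by rw [hfr2.2.1, hfr2.rest]; simpa using hP')
    rw [hfr2.2.1, hfr2.rest] at k2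
    simp only [walkTest] at k3
    rw [hfr2.2.1, hfr2.2.2, hfr2.rest] at k3
    simp only [LState.comp_setv, LState.setv_v] at k3
    rw [if_neg (by norm_num)] at k3
    refine ⟨hfr2.trans k1, k2, ?_⟩
    rcases hcase with ⟨c1, c2, c3⟩ | ⟨c1, c2⟩
    · rw [c1] at k3
      rcases k3 with ⟨d1, d2, d3⟩ | ⟨d1, p, d2⟩
      · refine Or.inl ⟨d1, d2.trans c2, fun p hp => ?_⟩
        rcases Nat.lt_succ_iff_lt_or_eq.1 hp with h | h
        · exact c3 p h
        · change ¬ walkTest G s p.1 p.2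
          rw [show p.1 = ⟨j, hj⟩ from Fin.ext h]
          exact d3 p.2 trivial
      · exact Or.inr ⟨by omega, (⟨j, hj⟩, p), d2⟩
    · refine Or.inr ⟨?_, c2⟩
      rcases k3 with ⟨d1, d2, d3⟩ | ⟨d1, -⟩ <;> omega

/-- The passes end with a stable partition: every pass that finds a split increases the number of
clusters, so that there are at most `n` of them. -/
lemma run_passes {s : LState} (hσ : 0 < s.v 4)
    (hs : ∀ u w, s.rest G u w = s.rest G w u)
    (hP : PartitionInv (s.v 4) (s.rest G) (s.comp n) (s.v 7)) :
    let s' := (Cmd.loop 2 8 pass).run n (inputMat G) s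
    SameFrame s s' ∧ PartitionInv (s.v 4) (s.rest G) (s'.comp n) (s'.v 7) ∧
      (0 < n → StableState G s') := by
  intro s'
  have := Cmd.run_loop (n := n) (inp := inputMat G) 2 8 pass s
    (fun j s' => SameFrame s s' ∧ PartitionInv (s.v 4) (s.rest G) (s'.comp n) (s'.v 7) ∧
      (StableState G s' ∨ j ≤ s'.v 7)) ⟨SameFrame.refl s, hP, Or.inr (by omega)⟩ ?_
  · obtain ⟨h1, h2, h3⟩ := this
    refine ⟨h1, h2, fun hn => h3.resolve_right fun h => ?_⟩
    have h4 := h2.cnt_le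
    rw [Fintype.card_fin] at h4
    have : n < bigBound n := by
      unfold bigBound
      have h5 : n * 1 ≤ n * (n * n) := Nat.mul_le_mul_left n (Nat.mul_pos hn hn)
      have h6 : 4194304 * n * n * n = 4194304 * (n * (n * n)) := by ring
      omega
    have h7 : loopBound n 2 = bigBound n := rfl
    omega
  · rintro j hj s1 ⟨hfr, hP', hcase⟩
    have hfr2 := hfr.setv (x := 8) (by norm_num) (by norm_num) j
    obtain ⟨k1, k2, k3⟩ := run_pass (G := G) (s := s1.setv 8 j) (by rw [hfr2.2.1]; exact hσ)
      (by rw [hfr2.rest]; exact hs) (by rw [hfr2.2.1, hfr2.rest]; simpa using hP')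
    rw [hfr2.2.1, hfr2.rest] at k2
    refine ⟨hfr2.trans k1, k2, ?_⟩
    rcases k3 with ⟨d1, d2⟩ | ⟨d1, d2⟩
    · exact Or.inl d2
    · have d1' : s1.v 7 < (pass.run n (inputMat G) (s1.setv 8 j)).v 7 := by simpa using d1
      have d2' : ¬ StableState G s1 := by simpa [StableState] using d2
      have := hcase.resolve_left d2'
      exact Or.inr (by omega)

end Program

end Search


/-! ### Stable partitions are good -/

section Stable

variable {V : Type*}

lemma clusterMat_eq_zero_left {F : V → V → ℕ} {comp : V → ℕ} {c : ℕ} {u : V} (hu : comp u ≠ c)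
    (w : V) : clusterMat F comp c u w = 0 := if_neg fun h => hu h.1

lemma clusterMat_eq_zero_right {F : V → V → ℕ} {comp : V → ℕ} {c : ℕ} {w : V} (hw : comp w ≠ c)
    (u : V) : clusterMat F comp c u w = 0 := if_neg fun h => hw h.2

variable [Fintype V]

lemma wdeg_realMat (A : V → V → ℕ) (u : V) : wdeg (realMat A) u = (∑ w, A u w : ℕ) := by
  simp [wdeg, realMat]

/-- The rounding of the walk costs at most one. -/
lemma walkNat_le_walk {F : V → V → ℕ} {comp : V → ℕ} {c : ℕ} (y : V → ℕ) {u : V} (hu : comp u = c)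
    (hd : 0 < wdeg (realMat (clusterMat F comp c)) u) :
    (walkNat F comp y u : ℝ) ≤ walk (realMat (clusterMat F comp c)) (fun w => (y w : ℝ)) u ∧
      walk (realMat (clusterMat F comp c)) (fun w => (y w : ℝ)) u ≤ walkNat F comp y u + 1 := by
  rw [wdeg_realMat] at hd
  rw [walkNat, hu, walk, wdeg_realMat]
  have hnum : ∑ w, realMat (clusterMat F comp c) u w * ((y u : ℝ) + y w)
      = (∑ w, clusterMat F comp c u w * (y u + y w) : ℕ) := by
    push_cast
    rfl
  rw [hnum]
  set a := ∑ w, clusterMat F comp c u w * (y u + y w) with ha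
  set b := ∑ w, clusterMat F comp c u w with hb
  have hb0 : 0 < b := by exact_mod_cast hd
  have e : 2 * (b : ℝ) = (2 * b : ℕ) := by push_cast; ring
  rw [e]
  have h2 : (0 : ℝ) < (2 * b : ℕ) := by exact_mod_cast (by omega : 0 < 2 * b)
  refine ⟨Nat.cast_div_le, ?_⟩
  rw [div_le_iff₀ h2]
  have h3 : a ≤ (a / (2 * b) + 1) * (2 * b) := by
    have := Nat.lt_div_mul_add (a := a) (b := 2 * b) (by omega)
    rw [Nat.add_mul, one_mul]
    exact this.le
  exact_mod_cast h3

variable [DecidableEq V]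

lemma nvol_inter_cluster (F : V → V → ℕ) (comp : V → ℕ) (c : ℕ) (T : Finset V) :
    nvol (clusterMat F comp c) (T ∩ cluster comp c) = nvol (clusterMat F comp c) T := by
  refine Finset.sum_subset Finset.inter_subset_left fun u hu hu' => ?_
  refine Finset.sum_eq_zero fun w _ => clusterMat_eq_zero_left (fun h => hu' ?_) w
  exact Finset.mem_inter.2 ⟨hu, mem_cluster.2 h⟩

lemma nvol_inter_cluster_compl (F : V → V → ℕ) (comp : V → ℕ) (c : ℕ) (T : Finset V) :
    nvol (clusterMat F comp c) (T ∩ cluster comp c)ᶜ = nvol (clusterMat F comp c) Tᶜ := by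
  symm
  refine Finset.sum_subset (Finset.compl_subset_compl.2 Finset.inter_subset_left)
    fun u hu hu' => ?_
  refine Finset.sum_eq_zero fun w _ => clusterMat_eq_zero_left (fun h => ?_) w
  rw [Finset.mem_compl, not_not] at hu'
  exact Finset.mem_compl.1 hu (Finset.mem_inter.2 ⟨hu', mem_cluster.2 h⟩)

lemma ncut_inter_cluster (F : V → V → ℕ) (comp : V → ℕ) (c : ℕ) (T : Finset V) :
    ncut (clusterMat F comp c) (T ∩ cluster comp c) = ncut (clusterMat F comp c) T := by
  have h1 : ∀ u, ∑ w ∈ (T ∩ cluster comp c)ᶜ, clusterMat F comp c u w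
      = ∑ w ∈ Tᶜ, clusterMat F comp c u w := by
    intro u
    symm
    refine Finset.sum_subset (Finset.compl_subset_compl.2 Finset.inter_subset_left)
      fun w hw hw' => clusterMat_eq_zero_right (fun h => ?_) u
    rw [Finset.mem_compl, not_not] at hw'
    exact Finset.mem_compl.1 hw (Finset.mem_inter.2 ⟨hw', mem_cluster.2 h⟩)
  unfold ncut
  simp only [h1]
  refine Finset.sum_subset Finset.inter_subset_left fun u hu hu' => ?_
  refine Finset.sum_eq_zero fun w _ => clusterMat_eq_zero_left (fun h => hu' ?_) w
  exact Finset.mem_inter.2 ⟨hu, mem_cluster.2 h⟩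

/-- A sweep that is not an admissible split certifies expansion of the level sets of the walk. The
values outside the cluster are irrelevant; they are set to the value at a vertex of the cluster. -/
lemma sweepsExpand_of_not_splittable {σ : ℕ} (hσ : 0 < σ) {F : V → V → ℕ} {comp y : V → ℕ} (s : V)
    (h : ∀ u, ¬ Splittable σ F comp (comp u) (sweepSet comp y u)) :
    SweepsExpand (realMat (clusterMat F comp (comp s))) (1 / (σ : ℝ))
      fun u => if comp u = comp s then (y u : ℝ) else y s := by
  set x : V → ℝ := fun u => if comp u = comp s then (y u : ℝ) else y s with hx
  have hσR : (0 : ℝ) < σ := by exact_mod_cast hσ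
  have key : ∀ u, comp u = comp s → 1 / (σ : ℝ) *
      min (wvol (realMat (clusterMat F comp (comp s))) (Finset.univ.filter fun w => x u ≤ x w))
        (wvol (realMat (clusterMat F comp (comp s))) (Finset.univ.filter fun w => x u ≤ x w)ᶜ)
      ≤ wcut (realMat (clusterMat F comp (comp s))) (Finset.univ.filter fun w => x u ≤ x w) := by
    intro u hu
    have hT : (Finset.univ.filter fun w => x u ≤ x w) ∩ cluster comp (comp s)
        = sweepSet comp y u := by
      ext w
      rw [Finset.mem_inter, mem_cluster, mem_sweepSet, Finset.mem_filter, hu]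
      constructor
      · rintro ⟨⟨-, h1⟩, h2⟩
        simp only [hx, hu, h2, if_true] at h1
        exact ⟨h2, by exact_mod_cast h1⟩
      · rintro ⟨h1, h2⟩
        refine ⟨⟨Finset.mem_univ _, ?_⟩, h1⟩
        simp only [hx, hu, h1, if_true]
        exact_mod_cast h2
    have hn := h u
    rw [hu] at hn
    have := min_le_of_not_splittable (S := sweepSet comp y u) (c := comp s)
      (fun w hw => mem_cluster.2 ((mem_sweepSet.1 hw).1.trans hu)) hn
    rw [wvol_realMat, wvol_realMat, wcut_realMat, ← nvol_inter_cluster F comp,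
      ← nvol_inter_cluster_compl F comp, ← ncut_inter_cluster F comp, hT, div_mul_eq_mul_div,
      one_mul, div_le_iff₀ hσR, mul_comm]
    exact_mod_cast this
  intro u
  by_cases hu : comp u = comp s
  · exact key u hu
  · have hxu : x u = x s := by simp [hx, hu]
    rw [hxu]
    exact key s rfl

/-- If no sweep of the walks is an admissible split, then the clusters are expanders: otherwise the
walk from some vertex of a sparse set would stay there for longer than it takes to mix. -/
lemma goodPartition_of_stable {n κ t : ℕ} (hn : Fintype.card V = n) (hn0 : 0 < n)
    {F : V → V → ℕ} (hs : ∀ u w, F u w = F w u) (hF : ∀ u w, F u w ≤ 1) (hF0 : ∀ v, F v v = 0)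
    (hκ : Real.log n ≤ κ) (hκ4 : 4 ≤ κ) (hκn : κ ≤ 5 * n) (ht : 18144 * κ ^ 3 ≤ t)
    {comp : V → ℕ} {cnt : ℕ} (hP : PartitionInv (18 * κ) F comp cnt)
    (hstab : Stable (18 * κ) (16777216 * n ^ 5) t F comp) :
    GoodPartition (1 / (36288 * (κ : ℝ) ^ 3)) (18 * κ) F comp := by
  set M := 16777216 * n ^ 5 with hM
  have hM0 : 0 < M := by positivity
  have hκ0 : (0 : ℝ) < κ := by exact_mod_cast (by omega : 0 < κ)
  have ht0 : 0 < t := lt_of_lt_of_le (by positivity) ht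
  have hnR : (0 : ℝ) < n := by exact_mod_cast hn0
  have hκnR : (κ : ℝ) ≤ 5 * n := by exact_mod_cast hκn
  refine ⟨fun v => (hP.lt v).trans_le hP.cnt_le, hP.crossing_le hF ?_ (by omega),
    fun c S _ => ?_, fun c v hv => ?_⟩
  · rw [hn]; push_cast; linarith
  · set A := realMat (clusterMat F comp c) with hA
    have hA0 : ∀ u w, 0 ≤ A u w := fun u w => Nat.cast_nonneg _
    have hAs : ∀ u w, A u w = A w u := fun u w => by
      simp only [hA, realMat, clusterMat, hs w u, and_comm]
    have hcl : ∀ u, 0 < wdeg A u → comp u = c := by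
      intro u hu
      by_contra hne
      have : wdeg A u = 0 := Finset.sum_eq_zero fun w _ => by
        simp [hA, realMat, clusterMat_eq_zero_left hne w]
      linarith
    have key := cut_ge_of_walks (A := A) hAs hA0 (N := (n : ℝ) ^ 2) (ε := 1 / ((18 * κ : ℕ) : ℝ))
      (δ := 1 / (1296 * (κ : ℝ) ^ 2)) (M := (M : ℝ)) (t := 18144 * κ ^ 3) ?_ ?_ ?_ ?_ ?_ ?_ ?_ ?_ ?_
      (fun s j u => ((walkNat F comp)^[j] (pointMass M s) u : ℝ)) ?_ ?_ ?_ ?_ S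
    · rw [wvol_realMat, wvol_realMat, wcut_realMat] at key
      rw [div_mul_eq_mul_div, one_mul, div_le_iff₀ (by positivity)]
      calc _ ≤ _ := key
        _ = _ := by push_cast; ring
    · intro u hu
      rw [wdeg_realMat] at hu ⊢
      exact_mod_cast hu
    · rw [wvol_realMat]
      have : nvol (clusterMat F comp c) Finset.univ ≤ n ^ 2 := by
        calc nvol (clusterMat F comp c) Finset.univ ≤ ∑ _u : V, ∑ _w : V, 1 := by
              refine Finset.sum_le_sum fun u _ => Finset.sum_le_sum fun w _ => ?_
              unfold clusterMat
              split_ifs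
              · exact hF u w
              · omega
          _ = n ^ 2 := by simp [hn, sq]
      exact_mod_cast this
    · positivity
    · rw [div_le_one (by positivity)]
      exact_mod_cast (by omega : 1 ≤ 18 * κ)
    · push_cast; field_simp; norm_num
    · exact_mod_cast hM0
    · -- `(1 - δ / 2) ^ t ≤ exp (- 7 κ)`, and `32 N ^ 3 ≤ exp (κ + 6 log n)`
      have hδ2 : 1 / (1296 * (κ : ℝ) ^ 2) / 2 ≤ 1 := by
        rw [div_div, div_le_one (by positivity)]
        have : (4 : ℝ) ≤ κ := by exact_mod_cast hκ4
        nlinarith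
      have h1 : (1 - 1 / (1296 * (κ : ℝ) ^ 2) / 2) ^ (18144 * κ ^ 3) ≤ Real.exp (-(7 * κ)) := by
        calc (1 - 1 / (1296 * (κ : ℝ) ^ 2) / 2) ^ (18144 * κ ^ 3)
            ≤ Real.exp (-(1 / (1296 * (κ : ℝ) ^ 2) / 2)) ^ (18144 * κ ^ 3) := by
              refine pow_le_pow_left₀ (by linarith) ?_ _
              linarith [Real.add_one_le_exp (-(1 / (1296 * (κ : ℝ) ^ 2) / 2))]
          _ = Real.exp (-(7 * κ)) := by
              rw [← Real.exp_nat_mul]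
              congr 1
              push_cast
              field_simp
              norm_num
      have h2 : (32 : ℝ) ≤ Real.exp κ := by
        have h3 : (2.7 : ℝ) ^ 4 ≤ Real.exp 4 := by
          rw [show (4 : ℝ) = (4 : ℕ) * 1 by norm_num, Real.exp_nat_mul]
          exact pow_le_pow_left₀ (by norm_num) (by linarith [Real.exp_one_gt_d9]) _
        have h4 : Real.exp 4 ≤ Real.exp κ := Real.exp_le_exp.2 (by exact_mod_cast hκ4)
        norm_num at h3
        linarith
      have h3 : ((n : ℝ) ^ 2) ^ 3 ≤ Real.exp (6 * κ) := by
        calc ((n : ℝ) ^ 2) ^ 3 = Real.exp (Real.log n) ^ 6 := by rw [Real.exp_log hnR]; ring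
          _ ≤ Real.exp κ ^ 6 := pow_le_pow_left₀ (Real.exp_pos _).le (Real.exp_le_exp.2 hκ) _
          _ = Real.exp (6 * κ) := by rw [← Real.exp_nat_mul]; norm_num
      calc 32 * ((n : ℝ) ^ 2) ^ 3 * (1 - 1 / (1296 * (κ : ℝ) ^ 2) / 2) ^ (18144 * κ ^ 3)
          ≤ Real.exp κ * Real.exp (6 * κ) * Real.exp (-(7 * κ)) := by
            gcongr
        _ = 1 := by rw [← Real.exp_add, ← Real.exp_add]; simp; ring
    · have e1 : 64 * ((n : ℝ) ^ 2) ^ 3 * (1 + 2 / (1 / (1296 * (κ : ℝ) ^ 2)))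
          = 64 * (n : ℝ) ^ 6 * (1 + 2592 * (κ : ℝ) ^ 2) := by
        field_simp; ring
      have hκ1 : (1 : ℝ) ≤ (κ : ℝ) ^ 2 := by
        have : (4 : ℝ) ≤ κ := by exact_mod_cast hκ4
        nlinarith
      have hκ2 : (κ : ℝ) ^ 2 ≤ 25 * (n : ℝ) ^ 2 := by nlinarith
      rw [e1, div_mul_eq_mul_div, one_mul, le_div_iff₀ (by positivity), hM]
      calc 64 * (n : ℝ) ^ 6 * (1 + 2592 * (κ : ℝ) ^ 2) * (1296 * (κ : ℝ) ^ 2)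
          ≤ 64 * (n : ℝ) ^ 6 * ((κ : ℝ) ^ 2 + 2592 * (κ : ℝ) ^ 2) * (1296 * (κ : ℝ) ^ 2) := by
            gcongr
        _ ≤ 64 * (n : ℝ) ^ 6 * (2593 * (25 * (n : ℝ) ^ 2)) * (1296 * (25 * (n : ℝ) ^ 2)) := by
            rw [show (κ : ℝ) ^ 2 + 2592 * (κ : ℝ) ^ 2 = 2593 * (κ : ℝ) ^ 2 by ring]
            gcongr
        _ ≤ ((16777216 * n ^ 5 : ℕ) : ℝ) ^ 2 := by
            push_cast
            have : (0 : ℝ) ≤ (n : ℝ) ^ 10 := by positivity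
            nlinarith
    · rw [hM]
      push_cast
      have hκ3 : (κ : ℝ) ^ 3 ≤ 125 * (n : ℝ) ^ 3 := by
        calc (κ : ℝ) ^ 3 ≤ (5 * n) ^ 3 := pow_le_pow_left₀ hκ0.le hκnR _
          _ = _ := by ring
      calc 4 * (n : ℝ) ^ 2 * (18144 * (κ : ℝ) ^ 3)
          ≤ 4 * (n : ℝ) ^ 2 * (18144 * (125 * (n : ℝ) ^ 3)) := by gcongr
        _ ≤ 16777216 * (n : ℝ) ^ 5 := by
            have : (0 : ℝ) ≤ (n : ℝ) ^ 5 := by positivity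
            nlinarith
    · intro s u
      simp [pointMass]
    · intro s j u
      positivity
    · intro s j u hu
      rw [Function.iterate_succ_apply']
      exact walkNat_le_walk _ (hcl u hu) hu
    · intro s hsd j hj
      have hsc := hcl s hsd
      refine ⟨_, fun u hu => ?_, hA ▸ hsc ▸ sweepsExpand_of_not_splittable (by omega) s
        fun u => hstab s j (hj.trans_le ht) u⟩
      rw [if_pos (hsc ▸ hcl u hu)]
  · have hc : comp v = c := mem_cluster.1 hv
    refine regular_of_not_splittable hF0 hv ?_
    have hS : sweepSet comp ((walkNat F comp)^[0] (pointMass M v)) v = {v} := by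
      ext w
      rw [mem_sweepSet, Finset.mem_singleton]
      simp only [Function.iterate_zero, id, pointMass, if_true]
      constructor
      · rintro ⟨-, h⟩
        by_contra hne
        rw [if_neg hne] at h
        omega
      · rintro rfl; simp
    rw [← hS, ← hc]
    exact hstab v 0 ht0 v

end Stable


/-! ### The levels -/

/-- An integer close to `log n`, computed from a harmonic sum. -/
def logNat (n : ℕ) : ℕ := (∑ j : Fin n, n / ((j : ℕ) + 1)) / n + 4

lemma four_le_logNat (n : ℕ) : 4 ≤ logNat n := Nat.le_add_left 4 _

lemma harmonic_cast (n : ℕ) : ((harmonic n : ℚ) : ℝ) = ∑ j : Fin n, 1 / (((j : ℕ) : ℝ) + 1) := by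
  rw [harmonic, Finset.sum_range]
  push_cast
  exact Finset.sum_congr rfl fun j _ => by rw [one_div]

lemma log_le_logNat {n : ℕ} (hn : 0 < n) : Real.log n ≤ logNat n := by
  have hnR : (0 : ℝ) < n := by exact_mod_cast hn
  have h1 : Real.log n ≤ (harmonic n : ℚ) := by
    refine le_trans (Real.log_le_log hnR ?_) (log_add_one_le_harmonic n)
    push_cast; linarith
  rw [harmonic_cast] at h1
  set m := ∑ j : Fin n, n / ((j : ℕ) + 1) with hm
  have h2 : (n : ℝ) * ∑ j : Fin n, 1 / (((j : ℕ) : ℝ) + 1) ≤ m + n := by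
    have : ∀ j : Fin n, (n : ℝ) * (1 / (((j : ℕ) : ℝ) + 1)) ≤ (n / ((j : ℕ) + 1) : ℕ) + 1 := by
      intro j
      rw [mul_one_div, div_le_iff₀ (by positivity)]
      have h3 : n ≤ (n / ((j : ℕ) + 1) + 1) * ((j : ℕ) + 1) := by
        have := Nat.lt_div_mul_add (a := n) (b := (j : ℕ) + 1) (by omega)
        rw [Nat.add_mul, one_mul]
        exact this.le
      exact_mod_cast h3
    calc (n : ℝ) * ∑ j : Fin n, 1 / (((j : ℕ) : ℝ) + 1)
        = ∑ j : Fin n, (n : ℝ) * (1 / (((j : ℕ) : ℝ) + 1)) := Finset.mul_sum _ _ _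
      _ ≤ ∑ j : Fin n, (((n / ((j : ℕ) + 1) : ℕ) : ℝ) + 1) := Finset.sum_le_sum fun j _ => this j
      _ = m + n := by rw [Finset.sum_add_distrib, hm]; push_cast; simp
  have h4 : (m : ℝ) ≤ n * ((m / n : ℕ) + 1) := by
    have := Nat.lt_div_mul_add (a := m) hn
    have : m ≤ n * (m / n + 1) := by rw [mul_comm, Nat.add_mul, one_mul]; exact this.le
    exact_mod_cast this
  have h5 : (n : ℝ) * ∑ j : Fin n, 1 / (((j : ℕ) : ℝ) + 1) ≤ n * ((m / n : ℕ) + 2) := by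
    linarith
  have h6 := le_of_mul_le_mul_left h5 hnR
  rw [logNat, ← hm]
  push_cast at h6 ⊢
  linarith

lemma logNat_le {n : ℕ} (hn : 0 < n) : (logNat n : ℝ) ≤ Real.log n + 5 := by
  have hnR : (0 : ℝ) < n := by exact_mod_cast hn
  have h1 := harmonic_le_one_add_log n
  rw [harmonic_cast] at h1
  have h2 : ((∑ j : Fin n, n / ((j : ℕ) + 1) : ℕ) : ℝ)
      ≤ n * ∑ j : Fin n, 1 / (((j : ℕ) : ℝ) + 1) := by
    push_cast
    rw [Finset.mul_sum]
    refine Finset.sum_le_sum fun j _ => ?_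
    rw [mul_one_div]
    refine Nat.cast_div_le.trans_eq ?_
    push_cast; rfl
  have h3 : (((∑ j : Fin n, n / ((j : ℕ) + 1)) / n : ℕ) : ℝ)
      ≤ ∑ j : Fin n, 1 / (((j : ℕ) : ℝ) + 1) := by
    refine Nat.cast_div_le.trans ?_
    rw [div_le_iff₀ hnR]
    linarith
  rw [logNat]
  push_cast at h3 ⊢
  linarith

lemma logNat_le_mul {n : ℕ} (hn : 0 < n) : logNat n ≤ 5 * n := by
  have h1 := logNat_le hn
  have h2 := Real.log_le_sub_one_of_pos (x := n) (by exact_mod_cast hn)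
  have h3 : (1 : ℝ) ≤ n := by exact_mod_cast hn
  have : (logNat n : ℝ) ≤ 5 * n := by linarith
  exact_mod_cast this

lemma sq_lt_two_pow_logNat {n : ℕ} (hn : 0 < n) : n * n < 2 ^ (3 * logNat n) := by
  have hnR : (0 : ℝ) < n := by exact_mod_cast hn
  have h4 : (4 : ℝ) ≤ logNat n := by exact_mod_cast four_le_logNat n
  have : Real.log ((n : ℝ) * n) < Real.log ((2 : ℝ) ^ (3 * logNat n)) := by
    rw [Real.log_mul hnR.ne' hnR.ne', Real.log_pow]
    push_cast
    have := log_le_logNat hn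
    nlinarith [Real.log_two_gt_d9]
  have := (Real.log_lt_log_iff (by positivity) (by positivity)).1 this
  exact_mod_cast this

section Levels

variable {n : ℕ} {G : SimpleGraph (Fin n)}

namespace Program

lemma run_relabel (s : LState) : (relabel.run n (inputMat G) s).lab n
    = EdgeOrientation.relabel (s.lab n) (s.v 6) (s.comp n) := by
  funext u w
  refine ((Cmd.run_fill (n := n) (inp := inputMat G) (b := 1) (r := 0)
      (e := .ite (.and (.eq (.get 0 (.var 22)) (.lit 0))
        (.eq (.get 1 (.div (.var 22) (.muln (.lit 1))))
          (.get 1 (.sub (.var 22) (.muln (.div (.var 22) (.muln (.lit 1))))))))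
        (.add (.add (.muln (.var 6)) (.get 1 (.div (.var 22) (.muln (.lit 1))))) (.lit 1))
        (.get 0 (.var 22))) (by norm_num) (by decide) s).1 ((u : ℕ) * n + w)
      (cell_lt u w)).trans ?_
  set s1 := s.setv 22 ((u : ℕ) * n + w) with hs1
  have e1 : (Expr.get 1 (.div (.var 22) (.muln (.lit 1)))).eval n (inputMat G) s1
      = s.comp n u := by
    simp [Expr.eval, hs1, cell_div, LState.comp]
  have e2 : (Expr.get 1 (.sub (.var 22) (.muln (.div (.var 22) (.muln (.lit 1)))))).eval n
      (inputMat G) s1 = s.comp n w := by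
    simp [Expr.eval, hs1, cell_div, LState.comp]
  have e3 : (Expr.get 0 (.var 22)).eval n (inputMat G) s1 = s.lab n u w := by
    simp [Expr.eval, hs1, LState.lab]
  have hc : (Expr.and (.eq (.get 0 (.var 22)) (.lit 0))
        (.eq (.get 1 (.div (.var 22) (.muln (.lit 1))))
          (.get 1 (.sub (.var 22) (.muln (.div (.var 22) (.muln (.lit 1)))))))).eval n
      (inputMat G) s1 ≠ 0 ↔ s.lab n u w = 0 ∧ s.comp n u = s.comp n w := by
    rw [Expr.eval_and_ne_zero, Expr.eval_eq, Expr.eval_eq, e1, e2, e3]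
    by_cases h : s.lab n u w = 0 <;> simp [Expr.eval, h]
  rw [Expr.eval_ite, EdgeOrientation.relabel]
  by_cases h : s.lab n u w = 0 ∧ s.comp n u = s.comp n w
  · rw [if_neg (hc.2 h), if_pos h]
    simp only [Expr.eval] at e1 ⊢
    rw [e1]
    simp [hs1]
  · rw [if_pos (not_not.1 fun h' => h (hc.1 h')), if_neg h, e3]

/-- The expansion of the pieces that the program finds. -/
noncomputable def expansion (n : ℕ) : ℝ := 1 / (36288 * (logNat n : ℝ) ^ 3)

/-- The parameters have their values, and the labels come from `L` levels. -/
structure InitInv (G : SimpleGraph (Fin n)) (L : ℕ) (s : LState) : Prop where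
  kappa : s.v 3 = logNat n
  sigma : s.v 4 = 18 * logNat n
  mass : s.v 5 = 16777216 * n ^ 5
  levels : ∃ comps, LevelInv G (expansion n) (18 * logNat n) L (s.lab n) comps

lemma run_level (hn : 0 < n) {L : ℕ} {s : LState} (h : InitInv G L s) (hL : s.v 6 = L) :
    InitInv G (L + 1) (level.run n (inputMat G) s) := by
  have : Nonempty (Fin n) := ⟨⟨0, hn⟩⟩
  obtain ⟨comps, hlev⟩ := h.levels
  set s1 := ((Cmd.fill 0 1 (.lit 0)).run n (inputMat G) s).setv 7 1 with hs1
  have hfr1 : SameFrame s s1 := (sameFrame_run _ (by decide) (by decide) (by decide) s).setv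
    (by norm_num) (by norm_num) 1
  have hcomp1 : s1.comp n = fun _ => 0 := by
    funext v
    refine ((Cmd.run_fill (n := n) (inp := inputMat G) (b := 0) (r := 1)
      (e := .lit 0) (by norm_num) (by decide) s).1 v v.2).trans ?_
    rfl
  have h71 : s1.v 7 = 1 := by simp [hs1]
  have hσ : 0 < s1.v 4 := by
    rw [hfr1.2.1, h.sigma]
    have := four_le_logNat n
    omega
  have hsymm : ∀ u w, s1.rest G u w = s1.rest G w u := by
    rw [hfr1.rest]
    exact rest_symm s hlev.symm
  obtain ⟨k1, k2, k3⟩ := run_passes (G := G) hσ hsymm (by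
    rw [hcomp1, h71]; exact partitionInv_zero _ _)
  have hrun : level.run n (inputMat G) s
      = relabel.run n (inputMat G) ((Cmd.loop 2 8 pass).run n (inputMat G) s1) := rfl
  set s2 := (Cmd.loop 2 8 pass).run n (inputMat G) s1 with hs2
  have hfr2 := hfr1.trans k1
  have hlab2 : s2.lab n = s.lab n := by
    funext u w
    simp only [LState.lab, hfr2.1]
  have hrest : s1.rest G = labMat G (s.lab n) 0 := hfr1.rest
  have hgood := goodPartition_of_stable (κ := logNat n) (t := bigBound n) (Fintype.card_fin n) hn
    (F := labMat G (s.lab n) 0) (labMat_symm hlev.symm 0) (labMat_le_one _ _) (labMat_self _ _)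
    (log_le_logNat hn) (four_le_logNat n) (logNat_le_mul hn) (by
      have := Nat.pow_le_pow_left (logNat_le_mul hn) 3
      have e1 : (5 * n) ^ 3 = 125 * (n * n * n) := by ring
      have e2 : bigBound n = 4194304 * (n * n * n) := by unfold bigBound; ring
      rw [e1] at this
      rw [e2]
      omega) (comp := s2.comp n) (cnt := s2.v 7) (by
        rw [hfr1.2.1, h.sigma, hrest] at k2
        exact k2) (by
        have := k3 hn
        rw [StableState, hfr2.2.1, hfr2.2.2, hfr2.rest, h.sigma, h.mass] at this
        exact this)
  have hv : ∀ x, x ∉ level.assigned → (level.run n (inputMat G) s).v x = s.v x :=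
    fun x hx => Cmd.run_v_of_not_mem level hx s
  have h62 : s2.v 6 = L := by
    rw [hs2, Cmd.run_v_of_not_mem _ (by decide), hs1, LState.setv_v, if_neg (by norm_num),
      Cmd.run_v_of_not_mem _ (by decide), hL]
  refine ⟨(hv 3 (by decide)).trans h.kappa, (hv 4 (by decide)).trans h.sigma,
    (hv 5 (by decide)).trans h.mass, Function.update comps L (s2.comp n), ?_⟩
  · rw [hrun, run_relabel, hlab2, h62]
    exact hlev.succ hgood

lemma eval_dbl (e : Expr) (s : LState) :
    (dbl e).eval n (inputMat G) s = 2 * e.eval n (inputMat G) s := by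
  rw [dbl, Expr.eval, two_mul]

/-- The preprocessing ends after `3 κ` levels; the loop idles for the rest of its rounds. -/
lemma run_init (hn : 0 < n) :
    InitInv G (3 * logNat n) (init.run n (inputMat G) (initialState n)) := by
  set s1 := (initialState n).setv 3 (logNat n) with hs1
  have e1 : (Expr.add (.div (.sum 20 (.div (.muln (.lit 1)) (.add (.var 20) (.lit 1))))
      (.muln (.lit 1))) (.lit 4)).eval n (inputMat G) (initialState n) = logNat n := by
    simp only [Expr.eval, logNat, Finset.sum_range]
    simp
  have e2 : (Expr.add (dbl (dbl (dbl (dbl (.var 3))))) (dbl (.var 3))).eval n (inputMat G) s1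
      = 18 * logNat n := by
    simp only [Expr.eval, eval_dbl, hs1, LState.setv_v, if_true]
    ring
  set s2 := s1.setv 4 (18 * logNat n) with hs2
  have e3 : (Expr.muln (.muln (.muln (.muln (.muln (.lit 16777216)))))).eval n (inputMat G) s2
      = 16777216 * n ^ 5 := by
    simp only [Expr.eval]
    ring
  set s3 := s2.setv 5 (16777216 * n ^ 5) with hs3
  have hrun : init.run n (inputMat G) (initialState n)
      = (Cmd.loop 2 6 (.ite (.sub (.add (.var 3) (dbl (.var 3))) (.var 6)) level
          (.assign 19 (.lit 0)))).run n (inputMat G) s3 := by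
    simp only [init, Cmd.run.eq_1, Cmd.run.eq_3, e1, ← hs1, e2, ← hs2, e3, ← hs3]
  rw [hrun]
  have h0 : InitInv G 0 s3 := by
    refine ⟨by simp [hs3, hs2, hs1], by simp [hs3, hs2, hs1], by simp [hs3, hs2, hs1],
      fun _ _ => 0, ?_⟩
    exact levelInv_zero _ _
  have := Cmd.run_loop (n := n) (inp := inputMat G) 2 6
    (.ite (.sub (.add (.var 3) (dbl (.var 3))) (.var 6)) level (.assign 19 (.lit 0))) s3
    (fun j s => InitInv G (min j (3 * logNat n)) s) (by simpa using h0) ?_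
  · have hb : 3 * logNat n ≤ loopBound n 2 := by
      have h1 := logNat_le_mul hn
      have h5 : n * 1 ≤ n * (n * n) := Nat.mul_le_mul_left n (Nat.mul_pos hn hn)
      have h6 : loopBound n 2 = 4194304 * (n * (n * n)) := by
        change 4194304 * n * n * n = _
        ring
      omega
    rwa [min_eq_right hb] at this
  · intro j hj s hs
    have hs' : InitInv G (min j (3 * logNat n)) (s.setv 6 j) := by
      refine ⟨?_, ?_, ?_, hs.levels⟩
      · simpa using hs.kappa
      · simpa using hs.sigma
      · simpa using hs.mass
    have hc : (Expr.sub (.add (.var 3) (dbl (.var 3))) (.var 6)).eval n (inputMat G) (s.setv 6 j)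
        = 3 * logNat n - j := by
      simp only [Expr.eval, eval_dbl, hs'.kappa]
      simp only [LState.setv_v, if_true]
      omega
    rw [Cmd.run_ite, hc]
    by_cases hlt : j < 3 * logNat n
    · rw [if_neg (by omega), min_eq_left (by omega : j + 1 ≤ _)]
      rw [min_eq_left hlt.le] at hs'
      exact run_level hn hs' (by simp)
    · rw [if_pos (by omega), min_eq_right (by omega)]
      rw [min_eq_right (by omega)] at hs'
      refine ⟨?_, ?_, ?_, hs'.levels⟩
      · simpa [Cmd.run] using hs'.kappa
      · simpa [Cmd.run] using hs'.sigma
      · simpa [Cmd.run] using hs'.mass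

/-! ### Correctness of the orientation step -/

/-- What the program maintains: the arrays `5` and `6` count the heads and tails of the arcs in each
piece. -/
def CountInv (lab : Fin n → Fin n → ℕ) {m : ℕ} (P : Fin m → G.Subgraph) (σ : OnlineRule G)
    (h : List (Edge G)) (s : LState) : Prop :=
  s.lab n = lab ∧ ∀ (i : Fin m) (v : Fin n),
    s.a 5 (((i : ℕ) + 1) * n + v) = (arcsIn σ (P i) h).countP (fun a => a.2 = v) ∧
    s.a 6 (((i : ℕ) + 1) * n + v) = (arcsIn σ (P i) h).countP (fun a => a.1 = v)

/-- `step` compares the discrepancies of `u` and `v` in the piece `l` of the edge, without subtractions,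
and counts the new arc. -/
lemma run_step {s : LState} {u v : Fin n} :
    let s' := step.run n (inputMat G) ((s.setv 1 u).setv 2 v)
    let l := s.lab n u v
    s'.a 0 = s.a 0 ∧
    (s.a 5 (l * n + v) + s.a 6 (l * n + u) ≤ s.a 5 (l * n + u) + s.a 6 (l * n + v) →
      s'.v 0 = 1 ∧
      (∀ i, s'.a 5 i = s.a 5 i + if i = l * n + v then 1 else 0) ∧
      (∀ i, s'.a 6 i = s.a 6 i + if i = l * n + u then 1 else 0)) ∧
    (¬ s.a 5 (l * n + v) + s.a 6 (l * n + u) ≤ s.a 5 (l * n + u) + s.a 6 (l * n + v) →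
      s'.v 0 = 0 ∧
      (∀ i, s'.a 5 i = s.a 5 i + if i = l * n + u then 1 else 0) ∧
      (∀ i, s'.a 6 i = s.a 6 i + if i = l * n + v then 1 else 0)) := by
  intro s' l
  set s0 := (s.setv 1 u).setv 2 v with hs0
  have e14 : (Expr.get 0 (.cell (.var 1) (.var 2))).eval n (inputMat G) s0 = l := by
    simp [Expr.eval, Expr.cell, hs0, l, LState.lab]
  set s1 := s0.setv 14 l with hs1
  have e15 : (Expr.cell (.var 14) (.var 1)).eval n (inputMat G) s1 = l * n + u := by
    simp [Expr.eval, Expr.cell, hs1, hs0]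
  set s2 := s1.setv 15 (l * n + u) with hs2
  have e16 : (Expr.cell (.var 14) (.var 2)).eval n (inputMat G) s2 = l * n + v := by
    simp [Expr.eval, Expr.cell, hs2, hs1, hs0]
  set s3 := s2.setv 16 (l * n + v) with hs3
  have hrun : s' = (Cmd.ite (.le (.add (.get 5 (.var 16)) (.get 6 (.var 15)))
      (.add (.get 5 (.var 15)) (.get 6 (.var 16))))
    (.seq (.assign 0 (.lit 1)) <|
      .seq (.store 6 (.var 15) (.add (.get 6 (.var 15)) (.lit 1)))
        (.store 5 (.var 16) (.add (.get 5 (.var 16)) (.lit 1))))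
    (.seq (.assign 0 (.lit 0)) <|
      .seq (.store 6 (.var 16) (.add (.get 6 (.var 16)) (.lit 1)))
        (.store 5 (.var 15) (.add (.get 5 (.var 15)) (.lit 1))))).run n (inputMat G) s3 := by
    change step.run n (inputMat G) s0 = _
    simp only [step]
    simp only [Cmd.run.eq_1, Cmd.run.eq_3, e14, ← hs1, e15, ← hs2, e16, ← hs3]
  have hle : (Expr.le (.add (.get 5 (.var 16)) (.get 6 (.var 15)))
      (.add (.get 5 (.var 15)) (.get 6 (.var 16)))).eval n (inputMat G) s3 =
      if s.a 5 (l * n + v) + s.a 6 (l * n + u) ≤ s.a 5 (l * n + u) + s.a 6 (l * n + v)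
        then 1 else 0 := by
    rw [Expr.eval_le]
    simp [Expr.eval, hs3, hs2, hs1, hs0]
  rw [Cmd.run_ite, hle] at hrun
  refine ⟨?_, fun h => ?_, fun h => ?_⟩
  · change (step.run n (inputMat G) s0).a 0 = _
    rw [Cmd.run_a_of_not_mem _ (by decide)]
    rfl
  · rw [if_pos h, if_neg one_ne_zero] at hrun
    rw [hrun]
    simp only [Cmd.run.eq_1, Cmd.run.eq_2, Cmd.run.eq_3, Expr.eval]
    refine ⟨by simp, fun i => ?_, fun i => ?_⟩
    · by_cases hi : i = l * n + v <;> simp [LState.seta_a, hs3, hs2, hs1, hs0, hi]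
    · by_cases hi : i = l * n + u <;> simp [LState.seta_a, hs3, hs2, hs1, hs0, hi]
  · rw [if_neg h, if_pos rfl] at hrun
    rw [hrun]
    simp only [Cmd.run.eq_1, Cmd.run.eq_2, Cmd.run.eq_3, Expr.eval]
    refine ⟨by simp, fun i => ?_, fun i => ?_⟩
    · by_cases hi : i = l * n + u <;> simp [LState.seta_a, hs3, hs2, hs1, hs0, hi]
    · by_cases hi : i = l * n + v <;> simp [LState.seta_a, hs3, hs2, hs1, hs0, hi]

/-- The rule that the program carries out. -/
noncomputable def rule (G : SimpleGraph (Fin n)) : OnlineRule G := ruleOf init step G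

lemma disc_le_disc_iff (A : List (Fin n × Fin n)) (u v : Fin n) : disc A v ≤ disc A u ↔
    A.countP (fun a => a.2 = v) + A.countP (fun a => a.1 = u)
      ≤ A.countP (fun a => a.2 = u) + A.countP (fun a => a.1 = v) := by
  unfold disc
  omega

lemma countInv_stateAfter {L : ℕ} {lab : Fin n → Fin n → ℕ} {comps : ℕ → Fin n → ℕ}
    {α : ℝ} {σ : ℕ} (hlev : LevelInv G α σ L lab comps)
    (hlab : (stateAfter init step G []).lab n = lab) (h : List (Edge G)) :
    CountInv lab (labPiece hlev) (rule G) h (stateAfter init step G h) := by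
  induction h with
  | nil =>
    refine ⟨hlab, fun i v => ?_⟩
    have h5 : (stateAfter init step G []).a 5 = (initialState n).a 5 :=
      Cmd.run_a_of_not_mem init (by decide) _
    have h6 : (stateAfter init step G []).a 6 = (initialState n).a 6 :=
      Cmd.run_a_of_not_mem init (by decide) _
    rw [h5, h6]
    simp [arcsIn, arcs, initialState]
  | cons e h ih =>
    obtain ⟨ih1, ih2⟩ := ih
    obtain ⟨r1, r2, r3⟩ := run_step (G := G) (s := stateAfter init step G h) (u := e.1.1)
      (v := e.1.2)
    set s := stateAfter init step G h with hs
    have hst : stateAfter init step G (e :: h)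
        = step.run n (inputMat G) ((s.setv 1 (e.1.1 : ℕ)).setv 2 (e.1.2 : ℕ)) := rfl
    rw [← hst] at r1 r2 r3
    rw [ih1] at r2 r3
    refine ⟨?_, fun i v => ?_⟩
    · rw [← ih1]
      funext u w
      simp only [LState.lab, r1]
    have hrule : rule G h e = decide ((stateAfter init step G (e :: h)).v 0 ≠ 0) := rfl
    obtain ⟨c5, c6⟩ := ih2 i v
    by_cases hadj : (labPiece hlev i).Adj e.1.1 e.1.2
    · have hl : lab e.1.1 e.1.2 = (i : ℕ) + 1 := hadj.2
      rw [hl] at r2 r3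
      have hval : ∀ w : Fin n, (v : ℕ) = w ↔ w = v := fun w => by rw [Fin.ext_iff, eq_comm]
      rw [arcsIn_cons_of_adj _ hadj, List.countP_cons, List.countP_cons, newArc, hrule]
      by_cases hc : s.a 5 (((i : ℕ) + 1) * n + e.1.2) + s.a 6 (((i : ℕ) + 1) * n + e.1.1)
          ≤ s.a 5 (((i : ℕ) + 1) * n + e.1.1) + s.a 6 (((i : ℕ) + 1) * n + e.1.2)
      · obtain ⟨d1, d2, d3⟩ := r2 hc
        rw [d2, d3, d1, c5, c6]
        simp [hval]
      · obtain ⟨d1, d2, d3⟩ := r3 hc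
        rw [d2, d3, d1, c5, c6]
        simp [hval]
    · rw [arcsIn_cons_of_not_adj _ hadj, ← c5, ← c6]
      have hne : lab e.1.1 e.1.2 ≠ (i : ℕ) + 1 := fun h => hadj ⟨e.2.2, h⟩
      have hcell : ∀ w : Fin n, ((i : ℕ) + 1) * n + v ≠ lab e.1.1 e.1.2 * n + w :=
        fun w h => hne (cell_inj h).1.symm
      by_cases hc : s.a 5 (lab e.1.1 e.1.2 * n + e.1.2) + s.a 6 (lab e.1.1 e.1.2 * n + e.1.1)
          ≤ s.a 5 (lab e.1.1 e.1.2 * n + e.1.1) + s.a 6 (lab e.1.1 e.1.2 * n + e.1.2)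
      · obtain ⟨d1, d2, d3⟩ := r2 hc
        rw [d2, d3]
        simp [hcell]
      · obtain ⟨d1, d2, d3⟩ := r3 hc
        rw [d2, d3]
        simp [hcell]

/-- The program decomposes the graph and is greedy on each piece. -/
theorem exists_decomposition (G : SimpleGraph (Fin n)) (hn : 2 ≤ n) {α K : ℝ} (hα : 0 ≤ α)
    (hα' : α ≤ expansion n) (hK : (3 * logNat n : ℕ) ≤ K) :
    ∃ (m : ℕ) (P : Fin m → G.Subgraph),
      IsExpanderDecomposition P α K ∧ IsPiecewiseGreedy (rule G) P := by
  obtain ⟨comps, hlev⟩ := (run_init (G := G) (by omega)).levels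
  have hκ : (4 : ℝ) ≤ logNat n := by exact_mod_cast four_le_logNat n
  refine ⟨_, labPiece hlev, hlev.isExpanderDecomposition (sq_lt_two_pow_logNat (by omega)) hα hα' ?_
    hK, fun h e i hadj => ?_⟩
  · have h1 : expansion n * (18 * logNat n : ℕ) ≤ 4 := by
      rw [expansion, div_mul_eq_mul_div, one_mul, div_le_iff₀ (by positivity)]
      push_cast
      nlinarith [sq_nonneg (logNat n : ℝ), pow_le_pow_right₀ (by linarith : (1 : ℝ) ≤ logNat n)
        (by norm_num : 1 ≤ 3)]
    exact le_trans (mul_le_mul_of_nonneg_right hα' (by positivity)) h1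
  · obtain ⟨ih1, ih2⟩ := countInv_stateAfter hlev rfl h
    obtain ⟨-, r2, r3⟩ := run_step (G := G) (s := stateAfter init step G h) (u := e.1.1)
      (v := e.1.2)
    have hst : stateAfter init step G (e :: h) = step.run n (inputMat G)
      (((stateAfter init step G h).setv 1 (e.1.1 : ℕ)).setv 2 (e.1.2 : ℕ)) := rfl
    rw [← hst] at r2 r3
    have hl : (stateAfter init step G h).lab n e.1.1 e.1.2 = (i : ℕ) + 1 := by
      rw [ih1]; exact hadj.2
    have hrule : rule G h e = decide ((stateAfter init step G (e :: h)).v 0 ≠ 0) := rfl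
    rw [hl, (ih2 i _).1, (ih2 i _).1, (ih2 i _).2, (ih2 i _).2, ← disc_le_disc_iff] at r2 r3
    by_cases hc : disc (arcsIn (rule G) (labPiece hlev i) h) e.1.2
        ≤ disc (arcsIn (rule G) (labPiece hlev i) h) e.1.1
    · rw [hrule, (r2 hc).1]
      simpa using hc
    · rw [hrule, (r3 hc).1]
      simpa using (not_le.1 hc).le

end Program

end Levels


/-! ### The parameters -/

lemma logNat_le_nine_mul {n : ℕ} (hn : 2 ≤ n) : (logNat n : ℝ) ≤ 9 * Real.log n := by
  have h1 := logNat_le (by omega : 0 < n)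
  have h2 : Real.log 2 ≤ Real.log n := Real.log_le_log (by norm_num) (by exact_mod_cast hn)
  linarith [Real.log_two_gt_d9]

lemma log_ge {n : ℕ} (hn : 2 ≤ n) : 0.69 ≤ Real.log n := by
  have h2 : Real.log 2 ≤ Real.log n := Real.log_le_log (by norm_num) (by exact_mod_cast hn)
  linarith [Real.log_two_gt_d9]

lemma Program.expansion_pos (n : ℕ) : 0 < Program.expansion n := by
  have h4 : (4 : ℝ) ≤ logNat n := by exact_mod_cast four_le_logNat n
  unfold Program.expansion
  positivity

lemma Program.expansion_le_one (n : ℕ) : Program.expansion n ≤ 1 := by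
  have h4 : (4 : ℝ) ≤ logNat n := by exact_mod_cast four_le_logNat n
  have h5 := one_le_pow₀ (by linarith : (1 : ℝ) ≤ logNat n) (n := 3)
  rw [Program.expansion, div_le_one (by positivity)]
  linarith

lemma Program.le_expansion {n : ℕ} (hn : 2 ≤ n) :
    1 / 10 ^ 9 / Real.log n ^ 8 ≤ Program.expansion n := by
  have h4 : (4 : ℝ) ≤ logNat n := by exact_mod_cast four_le_logNat n
  have hl := log_ge hn
  have h1 : (logNat n : ℝ) ^ 3 ≤ (9 * Real.log n) ^ 3 :=
    pow_le_pow_left₀ (by linarith) (logNat_le_nine_mul hn) 3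
  have h2 : (0.69 : ℝ) ^ 5 ≤ Real.log n ^ 5 := pow_le_pow_left₀ (by norm_num) hl 5
  have h3 : (0 : ℝ) < Real.log n ^ 3 := by positivity
  rw [Program.expansion, div_div, div_le_div_iff₀ (by positivity) (by positivity)]
  have e : Real.log n ^ 8 = Real.log n ^ 3 * Real.log n ^ 5 := by ring
  have h5 : Real.log n ^ 3 * 0.69 ^ 5 ≤ Real.log n ^ 3 * Real.log n ^ 5 := by gcongr
  rw [mul_pow] at h1
  rw [e]
  norm_num at h1 h5 ⊢
  linarith

lemma three_logNat_le {n : ℕ} (hn : 2 ≤ n) :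
    ((3 * logNat n : ℕ) : ℝ) ≤ 10 ^ 4 * Real.log n ^ 8 := by
  have hl := log_ge hn
  have h1 := logNat_le_nine_mul hn
  have h2 : (0.69 : ℝ) ^ 7 ≤ Real.log n ^ 7 := pow_le_pow_left₀ (by norm_num) hl 7
  have h3 : Real.log n * 0.69 ^ 7 ≤ Real.log n * Real.log n ^ 7 := by gcongr
  have e : Real.log n ^ 8 = Real.log n * Real.log n ^ 7 := by ring
  rw [e]
  push_cast
  norm_num at h3 ⊢
  linarith

/-- The discrepancy bound for the algorithm. -/
lemma failureProb_rule_le {n : ℕ} (G : SimpleGraph (Fin n)) {T : ℕ} (hn : 2 ≤ n) (hT : 1 ≤ T)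
    (c : ℕ) : failureProb (Program.rule G) T
      (135 * (c + 5) * 36288 ^ 2 * 9 ^ 6 * Real.log ((n : ℝ) * T) ^ 8) ≤ 1 / ((n : ℝ) * T) ^ c := by
  obtain ⟨m, P, hP, hg⟩ := Program.exists_decomposition G hn (Program.expansion_pos n).le le_rfl
    (le_refl ((3 * logNat n : ℕ) : ℝ))
  refine failureProb_le_of_decomposition hg (Program.expansion_pos n) (Program.expansion_le_one n)
    hP hn hT c ?_
  have h4 : (4 : ℝ) ≤ logNat n := by exact_mod_cast four_le_logNat n
  have hl := log_ge hn
  set l := Real.log ((n : ℝ) * T) with hlT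
  have hll : Real.log n ≤ l := by
    refine Real.log_le_log (by exact_mod_cast (by omega : 0 < n)) ?_
    exact le_mul_of_one_le_right (by positivity) (by exact_mod_cast hT)
  have hκ : (logNat n : ℝ) ≤ 9 * l := (logNat_le_nine_mul hn).trans (by linarith)
  have hl0 : 0 < l := by linarith
  calc 5 * (c + 5) * ((3 * logNat n : ℕ) : ℝ) * l / Program.expansion n ^ 2
      = 15 * (c + 5) * 36288 ^ 2 * ((logNat n : ℝ) ^ 7 * l) := by
        unfold Program.expansion
        push_cast
        field_simp
        ring
    _ ≤ 15 * (c + 5) * 36288 ^ 2 * ((9 * l) ^ 7 * l) := by gcongr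
    _ = 135 * (c + 5) * 36288 ^ 2 * 9 ^ 6 * l ^ 8 := by ring

/-- The explicit discrepancy bound. -/
lemma failureProb_explicit_le {n : ℕ} {G : SimpleGraph (Fin n)} {m : ℕ} {P : Fin m → G.Subgraph}
    {σ : OnlineRule G} {T : ℕ} (hn : 2 ≤ n) (hT : 1 ≤ T)
    (hP : IsExpanderDecomposition P (1 / 162 / Real.log n) (50 * Real.log n ^ 2))
    (hσ : IsPiecewiseGreedy σ P) (c : ℕ) :
    failureProb σ T (1500 * (c + 5) * 162 ^ 2 * (Real.log n ^ 7 + Real.log T ^ 5))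
      ≤ 1 / ((n : ℝ) * T) ^ c := by
  have hl := log_ge hn
  have hl0 : 0 < Real.log n := by linarith
  have ht : 0 ≤ Real.log T := Real.log_nonneg (by exact_mod_cast hT)
  refine failureProb_le_of_decomposition hσ (by positivity) ?_ hP hn hT c ?_
  · rw [div_div, div_le_one (by positivity)]
    linarith
  rw [Real.log_mul (by exact_mod_cast (by omega : n ≠ 0)) (by exact_mod_cast (by omega : T ≠ 0))]
  set l := Real.log n
  set t := Real.log T
  have h1 : l ^ 4 * t ≤ l ^ 5 + t ^ 5 := by
    rcases le_total t l with h | h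
    · have : l ^ 4 * t ≤ l ^ 4 * l := by gcongr
      have h5 : 0 ≤ t ^ 5 := by positivity
      linarith [show l ^ 4 * l = l ^ 5 by ring]
    · have : l ^ 4 * t ≤ t ^ 4 * t := by gcongr
      have h5 : 0 ≤ l ^ 5 := by positivity
      linarith [show t ^ 4 * t = t ^ 5 by ring]
  have h2 : l ^ 5 ≤ 3 * l ^ 7 := by
    have h3 : (1 : ℝ) ≤ 3 * l ^ 2 := by nlinarith
    calc l ^ 5 = l ^ 5 * 1 := by ring
      _ ≤ l ^ 5 * (3 * l ^ 2) := by gcongr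
      _ = 3 * l ^ 7 := by ring
  have h5 : 0 ≤ t ^ 5 := by positivity
  calc 5 * (c + 5) * (50 * l ^ 2) * (l + t) / (1 / 162 / l) ^ 2
      = 250 * (c + 5) * 162 ^ 2 * (l ^ 5 + l ^ 4 * t) := by
        field_simp
        ring
    _ ≤ 250 * (c + 5) * 162 ^ 2 * (6 * (l ^ 7 + t ^ 5)) := by
        gcongr
        linarith
    _ = 1500 * (c + 5) * 162 ^ 2 * (l ^ 7 + t ^ 5) := by ring

/-- Every graph has an expander decomposition with expansion `Ω(1 / log n)`. -/
lemma exists_decomposition_log {n : ℕ} (G : SimpleGraph (Fin n)) (hn : 2 ≤ n) :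
    ∃ (m : ℕ) (P : Fin m → G.Subgraph),
      IsExpanderDecomposition P (1 / 162 / Real.log n) (50 * Real.log n ^ 2) := by
  have hl := log_ge hn
  have hκ := logNat_le_nine_mul hn
  have h4 := four_le_logNat n
  refine exists_isExpanderDecomposition G (σ := 18 * logNat n) (L := 3 * logNat n) (by omega) ?_
    (by omega) (sq_lt_two_pow_logNat (by omega)) (by positivity) ?_ ?_
  · push_cast
    linarith [log_le_logNat (by omega : 0 < n)]
  · rw [div_div, div_mul_eq_mul_div, one_mul, div_le_one (by positivity)]
    push_cast
    linarith
  · push_cast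
    nlinarith

end EdgeOrientation

open EdgeOrientation
theorem theorem1 :
    -- an efficient algorithm: decomposition into expanders and greedy on each piece
    (∃ (A : OnlineAlgorithm) (σ : ∀ (n : ℕ) (G : SimpleGraph (Fin n)), OnlineRule G) (d k : ℕ)
        (a b : ℝ), 0 < a ∧ 0 < b ∧
      (∀ (n : ℕ) (G : SimpleGraph (Fin n)), A.ComputesInTime G (σ n G) d) ∧
      (∀ (n : ℕ) (G : SimpleGraph (Fin n)), 2 ≤ n →
        ∃ (m : ℕ) (P : Fin m → G.Subgraph),
          IsExpanderDecomposition P (a / Real.log n ^ k) (b * Real.log n ^ k) ∧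
          IsPiecewiseGreedy (σ n G) P) ∧
      ∀ c : ℕ, ∃ C : ℝ, 0 < C ∧
        ∀ (n : ℕ) (G : SimpleGraph (Fin n)) (T : ℕ), 2 ≤ n → 1 ≤ T →
          failureProb (σ n G) T (C * Real.log ((n : ℝ) * T) ^ k) ≤ 1 / ((n : ℝ) * T) ^ c) ∧
    -- the explicit bound
    (∃ a b : ℝ, 0 < a ∧ 0 < b ∧
      (∀ (n : ℕ) (G : SimpleGraph (Fin n)), 2 ≤ n →
        ∃ (m : ℕ) (P : Fin m → G.Subgraph),
          IsExpanderDecomposition P (a / Real.log n) (b * Real.log n ^ 2)) ∧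
      ∀ c : ℕ, ∃ C : ℝ, 0 < C ∧
        ∀ (n : ℕ) (G : SimpleGraph (Fin n)) (m : ℕ) (P : Fin m → G.Subgraph)
          (σ : OnlineRule G) (T : ℕ), 2 ≤ n → 1 ≤ T →
          IsExpanderDecomposition P (a / Real.log n) (b * Real.log n ^ 2) →
          IsPiecewiseGreedy σ P →
          failureProb σ T (C * (Real.log n ^ 7 + Real.log T ^ 5)) ≤ 1 / ((n : ℝ) * T) ^ c) := by
  obtain ⟨d, hd⟩ := machine_computesInTime Program.init Program.step Program.init_wf
    Program.step_wf
  refine ⟨⟨machine Program.init Program.step, fun n G => Program.rule G, d, 8, 1 / 10 ^ 9, 10 ^ 4,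
    by norm_num, by norm_num, hd, fun n G hn => ?_, fun c => ?_⟩, 1 / 162, 50, by norm_num,
    by norm_num, fun n G hn => exists_decomposition_log G hn, fun c => ?_⟩
  · have := log_ge hn
    exact Program.exists_decomposition G hn (by positivity) (Program.le_expansion hn)
      (three_logNat_le hn)
  · exact ⟨135 * (c + 5) * 36288 ^ 2 * 9 ^ 6, by positivity,
      fun n G T hn hT => failureProb_rule_le G hn hT c⟩
  · exact ⟨1500 * (c + 5) * 162 ^ 2, by positivity,
      fun n G m P σ T hn hT hP hσ => failureProb_explicit_le hn hT hP hσ c⟩
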